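/- Let $\omega_{\mathrm{can}}=\mathrm dx_1\wedge \mathrm dy_1+\mathrm dx_2\wedge \mathrm dy_2$ on $\mathbb R^4$ and let $q=(q_1,q_2):\mathbb R^4\to\mathbb R^2$ be the focus-focus model $$q_1=x_1y_2-x_2y_1,\qquad q_2=x_1y_1+x_2y_2 .$$ Let $\mathrm{Aut}=\mathrm{Aut}((\mathbb R^4,0),\omega_{\mathrm{can}},q)$ be the group of germs at $0$ of ($C^\infty$) symplectomorphisms $\varphi$ of $(\mathbb R^4,0)$ for which there is a germ of local ($C^\infty$) diffeomorphism $g$ of $(\mathbb R^2,0)$ with $q\circ\varphi=g\circ q$. Let $G$ be the group of germs of local diffeomorphisms of $(\mathbb R^2,0)$ of the form $g(a,b)=(\epsilon_1 a,\ \epsilon_2 b+h(a,b))$, where $\epsilon_1,\epsilon_2\in\{\pm1\}$ and $h$ is a flat function, i.e. smooth near $(0,0)$ with zero Taylor series at $(0,0)$. **Proposition.** (i) A germ $g$ of local diffeomorphism of $(\mathbb R^2,0)$ satisfies $q\circ\varphi=g\circ q$ for some germ $\varphi$ of symplectomorphism of $(\mathbb R^4,0)$ if and only if $g\in G$. (ii)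 For every $\varphi\in\mathrm{Aut}$ the germ $g$ with $q\circ\varphi=g\circ q$ is unique, and $\varphi\mapsto g$ is a surjective group homomorphism $\mathrm{Aut}\to G$. (iii) The sign changes $g_\epsilon(a,b)=(\epsilon_1a,\epsilon_2b)$, $\epsilon=(\epsilon_1,\epsilon_2)\in\{\pm1\}^2$, which form a Klein four-group in $G$, are the images of explicit linear symplectomorphisms. Let $$A_{(-1,1)}(x_1,y_1,x_2,y_2)=(x_2,y_2,x_1,y_1),\qquad A_{(1,-1)}(x_1,y_1,x_2,y_2)=(y_1,-x_1,y_2,-x_2),$$ $A_{(1,1)}=\mathrm{id}$ and $A_{(-1,-1)}=A_{(-1,1)}\circ A_{(1,-1)}$. Then each $A_\epsilon$ is a linear symplectomorphism of $(\mathbb R^4,\omega_{\mathrm{can}})$ with $q\circ A_\epsilon=g_\epsilon\circ q$ on $\mathbb R^4$, so its germ lies in $\mathrm{Aut}$ and is mapped to $g_\epsilon$. The $A_\epsilon$ commute with each other, and $\epsilon\mapsto \pm A_\epsilon$ is an injective homomorphism $\{\pm1\}^2\to \mathrm{Sp}(4,\mathbb R)/\{\pm \mathrm{id}\}$. -/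

import Mathlib

open Filter Topology
open scoped ContDiff

namespace FocusFocus

/-! ### Germs of smooth maps `(E, 0) → (E, 0)` and of local diffeomorphisms -/

section Germs

variable (E : Type*) [NormedAddCommGroup E] [NormedSpace ℝ E]

/-- A map `E → E` that fixes the origin and is `C^∞` on some neighbourhood of it
(its values away from that neighbourhood are irrelevant). -/
structure PointedMap where
  toFun : E → E
  map_zero : toFun 0 = 0
  smooth : ∀ᶠ x in 𝓝 (0 : E), ContDiffAt ℝ ∞ toFun x

variable {E}

theorem PointedMap.continuousAt (f : PointedMap E) : ContinuousAt f.toFun 0 :=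
  f.smooth.self_of_nhds.continuousAt

theorem PointedMap.tendsto (f : PointedMap E) : Tendsto f.toFun (𝓝 0) (𝓝 0) := by
  have h := f.continuousAt.tendsto
  rwa [f.map_zero] at h

/-- Composition `f ∘ g`. -/
def PointedMap.comp (f g : PointedMap E) : PointedMap E where
  toFun := f.toFun ∘ g.toFun
  map_zero := by simp [f.map_zero, g.map_zero]
  smooth := by
    filter_upwards [g.smooth, g.tendsto.eventually f.smooth] with x hg hf
    exact hf.comp x hg

/-- A continuous linear map, as a pointed map. -/
def PointedMap.ofLinear (L : E →L[ℝ] E) : PointedMap E where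
  toFun := L
  map_zero := by simp
  smooth := Eventually.of_forall fun _ => L.contDiff.contDiffAt

variable (E)

/-- Two maps have the same germ at the origin if they agree on a neighbourhood of it. -/
instance germSetoid : Setoid (PointedMap E) where
  r f g := f.toFun =ᶠ[𝓝 0] g.toFun
  iseqv := ⟨fun _ => EventuallyEq.rfl, fun h => h.symm, fun h h' => h.trans h'⟩

/-- Germs at the origin of smooth maps `(E, 0) → (E, 0)`. -/
def SmoothGerm : Type _ := Quotient (germSetoid E)

variable {E}

/-- The germ of a pointed map. -/
def germ (f : PointedMap E) : SmoothGerm E := Quotient.mk (germSetoid E) f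

theorem germ_eq_iff {f g : PointedMap E} : germ f = germ g ↔ f.toFun =ᶠ[𝓝 0] g.toFun :=
  Quotient.eq (r := germSetoid E)

theorem germ_surj (φ : SmoothGerm E) : ∃ f, germ f = φ := Quotient.exists_rep φ

/-- Germs form a monoid under composition: `germ f * germ g` is the germ of `f ∘ g`. -/
instance : Monoid (SmoothGerm E) where
  mul := Quotient.map₂ PointedMap.comp (by
    intro f f' hf g g' hg
    have h1 : ∀ᶠ x in 𝓝 (0 : E), f.toFun (g.toFun x) = f'.toFun (g.toFun x) :=
      g.tendsto.eventually hf
    have h2 : ∀ᶠ x in 𝓝 (0 : E), g.toFun x = g'.toFun x := hg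
    change ∀ᶠ x in 𝓝 (0 : E), f.toFun (g.toFun x) = f'.toFun (g'.toFun x)
    filter_upwards [h1, h2] with x h1 h2
    rw [h1, h2])
  one := germ (PointedMap.ofLinear (ContinuousLinearMap.id ℝ E))
  mul_assoc := by
    rintro ⟨f⟩ ⟨g⟩ ⟨h⟩
    rfl
  one_mul := by
    rintro ⟨f⟩
    rfl
  mul_one := by
    rintro ⟨f⟩
    rfl

theorem germ_mul (f g : PointedMap E) : germ f * germ g = germ (f.comp g) := rfl

theorem germ_one : (1 : SmoothGerm E) =
    germ (PointedMap.ofLinear (ContinuousLinearMap.id ℝ E)) := rfl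

variable (E)

/-- The group of germs of local diffeomorphisms of `(E, 0)`: the germs of smooth maps
`(E, 0) → (E, 0)` that have a two-sided inverse germ of the same kind. -/
abbrev DiffeoGerm : Type _ := (SmoothGerm E)ˣ

variable {E}

/-- The germ at the origin of a linear automorphism. -/
def linearGerm (A : E ≃L[ℝ] E) : DiffeoGerm E where
  val := germ (PointedMap.ofLinear (A : E →L[ℝ] E))
  inv := germ (PointedMap.ofLinear (A.symm : E →L[ℝ] E))
  val_inv := germ_eq_iff.2 <| Eventually.of_forall fun x => by
    simp [PointedMap.ofLinear, PointedMap.comp]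
  inv_val := germ_eq_iff.2 <| Eventually.of_forall fun x => by
    simp [PointedMap.ofLinear, PointedMap.comp]

end Germs

/-! ### The focus-focus model -/

/-- `ℝ⁴` with coordinates `(x₁, y₁, x₂, y₂)`. -/
abbrev R4 : Type := Fin 4 → ℝ

/-- `ℝ²` with coordinates `(a, b)`. -/
abbrev R2 : Type := Fin 2 → ℝ

/-- The canonical symplectic form `dx₁ ∧ dy₁ + dx₂ ∧ dy₂`. -/
def omegaCan (u v : R4) : ℝ := (u 0 * v 1 - u 1 * v 0) + (u 2 * v 3 - u 3 * v 2)

/-- The focus-focus model `q = (q₁, q₂)`, `q₁ = x₁ y₂ - x₂ y₁`, `q₂ = x₁ y₁ + x₂ y₂`. -/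
def q (x : R4) : R2 := ![x 0 * x 3 - x 2 * x 1, x 0 * x 1 + x 2 * x 3]

theorem q_tendsto : Tendsto q (𝓝 0) (𝓝 0) := by
  have h : Continuous q := by
    unfold q
    fun_prop
  have h0 : q 0 = 0 := by
    ext i
    fin_cases i <;> simp [q]
  simpa [h0] using h.tendsto 0

/-- The germ `φ` satisfies `φ^* ω_can = ω_can` near the origin. -/
def IsSymplectic (φ : SmoothGerm R4) : Prop :=
  Quotient.liftOn φ
    (fun f => ∀ᶠ x in 𝓝 (0 : R4), ∀ u v : R4,
      omegaCan (fderiv ℝ f.toFun x u) (fderiv ℝ f.toFun x v) = omegaCan u v)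
    (by
      have key : ∀ f g : PointedMap R4, f.toFun =ᶠ[𝓝 0] g.toFun →
          (∀ᶠ x in 𝓝 (0 : R4), ∀ u v : R4,
            omegaCan (fderiv ℝ f.toFun x u) (fderiv ℝ f.toFun x v) = omegaCan u v) →
          ∀ᶠ x in 𝓝 (0 : R4), ∀ u v : R4,
            omegaCan (fderiv ℝ g.toFun x u) (fderiv ℝ g.toFun x v) = omegaCan u v := by
        intro f g h hf
        filter_upwards [h.fderiv (𝕜 := ℝ), hf] with x h1 h2
        rw [← h1]
        exact h2
      intro f g h
      exact propext ⟨key f g h, key g f (EventuallyEq.symm h)⟩)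

theorem isSymplectic_germ (f : PointedMap R4) : IsSymplectic (germ f) ↔
    ∀ᶠ x in 𝓝 (0 : R4), ∀ u v : R4,
      omegaCan (fderiv ℝ f.toFun x u) (fderiv ℝ f.toFun x v) = omegaCan u v := Iff.rfl

/-- The relation `q ∘ φ = g ∘ q` between germs at the origin of `ℝ⁴`. -/
def Intertwines (φ : SmoothGerm R4) (g : SmoothGerm R2) : Prop :=
  Quotient.liftOn₂ φ g
    (fun f k => ∀ᶠ x in 𝓝 (0 : R4), q (f.toFun x) = k.toFun (q x))
    (by
      have key : ∀ (f f' : PointedMap R4) (k k' : PointedMap R2), f.toFun =ᶠ[𝓝 0] f'.toFun →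
          k.toFun =ᶠ[𝓝 0] k'.toFun →
          (∀ᶠ x in 𝓝 (0 : R4), q (f.toFun x) = k.toFun (q x)) →
          ∀ᶠ x in 𝓝 (0 : R4), q (f'.toFun x) = k'.toFun (q x) := by
        intro f f' k k' hf hk h
        filter_upwards [hf, q_tendsto.eventually hk, h] with x h1 h2 h3
        rw [← h1, h3, h2]
      intro f k f' k' hf hk
      exact propext ⟨key f f' k k' hf hk,
        key f' f k' k (EventuallyEq.symm hf) (EventuallyEq.symm hk)⟩)

theorem intertwines_germ (f : PointedMap R4) (k : PointedMap R2) :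
    Intertwines (germ f) (germ k) ↔
      ∀ᶠ x in 𝓝 (0 : R4), q (f.toFun x) = k.toFun (q x) := Iff.rfl

theorem IsSymplectic.one : IsSymplectic 1 := by
  rw [germ_one, isSymplectic_germ]
  refine Eventually.of_forall fun x u v => ?_
  simp [PointedMap.ofLinear]

theorem IsSymplectic.mul {φ ψ : SmoothGerm R4} (hφ : IsSymplectic φ) (hψ : IsSymplectic ψ) :
    IsSymplectic (φ * ψ) := by
  obtain ⟨f, rfl⟩ := germ_surj φ
  obtain ⟨g, rfl⟩ := germ_surj ψ
  rw [isSymplectic_germ] at hφ hψ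
  rw [germ_mul, isSymplectic_germ]
  filter_upwards [g.tendsto.eventually hφ, hψ, g.smooth, g.tendsto.eventually f.smooth]
    with x h1 h2 h3 h4 u v
  have e : fderiv ℝ (f.toFun ∘ g.toFun) x
      = (fderiv ℝ f.toFun (g.toFun x)).comp (fderiv ℝ g.toFun x) :=
    fderiv_comp x (h4.differentiableAt (by simp)) (h3.differentiableAt (by simp))
  change omegaCan (fderiv ℝ (f.toFun ∘ g.toFun) x u) (fderiv ℝ (f.toFun ∘ g.toFun) x v) = _
  rw [e]
  simp only [ContinuousLinearMap.comp_apply]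
  rw [h1, h2]

theorem IsSymplectic.of_mul {φ ψ : SmoothGerm R4} (hφ : IsSymplectic φ)
    (h : IsSymplectic (φ * ψ)) : IsSymplectic ψ := by
  obtain ⟨f, rfl⟩ := germ_surj φ
  obtain ⟨g, rfl⟩ := germ_surj ψ
  rw [isSymplectic_germ] at hφ
  rw [germ_mul, isSymplectic_germ] at h
  rw [isSymplectic_germ]
  filter_upwards [g.tendsto.eventually hφ, h, g.smooth, g.tendsto.eventually f.smooth]
    with x h1 h2 h3 h4 u v
  have e : fderiv ℝ (f.toFun ∘ g.toFun) x
      = (fderiv ℝ f.toFun (g.toFun x)).comp (fderiv ℝ g.toFun x) :=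
    fderiv_comp x (h4.differentiableAt (by simp)) (h3.differentiableAt (by simp))
  have h5 := h2 u v
  change omegaCan (fderiv ℝ (f.toFun ∘ g.toFun) x u)
    (fderiv ℝ (f.toFun ∘ g.toFun) x v) = _ at h5
  rw [e] at h5
  simp only [ContinuousLinearMap.comp_apply] at h5
  rw [h1] at h5
  exact h5

theorem Intertwines.one : Intertwines 1 1 := by
  rw [germ_one, germ_one, intertwines_germ]
  exact Eventually.of_forall fun x => rfl

theorem Intertwines.mul {φ ψ : SmoothGerm R4} {g k : SmoothGerm R2} (h : Intertwines φ g)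
    (h' : Intertwines ψ k) : Intertwines (φ * ψ) (g * k) := by
  obtain ⟨f, rfl⟩ := germ_surj φ
  obtain ⟨f', rfl⟩ := germ_surj ψ
  obtain ⟨g, rfl⟩ := germ_surj g
  obtain ⟨g', rfl⟩ := germ_surj k
  rw [intertwines_germ] at h h'
  rw [germ_mul, germ_mul, intertwines_germ]
  filter_upwards [f'.tendsto.eventually h, h'] with x h1 h2
  change q (f.toFun (f'.toFun x)) = g.toFun (g'.toFun (q x))
  rw [h1, h2]

theorem Intertwines.inv {φ : DiffeoGerm R4} {g : DiffeoGerm R2}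
    (h : Intertwines φ.val g.val) : Intertwines (φ⁻¹).val (g⁻¹).val := by
  obtain ⟨f, hf⟩ := germ_surj φ.val
  obtain ⟨f', hf'⟩ := germ_surj (φ⁻¹).val
  obtain ⟨k, hk⟩ := germ_surj g.val
  obtain ⟨k', hk'⟩ := germ_surj (g⁻¹).val
  have e1 : germ (f.comp f') = 1 := by rw [← germ_mul, hf, hf']; simp
  have e2 : germ (k'.comp k) = 1 := by rw [← germ_mul, hk, hk']; simp
  rw [germ_one, germ_eq_iff] at e1 e2
  rw [← hf, ← hk, intertwines_germ] at h
  rw [← hf', ← hk', intertwines_germ]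
  have t : Tendsto (fun x => q (f'.toFun x)) (𝓝 0) (𝓝 0) := q_tendsto.comp f'.tendsto
  filter_upwards [e1, f'.tendsto.eventually h, t.eventually e2] with x h1 h2 h3
  change f.toFun (f'.toFun x) = x at h1
  change k'.toFun (k.toFun (q (f'.toFun x))) = q (f'.toFun x) at h3
  rw [h1] at h2
  rw [h2, h3]

/-- `Aut((ℝ⁴, 0), ω_can, q)`: the group of germs of symplectomorphisms `φ` of `(ℝ⁴, 0)` for which
there is a germ of local diffeomorphism `g` of `(ℝ², 0)` with `q ∘ φ = g ∘ q`. -/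
def Aut : Subgroup (DiffeoGerm R4) where
  carrier := {φ | IsSymplectic φ.val ∧ ∃ g : DiffeoGerm R2, Intertwines φ.val g.val}
  one_mem' := ⟨IsSymplectic.one, 1, Intertwines.one⟩
  mul_mem' := by
    rintro φ ψ ⟨h1, g, h2⟩ ⟨h3, k, h4⟩
    exact ⟨h1.mul h3, g * k, h2.mul h4⟩
  inv_mem' := by
    rintro φ ⟨h1, g, h2⟩
    refine ⟨IsSymplectic.of_mul h1 ?_, g⁻¹, h2.inv⟩
    rw [Units.mul_inv]
    exact IsSymplectic.one

/-! ### The group `G` -/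

/-- A flat function near the origin of `ℝ²`: smooth on a neighbourhood of the origin, with
vanishing Taylor series there. -/
def IsFlat (h : R2 → ℝ) : Prop :=
  (∀ᶠ c in 𝓝 (0 : R2), ContDiffAt ℝ ∞ h c) ∧ ∀ n : ℕ, iteratedFDeriv ℝ n h 0 = 0

/-- The germ `g` is of the form `g(a, b) = (ε₁ a, ε₂ b + O(∞))`, with signs `ε₁, ε₂`. -/
def HasFlatForm (g : SmoothGerm R2) : Prop :=
  ∃ k : PointedMap R2, germ k = g ∧ ∃ (ε : ℤˣ × ℤˣ) (h : R2 → ℝ), IsFlat h ∧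
    ∀ᶠ c in 𝓝 (0 : R2), k.toFun c = ![((ε.1 : ℤ) : ℝ) * c 0, ((ε.2 : ℤ) : ℝ) * c 1 + h c]

theorem IsFlat.add {h k : R2 → ℝ} (hh : IsFlat h) (hk : IsFlat k) : IsFlat (h + k) := by
  refine ⟨?_, fun n => ?_⟩
  · filter_upwards [hh.1, hk.1] with c h1 h2
    exact h1.add h2
  · have e := iteratedFDeriv_add_apply (𝕜 := ℝ) (i := n) (x := (0 : R2)) (f := h) (g := k)
      (hh.1.self_of_nhds.of_le (by exact_mod_cast le_top))
      (hk.1.self_of_nhds.of_le (by exact_mod_cast le_top))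
    rw [e, hh.2 n, hk.2 n, add_zero]

theorem IsFlat.const_mul {h : R2 → ℝ} (hh : IsFlat h) (r : ℝ) : IsFlat (r • h) := by
  refine ⟨?_, fun n => ?_⟩
  · filter_upwards [hh.1] with c h1
    exact h1.const_smul r
  · have e := iteratedFDeriv_const_smul_apply (𝕜 := ℝ) (i := n) (x := (0 : R2)) (f := h) (a := r)
      (hh.1.self_of_nhds.of_le (by exact_mod_cast le_top))
    rw [e, hh.2 n, smul_zero]

theorem IsFlat.comp {h : R2 → ℝ} (hh : IsFlat h) (k : PointedMap R2) :
    IsFlat (h ∘ k.toFun) := by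
  refine ⟨?_, fun n => ?_⟩
  · filter_upwards [k.smooth, k.tendsto.eventually hh.1] with c h1 h2
    exact h2.comp c h1
  · have h0 : ContDiffAt ℝ ∞ h (k.toFun 0) := by
      rw [k.map_zero]
      exact hh.1.self_of_nhds
    rw [iteratedFDeriv_comp h0 k.smooth.self_of_nhds (i := n) (by exact_mod_cast le_top)]
    refine Finset.sum_eq_zero fun c _ => ?_
    ext v
    simp [ftaylorSeries, k.map_zero, hh.2, FormalMultilinearSeries.compAlongOrderedFinpartition]

theorem HasFlatForm.mul {g g' : SmoothGerm R2} (hg : HasFlatForm g) (hg' : HasFlatForm g') :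
    HasFlatForm (g * g') := by
  obtain ⟨k, rfl, ε, h, hh, e⟩ := hg
  obtain ⟨k', rfl, ε', h', hh', e'⟩ := hg'
  refine ⟨k.comp k', rfl, ε * ε', (((ε.2 : ℤ) : ℝ) • h') + h ∘ k'.toFun,
    (hh'.const_mul _).add (hh.comp k'), ?_⟩
  filter_upwards [k'.tendsto.eventually e, e'] with c h1 h2
  change k.toFun (k'.toFun c) = _
  rw [h1]
  ext i
  fin_cases i
  · simp [h2, mul_assoc]
  · simp [h2, mul_add, mul_assoc, add_assoc]

theorem HasFlatForm.inv {g : DiffeoGerm R2} (hg : HasFlatForm g.val) :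
    HasFlatForm (g⁻¹).val := by
  obtain ⟨k, hk, ε, h, hh, e⟩ := hg
  obtain ⟨k', hk'⟩ := germ_surj (g⁻¹).val
  have e1 : germ (k.comp k') = 1 := by rw [← germ_mul, hk, hk']; simp
  rw [germ_one, germ_eq_iff] at e1
  refine ⟨k', hk', ε, (-((ε.2 : ℤ) : ℝ)) • (h ∘ k'.toFun), (hh.comp k').const_mul _, ?_⟩
  filter_upwards [k'.tendsto.eventually e, e1] with c h1 h2
  change k.toFun (k'.toFun c) = c at h2
  rw [h2] at h1
  have a := congrFun h1 0
  have b := congrFun h1 1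
  simp only [Matrix.cons_val_zero, Matrix.cons_val_one] at a b
  have s : ∀ u : ℤˣ, ((u : ℤ) : ℝ) * ((u : ℤ) : ℝ) = 1 := by
    intro u
    exact_mod_cast Int.units_coe_mul_self u
  ext i
  fin_cases i
  · change k'.toFun c 0 = ((ε.1 : ℤ) : ℝ) * c 0
    rw [a, ← mul_assoc, s, one_mul]
  · change k'.toFun c 1 = ((ε.2 : ℤ) : ℝ) * c 1 + -((ε.2 : ℤ) : ℝ) * h (k'.toFun c)
    rw [b, mul_add, ← mul_assoc, s]
    ring

/-- The group `G` of germs of local diffeomorphisms of `(ℝ², 0)` of the form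
`(a, b) ↦ (±a, ±b + O(∞))`. -/
def G : Subgroup (DiffeoGerm R2) where
  carrier := {g | HasFlatForm g.val}
  one_mem' := ⟨_, rfl, 1, 0,
    ⟨Eventually.of_forall fun _ => contDiffAt_const, fun n => by
      simp⟩,
    Eventually.of_forall fun c => by
      ext i
      fin_cases i <;> simp [PointedMap.ofLinear]⟩
  mul_mem' := fun h h' => HasFlatForm.mul h h'
  inv_mem' := fun h => HasFlatForm.inv h

/-! ### Explicit linear maps -/

/-- `A₁₀ (x₁, y₁, x₂, y₂) = (x₂, y₂, x₁, y₁)`. -/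
noncomputable def A10 : R4 ≃L[ℝ] R4 := LinearEquiv.toContinuousLinearEquiv
  { toFun := fun x => ![x 2, x 3, x 0, x 1]
    invFun := fun x => ![x 2, x 3, x 0, x 1]
    map_add' := fun x y => by ext i; fin_cases i <;> simp
    map_smul' := fun r x => by ext i; fin_cases i <;> simp
    left_inv := fun x => by ext i; fin_cases i <;> simp
    right_inv := fun x => by ext i; fin_cases i <;> simp }

/-- `A₀₁ (x₁, y₁, x₂, y₂) = (y₁, -x₁, y₂, -x₂)`. -/
noncomputable def A01 : R4 ≃L[ℝ] R4 := LinearEquiv.toContinuousLinearEquiv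
  { toFun := fun x => ![x 1, -x 0, x 3, -x 2]
    invFun := fun x => ![-x 1, x 0, -x 3, x 2]
    map_add' := fun x y => by ext i; fin_cases i <;> simp <;> ring
    map_smul' := fun r x => by ext i; fin_cases i <;> simp
    left_inv := fun x => by ext i; fin_cases i <;> simp
    right_inv := fun x => by ext i; fin_cases i <;> simp }

/-- The map `A_ε` attached to a pair of signs: `A₁₀` is used when `ε₁ = -1`, and `A₀₁` when
`ε₂ = -1`; so `A_(-1,-1) = A₁₀ ∘ A₀₁`. -/
noncomputable def A (ε : ℤˣ × ℤˣ) : R4 ≃L[ℝ] R4 :=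
  (if ε.1 = -1 then A10 else 1) * (if ε.2 = -1 then A01 else 1)

/-- `g_ε (a, b) = (ε₁ a, ε₂ b)`. -/
noncomputable def signMap (ε : ℤˣ × ℤˣ) : R2 ≃L[ℝ] R2 := LinearEquiv.toContinuousLinearEquiv
  { toFun := fun c => ![((ε.1 : ℤ) : ℝ) * c 0, ((ε.2 : ℤ) : ℝ) * c 1]
    invFun := fun c => ![((ε.1 : ℤ) : ℝ) * c 0, ((ε.2 : ℤ) : ℝ) * c 1]
    map_add' := fun x y => by ext i; fin_cases i <;> simp <;> ring
    map_smul' := fun r x => by ext i; fin_cases i <;> simp <;> ring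
    left_inv := fun x => by
      have s : ∀ u : ℤˣ, ((u : ℤ) : ℝ) * ((u : ℤ) : ℝ) = 1 := fun u => by
        exact_mod_cast Int.units_coe_mul_self u
      ext i
      fin_cases i <;> simp [← mul_assoc, s]
    right_inv := fun x => by
      have s : ∀ u : ℤˣ, ((u : ℤ) : ℝ) * ((u : ℤ) : ℝ) = 1 := fun u => by
        exact_mod_cast Int.units_coe_mul_self u
      ext i
      fin_cases i <;> simp [← mul_assoc, s] }

end FocusFocus

/-! Put `z = x₁ + i x₂` and `w = y₁ + i y₂`. Then `z̄ w = q₂ + i q₁`, and the joint Hamiltonian flow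
of `q` at time `(a, b)` is `(z, w) ↦ (e^{b+ia} z, e^{-b+ia} w)`.

Necessity. Let `φ` lift `g`, with `g⁻¹ = k = (k_a, k_b)`. Being symplectic, `φ` sends the
Hamiltonian field of `q_j` to that of `k_j ∘ q`. So it carries joint flows to joint flows, the times
being transformed by the transposed derivative of `k` (`transport_jointFlow`). The flow of `q₁` has
period `2π`, which forces `∂_b k_a = 0` and `∂_a k_a ∈ ℤ`; applied to `g` as well, this gives `k_a =
±a`.

For `k_b`, follow the flow on the leaf over `c` from a point near the stable plane `z = 0` to one
near the unstable plane `w = 0`. The time needed is `-log |c|` up to a constant. Comparison with the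
image orbit gives `log |g(c)|² = ± ∂_b k_b(g(c)) log |c|² + smooth` (`IsLocalLift.log_relation`).
For `u = ±k_b` this reads `∂_b u · log(a² + u²) = log(a² + b²) + S` with `S` smooth. Along each ray
the factor of `log r²` and the smooth remainder must both be flat (`flatAtZero_of_mul_log`). Hence
`u = b + v(a)` up to a flat function. A first nonzero coefficient of `v`, in degree `n > 0`, would
make the degree `n` part of `S` on the ray of slope `m` a nonzero multiple of `m / (1 + m²)`, which
is not a polynomial in `m`; degree `0` is excluded directly. So `u - b` is flat
(`isFlat_of_log_relation`).

Sufficiency. For `(a, b) ↦ (a, b + h)` with `h` flat, adding `h z / |z|²` to `w` changes `z̄ w` by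
`h`. To restore symplecticity, apply the joint flow with times `m₁ log |z|` for `q₂` and `-m₂ log
|z|` for `q₁`. Here `1 + m₁ = 1 / (1 + h_b)` and `-m₂ = -h_a / (1 + h_b)` are the derivatives of the
second component of the inverse base map, as the transport law demands. Everything is smooth across
`z = 0` because `|q| = |z| |w|`, so a flat function of `q` beats every power of `|z|⁻¹`
(`contDiff_flat_mul_inv_pow`, `contDiff_flat_mul_log`). Signs are supplied by the maps `A ε`.

Finally `q` has a right inverse continuous at the origin, so `φ` determines `g`, and
multiplicativity of `φ ↦ g` follows from uniqueness. -/

namespace FocusFocus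

universe u

/-! ### Cut-offs and functions vanishing to infinite order -/

section General

variable {E F : Type*} [NormedAddCommGroup E] [NormedSpace ℝ E]
  [NormedAddCommGroup F] [NormedSpace ℝ F]

/-- A function that is smooth near the origin has the germ of a globally smooth one. -/
theorem exists_contDiff_eventuallyEq [FiniteDimensional ℝ E] {f : E → F}
    (hf : ∀ᶠ x in 𝓝 (0 : E), ContDiffAt ℝ ∞ f x) :
    ∃ g : E → F, ContDiff ℝ ∞ g ∧ g =ᶠ[𝓝 0] f := by
  obtain ⟨ε, hε, h⟩ := Metric.eventually_nhds_iff_ball.1 hf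
  let b : ContDiffBump (0 : E) := ⟨ε / 3, ε / 2, by positivity, by linarith⟩
  refine ⟨fun x => b x • f x, ?_, ?_⟩
  · rw [contDiff_iff_contDiffAt]
    intro x
    by_cases hx : x ∈ Metric.ball (0 : E) ε
    · exact b.contDiffAt.smul (h x hx)
    · have : (fun x => b x • f x) =ᶠ[𝓝 x] fun _ => 0 := by
        have ho : IsOpen (Metric.closedBall (0 : E) (ε / 2))ᶜ := Metric.isClosed_closedBall.isOpen_compl
        have hm : x ∈ (Metric.closedBall (0 : E) (ε / 2))ᶜ := by
          simp only [Set.mem_compl_iff, Metric.mem_closedBall, Metric.mem_ball] at hx ⊢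
          linarith
        filter_upwards [ho.mem_nhds hm] with y hy
        have : b y = 0 := b.zero_of_le_dist (by
          simp only [Set.mem_compl_iff, Metric.mem_closedBall, not_le] at hy
          exact hy.le)
        simp [this]
      exact contDiffAt_const.congr_of_eventuallyEq this
  · filter_upwards [b.eventuallyEq_one] with x hx
    simp [hx]

theorem iteratedFDeriv_congr_nhds {f g : E → F} {x : E} (h : f =ᶠ[𝓝 x] g) (n : ℕ) :
    iteratedFDeriv ℝ n f x = iteratedFDeriv ℝ n g x :=
  (h.iteratedFDeriv ℝ n).self_of_nhds

/-- A smooth function with vanishing Taylor series vanishes to infinite order. -/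
theorem isBigO_pow_of_iteratedFDeriv_eq_zero {E : Type u} [NormedAddCommGroup E]
    [NormedSpace ℝ E] (n : ℕ) : ∀ {F : Type u} [NormedAddCommGroup F] [NormedSpace ℝ F] {f : E → F},
    (∀ᶠ x in 𝓝 (0 : E), ContDiffAt ℝ ∞ f x) → (∀ n, iteratedFDeriv ℝ n f 0 = 0) →
    f =O[𝓝 0] fun x => ‖x‖ ^ n := by
  induction n with
  | zero =>
    intro F _ _ f hf _
    simpa using hf.self_of_nhds.continuousAt.isBigO_one ℝ
  | succ n ih =>
    intro F _ _ f hf h0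
    have hD : (fderiv ℝ f) =O[𝓝 0] fun x => ‖x‖ ^ n := by
      apply ih
      · filter_upwards [hf] with x hx using hx.fderiv_right (m := ∞) (by simp)
      · intro m
        ext v y
        have := congrArg (fun M => M (Fin.snoc v y)) (h0 (m + 1))
        simpa [iteratedFDeriv_succ_apply_right] using this
    obtain ⟨C, hC⟩ := hD.bound
    have hf0 : f 0 = 0 := by
      have := congrArg (fun M => M (fun _ => 0)) (h0 0)
      simpa using this
    obtain ⟨ε, hε, h⟩ := Metric.eventually_nhds_iff_ball.1 (hC.and hf)
    refine Asymptotics.IsBigO.of_bound C ?_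
    filter_upwards [Metric.ball_mem_nhds (0 : E) hε] with x hx
    have hsub : Metric.closedBall (0 : E) ‖x‖ ⊆ Metric.ball 0 ε := by
      apply Metric.closedBall_subset_ball
      simpa using hx
    have hx0 : 0 ≤ C * ‖x‖ ^ n := by
      have := (h x hx).1
      rw [norm_pow, norm_norm] at this
      exact (norm_nonneg _).trans this
    have key := (convex_closedBall (0 : E) ‖x‖).norm_image_sub_le_of_norm_hasFDerivWithin_le
      (f := f) (f' := fderiv ℝ f) (C := C * ‖x‖ ^ n) (x := 0) (y := x)
      (fun y hy => ((h y (hsub hy)).2.differentiableAt (by simp)).hasFDerivAt.hasFDerivWithinAt)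
      (fun y hy => by
        have h1 := (h y (hsub hy)).1
        rw [norm_pow, norm_norm] at h1
        refine h1.trans ?_
        have hy' : ‖y‖ ≤ ‖x‖ := by simpa using hy
        -- The constant of a `O`-bound may be negative; the bound then forces both sides to vanish.
        rcases le_or_gt 0 C with hC0 | hC0
        · gcongr
        · have hn : 0 ≤ C * ‖y‖ ^ n := (norm_nonneg _).trans h1
          have h2 : ‖y‖ ^ n = 0 := by
            by_contra hne
            have : 0 < ‖y‖ ^ n := lt_of_le_of_ne (by positivity) (Ne.symm hne)
            nlinarith
          rw [h2]; simpa using hx0)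
      (by simp) (by simp)
    rw [hf0] at key
    simp only [sub_zero] at key
    rw [norm_pow, norm_norm, pow_succ, ← mul_assoc]
    exact key

/-- If a smooth function vanishes to infinite order at the origin, so does its derivative. -/
theorem isBigO_pow_fderiv [FiniteDimensional ℝ E] {f : E → F} (hf : ContDiff ℝ ∞ f)
    (h : ∀ n : ℕ, f =O[𝓝 0] fun x => ‖x‖ ^ n) (n : ℕ) :
    fderiv ℝ f =O[𝓝 0] fun x => ‖x‖ ^ n := by
  rcases Nat.eq_zero_or_pos n with rfl | hn
  · have := (hf.continuous_fderiv (by simp)).continuousAt (x := (0 : E))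
    simpa using this.isBigO_one ℝ
  -- a bound for the second derivative
  have hD : ContDiff ℝ ∞ (fderiv ℝ f) := hf.fderiv_right (by simp)
  have hcont : Continuous (fderiv ℝ (fderiv ℝ f)) := hD.continuous_fderiv (by simp)
  obtain ⟨K, hK⟩ := (isCompact_closedBall (0 : E) 2).exists_bound_of_continuousOn
    (f := fderiv ℝ (fderiv ℝ f)) hcont.continuousOn
  have hK0 : 0 ≤ K := (norm_nonneg _).trans (hK 0 (by simp))
  -- Taylor estimate of order two
  have taylor : ∀ x h : E, ‖x‖ ≤ 1 → ‖h‖ ≤ 1 → ‖f (x + h) - f x - fderiv ℝ f x h‖ ≤ K * ‖h‖ * ‖h‖ := by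
    intro x h hx hh
    have hsub : Metric.closedBall x ‖h‖ ⊆ Metric.closedBall 0 2 := by
      apply Metric.closedBall_subset_closedBall'
      rw [dist_zero_right]; linarith
    have := (convex_closedBall x ‖h‖).norm_image_sub_le_of_norm_hasFDerivWithin_le
      (f := fun y => f y - fderiv ℝ f x y) (f' := fun y => fderiv ℝ f y - fderiv ℝ f x)
      (C := K * ‖h‖) (x := x) (y := x + h)
      (fun y hy => (((hf.differentiable (by simp) y).hasFDerivAt).sub
        (fderiv ℝ f x).hasFDerivAt).hasFDerivWithinAt)
      (fun y hy => by
        have h1 := (convex_closedBall x ‖h‖).norm_image_sub_le_of_norm_hasFDerivWithin_le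
          (f := fderiv ℝ f) (f' := fderiv ℝ (fderiv ℝ f)) (C := K) (x := x) (y := y)
          (fun z hz => (hD.differentiable (by simp) z).hasFDerivAt.hasFDerivWithinAt)
          (fun z hz => hK z (hsub hz)) (by simp) hy
        refine h1.trans ?_
        gcongr
        simpa [dist_eq_norm] using hy)
      (by simp) (by simp)
    simp only [map_add, add_sub_cancel_left] at this
    convert this using 2
    abel
  -- The increment below has length `t = ‖x‖ ^ n`. Dividing the Taylor estimate by `t` leaves `O(t)`
  -- provided that `f = O(t²)`, whence the order `2 * n`.
  obtain ⟨C, hCp, hC⟩ := (h (2 * n)).exists_pos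
  obtain ⟨ε, hε, hb⟩ := Metric.eventually_nhds_iff_ball.1 hC.bound
  refine Asymptotics.IsBigO.of_bound (C * 2 ^ (2 * n) + C + K) ?_
  filter_upwards [Metric.ball_mem_nhds (0 : E) (show 0 < min (ε / 2) (1/2) by positivity)] with x hx
  have hx1 : ‖x‖ < ε / 2 := by
    have := lt_of_lt_of_le (by simpa using hx) (min_le_left _ _); exact this
  have hx2 : ‖x‖ < 1 / 2 := lt_of_lt_of_le (by simpa using hx) (min_le_right (ε / 2) (1/2))
  rw [norm_pow, norm_norm]
  rcases eq_or_ne x 0 with rfl | hx0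
  · have : fderiv ℝ f 0 = 0 :=
      (Asymptotics.IsBigO.hasFDerivAt (n := 2) (by simpa using h 2) (by norm_num)).fderiv
    rw [this]
    simp only [norm_zero]
    positivity
  have hxp : 0 < ‖x‖ := norm_pos_iff.2 hx0
  refine ContinuousLinearMap.opNorm_le_of_unit_norm (by positivity) (fun v hv => ?_)
  set t : ℝ := ‖x‖ ^ n with ht
  have htp : 0 < t := by positivity
  have htx : t ≤ ‖x‖ := pow_le_of_le_one hxp.le (by linarith) hn.ne'
  have hnt : ‖t • v‖ = t := by rw [norm_smul, hv, mul_one, Real.norm_of_nonneg htp.le]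
  have h1 := taylor x (t • v) (by linarith) (by linarith)
  have hxt : ‖x + t • v‖ ≤ 2 * ‖x‖ := (norm_add_le _ _).trans (by linarith)
  have h2 := hb (x + t • v) (by rw [mem_ball_zero_iff]; linarith)
  have h3 := hb x (by rw [mem_ball_zero_iff]; linarith)
  rw [norm_pow, norm_norm] at h2 h3
  have h4 : ‖x + t • v‖ ^ (2 * n) ≤ 2 ^ (2 * n) * (t * t) := by
    calc ‖x + t • v‖ ^ (2 * n) ≤ (2 * ‖x‖) ^ (2 * n) := by gcongr
      _ = _ := by rw [mul_pow, ht, two_mul n, pow_add ‖x‖]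
  have h5 : ‖x‖ ^ (2 * n) = t * t := by rw [ht, two_mul n, pow_add]
  rw [h5] at h3
  rw [hnt, map_smul] at h1
  have h6 : ‖t • fderiv ℝ f x v‖ ≤ ‖f (x + t • v) - f x - t • fderiv ℝ f x v‖
      + ‖f (x + t • v)‖ + ‖f x‖ := by
    have e : t • fderiv ℝ f x v = -(f (x + t • v) - f x - t • fderiv ℝ f x v)
      + f (x + t • v) - f x := by abel
    calc ‖t • fderiv ℝ f x v‖ = ‖-(f (x + t • v) - f x - t • fderiv ℝ f x v)
          + f (x + t • v) - f x‖ := by rw [← e]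
      _ ≤ _ := (norm_sub_le _ _).trans (by
          gcongr
          exact (norm_add_le _ _).trans (by rw [norm_neg]))
  rw [norm_smul, Real.norm_of_nonneg htp.le] at h6
  have h7 : C * ‖x + t • v‖ ^ (2 * n) ≤ C * (2 ^ (2 * n) * (t * t)) := by gcongr
  refine le_of_mul_le_mul_left ?_ htp
  linarith

end General

/-! ### Hadamard's lemma and flat functions of one variable -/

section OneVariable

/-- Differentiation under the integral replaces `(k, f)` by `(k + 1, deriv f)`; the weight `t ^ k`
keeps this family closed under derivatives, so that an induction on `n` applies. -/
theorem contDiff_integral_dilate (n : ℕ) : ∀ (k : ℕ) {f : ℝ → ℝ}, ContDiff ℝ ∞ f →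
    ContDiff ℝ n (fun r => ∫ t in (0 : ℝ)..1, t ^ k * f (t * r)) := by
  have deriv_int : ∀ (k : ℕ) {f : ℝ → ℝ}, ContDiff ℝ ∞ f → ∀ r, HasDerivAt
      (fun r => ∫ t in (0 : ℝ)..1, t ^ k * f (t * r))
      (∫ t in (0 : ℝ)..1, t ^ (k + 1) * deriv f (t * r)) r := by
    intro k f hf r
    have hc : Continuous f := hf.continuous
    have hc' : Continuous (deriv f) := hf.continuous_deriv (by simp)
    obtain ⟨K, hK⟩ := (isCompact_closedBall (0 : ℝ) (|r| + 1)).exists_bound_of_continuousOn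
      hc'.continuousOn
    refine (intervalIntegral.hasDerivAt_integral_of_dominated_loc_of_deriv_le
      (F := fun r t => t ^ k * f (t * r)) (F' := fun r t => t ^ (k + 1) * deriv f (t * r))
      (bound := fun _ => K) (s := Metric.ball r 1) (Metric.ball_mem_nhds r one_pos) ?_ ?_ ?_ ?_ ?_ ?_).2
    · exact Eventually.of_forall fun x => (by fun_prop : Continuous _).aestronglyMeasurable
    · exact (by fun_prop : Continuous _).intervalIntegrable _ _
    · exact (by fun_prop : Continuous _).aestronglyMeasurable
    · refine Eventually.of_forall fun t ht x hx => ?_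
      rw [Set.uIoc_of_le zero_le_one] at ht
      have hx' : |x| ≤ |r| + 1 := by
        have := abs_sub_abs_le_abs_sub x r
        rw [Metric.mem_ball, Real.dist_eq] at hx
        linarith
      have h1 : ‖deriv f (t * x)‖ ≤ K := by
        apply hK
        rw [mem_closedBall_zero_iff, Real.norm_eq_abs, abs_mul, abs_of_pos ht.1]
        nlinarith [ht.2, abs_nonneg x]
      rw [norm_mul, norm_pow, Real.norm_of_nonneg ht.1.le]
      have h2 : t ^ (k + 1) ≤ 1 := pow_le_one₀ ht.1.le ht.2
      have h3 : 0 ≤ t ^ (k + 1) := pow_nonneg ht.1.le _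
      nlinarith [norm_nonneg (deriv f (t * x))]
    · exact intervalIntegrable_const
    · refine Eventually.of_forall fun t ht x hx => ?_
      have h := ((hf.differentiable (by simp) (t * x)).hasDerivAt.comp x
        ((hasDerivAt_id x).const_mul t)).const_mul (t ^ k)
      exact h.congr_deriv (by ring)
  induction n with
  | zero =>
    intro k f hf
    have : Continuous (fun r => ∫ t in (0 : ℝ)..1, t ^ k * f (t * r)) :=
      continuous_iff_continuousAt.2 fun r => (deriv_int k hf r).continuousAt
    exact contDiff_zero.2 this
  | succ n ih =>
    intro k f hf
    rw [Nat.cast_succ, contDiff_succ_iff_deriv]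
    refine ⟨fun r => (deriv_int k hf r).differentiableAt, by simp, ?_⟩
    have e : deriv (fun r => ∫ t in (0 : ℝ)..1, t ^ k * f (t * r))
        = fun r => ∫ t in (0 : ℝ)..1, t ^ (k + 1) * deriv f (t * r) :=
      funext fun r => (deriv_int k hf r).deriv
    rw [e]
    exact ih (k + 1) ((contDiff_infty_iff_deriv.1 hf).2)

/-- **Hadamard's lemma** in one variable. -/
theorem exists_eq_mul_of_zero {f : ℝ → ℝ} (hf : ContDiff ℝ ∞ f) (h0 : f 0 = 0) :
    ∃ g : ℝ → ℝ, ContDiff ℝ ∞ g ∧ ∀ r, f r = r * g r := by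
  have hf' : ContDiff ℝ ∞ (deriv f) := (contDiff_infty_iff_deriv.1 hf).2
  refine ⟨fun r => ∫ t in (0 : ℝ)..1, t ^ 0 * deriv f (t * r),
    contDiff_infty.2 fun n => contDiff_integral_dilate n 0 hf', fun r => ?_⟩
  have key : ∫ t in (0 : ℝ)..1, r * deriv f (t * r) = f (1 * r) - f (0 * r) := by
    refine intervalIntegral.integral_eq_sub_of_hasDerivAt (f := fun t => f (t * r)) (fun t _ => ?_) ?_
    · have h := (hf.differentiable (by simp) (t * r)).hasDerivAt.comp t
        ((hasDerivAt_id t).mul_const r)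
      exact h.congr_deriv (by ring)
    · have := hf'.continuous
      exact (by fun_prop : Continuous _).intervalIntegrable _ _
  rw [intervalIntegral.integral_const_mul] at key
  simp only [one_mul, zero_mul, h0, sub_zero] at key
  simp [key]

theorem iteratedDeriv_pow_mul (n : ℕ) : ∀ {g : ℝ → ℝ}, ContDiff ℝ ∞ g →
    iteratedDeriv n (fun r => r ^ n * g r) 0 = n.factorial * g 0 := by
  induction n with
  | zero => intro g _; simp
  | succ n ih =>
    intro g hg
    have hg' : ContDiff ℝ ∞ (deriv g) := (contDiff_infty_iff_deriv.1 hg).2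
    have e : deriv (fun r => r ^ (n + 1) * g r) =
        fun r => r ^ n * ((n + 1) * g r + r * deriv g r) := by
      ext r
      have h := (hasDerivAt_pow (n + 1) r).mul (hg.differentiable (by simp) r).hasDerivAt
      refine (HasDerivAt.deriv h).trans ?_
      push_cast
      ring
    rw [iteratedDeriv_succ', e, ih (by fun_prop)]
    rw [Nat.factorial_succ]
    push_cast
    ring

/-- A smooth function of one variable vanishing to infinite order at the origin. -/
def FlatAtZero (f : ℝ → ℝ) : Prop := ∀ n : ℕ, ∃ g : ℝ → ℝ, ContDiff ℝ ∞ g ∧ ∀ r, f r = r ^ n * g r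

/-- A quotient `f / rⁿ` that is `O(r)` vanishes at `0` by continuity, so Hadamard's lemma extracts
one more factor `r`. Punctured estimates suffice. -/
theorem FlatAtZero.of_isBigO {f : ℝ → ℝ} (hf : ContDiff ℝ ∞ f)
    (h : ∀ n : ℕ, f =O[𝓝[≠] 0] fun r => r ^ n) : FlatAtZero f := by
  intro n
  induction n with
  | zero => exact ⟨f, hf, by simp⟩
  | succ n ih =>
    obtain ⟨g, hg, e⟩ := ih
    have h0 : g 0 = 0 := by
      have h1 : Tendsto g (𝓝[≠] 0) (𝓝 (g 0)) := hg.continuous.continuousAt.mono_left nhdsWithin_le_nhds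
      have h2 : g =O[𝓝[≠] 0] fun r => r := by
        obtain ⟨C, hC⟩ := (h (n + 1)).bound
        refine Asymptotics.IsBigO.of_bound C ?_
        filter_upwards [hC, self_mem_nhdsWithin] with r hr hr0
        have hp : 0 < ‖r‖ ^ n := pow_pos (norm_pos_iff.2 hr0) n
        rw [e, norm_mul, norm_pow, norm_pow, pow_succ] at hr
        refine le_of_mul_le_mul_left ?_ hp
        linarith
      have h3 : Tendsto g (𝓝[≠] 0) (𝓝 0) :=
        h2.trans_tendsto (tendsto_id.mono_left nhdsWithin_le_nhds)
      exact tendsto_nhds_unique h1 h3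
    obtain ⟨g', hg', e'⟩ := exists_eq_mul_of_zero hg h0
    exact ⟨g', hg', fun r => by rw [e, e', pow_succ, mul_assoc]⟩

theorem FlatAtZero.apply_zero {f : ℝ → ℝ} (h : FlatAtZero f) : f 0 = 0 := by
  obtain ⟨g, -, e⟩ := h 1
  simp [e]

theorem FlatAtZero.add {f g : ℝ → ℝ} (hf : FlatAtZero f) (hg : FlatAtZero g) :
    FlatAtZero (fun r => f r + g r) := fun n => by
  obtain ⟨a, ha, ea⟩ := hf n
  obtain ⟨b, hb, eb⟩ := hg n
  exact ⟨fun r => a r + b r, ha.add hb, fun r => by simp only [ea, eb]; ring⟩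

theorem FlatAtZero.mul {f g : ℝ → ℝ} (hf : FlatAtZero f) (hg : ContDiff ℝ ∞ g) :
    FlatAtZero (fun r => f r * g r) := fun n => by
  obtain ⟨a, ha, ea⟩ := hf n
  exact ⟨fun r => a r * g r, ha.mul hg, fun r => by simp only [ea]; ring⟩

theorem FlatAtZero.iteratedDeriv_eq_zero {f : ℝ → ℝ} (hf : FlatAtZero f) (n : ℕ) :
    iteratedDeriv n f 0 = 0 := by
  obtain ⟨g, hg, e⟩ := hf (n + 1)
  have : f = fun r => r ^ n * (r * g r) := funext fun r => by rw [e]; ring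
  rw [this, iteratedDeriv_pow_mul n (by fun_prop)]
  simp

/-- If `a log r² = b` with `a`, `b` smooth, then `a` and `b` vanish to infinite order. -/
theorem flatAtZero_of_mul_log {a b : ℝ → ℝ} (ha : ContDiff ℝ ∞ a) (hb : ContDiff ℝ ∞ b)
    (h : ∀ᶠ r in 𝓝[≠] (0 : ℝ), a r * Real.log (r ^ 2) = b r) : FlatAtZero a ∧ FlatAtZero b := by
  have main : ∀ n : ℕ, ∃ a' b' : ℝ → ℝ, ContDiff ℝ ∞ a' ∧ ContDiff ℝ ∞ b' ∧
      (∀ r, a r = r ^ n * a' r) ∧ (∀ r, b r = r ^ n * b' r) := by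
    intro n
    induction n with
    | zero => exact ⟨a, b, ha, hb, by simp, by simp⟩
    | succ n ih =>
      obtain ⟨a', b', ha', hb', ea, eb⟩ := ih
      have h' : ∀ᶠ r in 𝓝[≠] (0 : ℝ), a' r * Real.log (r ^ 2) = b' r := by
        filter_upwards [h, self_mem_nhdsWithin] with r hr hr0
        rw [ea, eb, mul_assoc] at hr
        exact mul_left_cancel₀ (pow_ne_zero n hr0) hr
      have ta : Tendsto a' (𝓝[≠] 0) (𝓝 (a' 0)) := ha'.continuous.continuousAt.mono_left nhdsWithin_le_nhds
      have tb : Tendsto b' (𝓝[≠] 0) (𝓝 (b' 0)) := hb'.continuous.continuousAt.mono_left nhdsWithin_le_nhds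
      have tl : Tendsto (fun r : ℝ => Real.log (r ^ 2)) (𝓝[≠] 0) atBot := by
        have : (fun r : ℝ => Real.log (r ^ 2)) = fun r => 2 * Real.log r := by
          ext r; rw [Real.log_pow]; norm_num
        rw [this]
        exact Real.tendsto_log_nhdsNE_zero.const_mul_atBot two_pos
      -- `a' = b' / log r²` tends to `0` because the logarithm diverges. Once `a' = r a''`, also `b'
      -- = a'' r log r²` tends to `0`, so both functions lose a factor `r` at the same time.
      have ha0 : a' 0 = 0 := by
        have tinv : Tendsto (fun r : ℝ => b' r * (Real.log (r ^ 2))⁻¹) (𝓝[≠] 0) (𝓝 (b' 0 * 0)) :=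
          tb.mul tl.inv_tendsto_atBot
        rw [mul_zero] at tinv
        refine tendsto_nhds_unique ta (tinv.congr' ?_)
        filter_upwards [h', tl.eventually (eventually_lt_atBot 0)] with r hr hl
        rw [← hr, mul_assoc, mul_inv_cancel₀ hl.ne, mul_one]
      obtain ⟨a'', ha'', ea'⟩ := exists_eq_mul_of_zero ha' ha0
      have hb0 : b' 0 = 0 := by
        have t0 : Tendsto (fun r : ℝ => a'' r * (r * Real.log (r ^ 2))) (𝓝[≠] 0) (𝓝 (a'' 0 * 0)) := by
          refine Tendsto.mul (ha''.continuous.continuousAt.mono_left nhdsWithin_le_nhds) ?_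
          have := Real.continuous_mul_log.tendsto 0
          simp only [zero_mul] at this
          have h2 := (this.mono_left (nhdsWithin_le_nhds (s := {0}ᶜ))).const_mul 2
          rw [mul_zero] at h2
          refine h2.congr fun r => ?_
          rw [Real.log_pow]; push_cast; ring
        rw [mul_zero] at t0
        refine tendsto_nhds_unique tb (t0.congr' ?_)
        filter_upwards [h'] with r hr
        rw [← hr, ea']; ring
      obtain ⟨b'', hb'', eb'⟩ := exists_eq_mul_of_zero hb' hb0
      exact ⟨a'', b'', ha'', hb'', fun r => by rw [ea, ea', pow_succ]; ring,
        fun r => by rw [eb, eb', pow_succ]; ring⟩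
  constructor
  · intro n
    obtain ⟨a', _, h1, _, h2, _⟩ := main n
    exact ⟨a', h1, h2⟩
  · intro n
    obtain ⟨_, b', _, h1, _, h2⟩ := main n
    exact ⟨b', h1, h2⟩

end OneVariable

/-! ### Taylor series of functions on the plane, read along rays -/

section TaylorAlongRays

theorem iteratedDeriv_line {E : Type*} [NormedAddCommGroup E] [NormedSpace ℝ E] {f : E → ℝ}
    (hf : ContDiff ℝ ∞ f) (c : E) (n : ℕ) (r : ℝ) :
    iteratedDeriv n (fun r : ℝ => f (r • c)) r = iteratedFDeriv ℝ n f (r • c) (fun _ => c) := by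
  have h := (ContinuousLinearMap.toSpanSingleton ℝ c).iteratedFDeriv_comp_right hf r
    (i := n) (by exact_mod_cast le_top)
  rw [iteratedDeriv_eq_iteratedFDeriv]
  change iteratedFDeriv ℝ n (f ∘ (ContinuousLinearMap.toSpanSingleton ℝ c)) r _ = _
  rw [h]
  simp

/-- Taylor's formula with Lagrange remainder on the segment from `0` to `x` involves the derivatives
only on the diagonal, so no polarization is needed. -/
theorem isBigO_pow_of_diag_eq_zero {E : Type*} [NormedAddCommGroup E] [NormedSpace ℝ E]
    [FiniteDimensional ℝ E] {f : E → ℝ} (hf : ContDiff ℝ ∞ f)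
    (h : ∀ (n : ℕ) (c : E), iteratedFDeriv ℝ n f 0 (fun _ => c) = 0) (n : ℕ) :
    f =O[𝓝 0] fun x => ‖x‖ ^ n := by
  have key : f =O[𝓝 0] fun x => ‖x‖ ^ (n + 1) := by
    obtain ⟨K, hK⟩ := (isCompact_closedBall (0 : E) 1).exists_bound_of_continuousOn
      (hf.continuous_iteratedFDeriv (m := n + 1) (by exact_mod_cast le_top)).continuousOn
    refine Asymptotics.IsBigO.of_bound K ?_
    filter_upwards [Metric.ball_mem_nhds (0 : E) one_pos] with x hx
    have hx1 : ‖x‖ < 1 := by simpa using hx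
    have hs : ContDiff ℝ ∞ fun r : ℝ => f (r • x) := by fun_prop
    obtain ⟨t, ht, e⟩ := taylor_mean_remainder_lagrange_iteratedDeriv (n := n) (x := 1) (x₀ := 0)
      (f := fun r : ℝ => f (r • x)) (by norm_num) (hs.of_le (by exact_mod_cast le_top)).contDiffOn
    have e0 : taylorWithinEval (fun r : ℝ => f (r • x)) n (Set.uIcc 0 1) 0 1 = 0 := by
      rw [taylor_within_apply]
      refine Finset.sum_eq_zero fun k _ => ?_
      rw [iteratedDerivWithin_eq_iteratedDeriv (uniqueDiffOn_uIcc (by norm_num))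
        (hs.contDiffAt.of_le (by exact_mod_cast le_top)) Set.left_mem_uIcc,
        iteratedDeriv_line hf, zero_smul, h, smul_zero]
    rw [e0, iteratedDeriv_line hf] at e
    simp only [one_smul, sub_zero, one_pow, mul_one] at e
    rw [e, norm_div, norm_pow, norm_norm]
    have hf1 : (1 : ℝ) ≤ ((n + 1).factorial : ℝ) := by
      exact_mod_cast Nat.succ_le_of_lt (Nat.factorial_pos _)
    have ht' : t ∈ Set.Ioo (0 : ℝ) 1 := by simpa [Set.uIoo] using ht
    have h1 : ‖iteratedFDeriv ℝ (n + 1) f (t • x) fun _ => x‖ ≤ K * ‖x‖ ^ (n + 1) := by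
      refine (ContinuousMultilinearMap.le_opNorm _ _).trans ?_
      rw [Finset.prod_const, Finset.card_univ, Fintype.card_fin]
      gcongr
      apply hK
      rw [mem_closedBall_zero_iff, norm_smul, Real.norm_of_nonneg ht'.1.le]
      nlinarith [ht'.2, norm_nonneg x]
    refine (div_le_self (norm_nonneg _) ?_).trans h1
    rw [Real.norm_of_nonneg (by positivity)]
    exact hf1
  refine key.trans (Asymptotics.IsBigO.of_bound 1 ?_)
  filter_upwards [Metric.ball_mem_nhds (0 : E) one_pos] with x hx
  have hx1 : ‖x‖ < 1 := by simpa using hx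
  simp only [norm_pow, norm_norm, one_mul]
  exact pow_le_pow_of_le_one (norm_nonneg _) hx1.le (Nat.le_succ n)

/-- Infinite-order vanishing passes to the derivative by `isBigO_pow_fderiv`. The target `F` varies
in the induction, and shares the universe of `E` so that `E →L[ℝ] F` is again admissible. -/
theorem iteratedFDeriv_eq_zero_of_isBigO {E : Type u} [NormedAddCommGroup E] [NormedSpace ℝ E]
    [FiniteDimensional ℝ E] (n : ℕ) : ∀ {F : Type u} [NormedAddCommGroup F] [NormedSpace ℝ F]
    {f : E → F}, ContDiff ℝ ∞ f → (∀ n : ℕ, f =O[𝓝 0] fun x => ‖x‖ ^ n) →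
    iteratedFDeriv ℝ n f 0 = 0 := by
  induction n with
  | zero =>
    intro F _ _ f _ h
    have : f 0 = 0 := Asymptotics.IsBigO.eq_zero_of_norm_pow (n := 1) (by simpa using h 1) one_ne_zero
    ext v
    simpa using this
  | succ n ih =>
    intro F _ _ f hf h
    have := ih (hf.fderiv_right (m := ∞) (by simp)) (isBigO_pow_fderiv hf h)
    ext v
    rw [iteratedFDeriv_succ_apply_right, this]
    simp

/-- Expand `(1, m) = m (0, 1) + (1, 0)` in every slot; the subset `s` records the slots that take
`(0, 1)`. -/
theorem exists_polynomial_of_multilinear {n : ℕ} (M : R2 [×n]→L[ℝ] ℝ) :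
    ∃ p : Polynomial ℝ, ∀ m : ℝ, M (fun _ => ![1, m]) = p.eval m := by
  classical
  refine ⟨∑ s : Finset (Fin n), Polynomial.C (M (s.piecewise (fun _ => ![0, 1]) (fun _ => ![1, 0])))
    * Polynomial.X ^ s.card, fun m => ?_⟩
  have e : (fun _ : Fin n => (![1, m] : R2)) =
      (fun i : Fin n => m • (![0, 1] : R2)) + fun _ => ![1, 0] := by
    ext i j
    fin_cases j <;> simp
  rw [e, ← ContinuousMultilinearMap.coe_coe, MultilinearMap.map_add_univ, Polynomial.eval_finsetSum]
  refine Finset.sum_congr rfl fun s _ => ?_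
  have h2 : s.piecewise (fun i : Fin n => m • (![0, 1] : R2)) (fun _ => ![1, 0]) =
      s.piecewise (fun i => m • (s.piecewise (fun _ => (![0, 1] : R2)) (fun _ => ![1, 0])) i)
        (s.piecewise (fun _ => (![0, 1] : R2)) (fun _ => ![1, 0])) := by
    ext i j
    by_cases hi : i ∈ s
    · rw [Finset.piecewise_eq_of_mem _ _ _ hi, Finset.piecewise_eq_of_mem _ _ _ hi,
        Finset.piecewise_eq_of_mem _ _ _ hi]
    · rw [Finset.piecewise_eq_of_notMem _ _ _ hi, Finset.piecewise_eq_of_notMem _ _ _ hi,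
        Finset.piecewise_eq_of_notMem _ _ _ hi]
  rw [h2, MultilinearMap.map_piecewise_smul]
  rw [Finset.prod_const, smul_eq_mul, Polynomial.eval_mul, Polynomial.eval_C, Polynomial.eval_pow,
    Polynomial.eval_X, mul_comm]

/-- Homogeneity gives the vectors with nonzero abscissa and continuity the vertical ones. This is
why rays of finite slope suffice everywhere. -/
theorem multilinear_diag_eq_zero {n : ℕ} (M : R2 [×n]→L[ℝ] ℝ)
    (h : ∀ m : ℝ, M (fun _ => ![1, m]) = 0) (c : R2) : M (fun _ => c) = 0 := by
  have h1 : ∀ t : ℝ, t ≠ 0 → M (fun _ => ![t, c 1]) = 0 := by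
    intro t ht
    have e : (fun _ : Fin n => (![t, c 1] : R2)) = fun i => (fun _ => t) i • (fun _ => ![1, c 1 / t]) i := by
      ext i j
      fin_cases j
      · simp
      · simp; field_simp
    rw [e, M.map_smul_univ, h, smul_zero]
  have h2 : (fun t : ℝ => M (fun _ => ![t, c 1])) = fun _ => 0 := by
    refine Continuous.ext_on (dense_compl_singleton (0 : ℝ)) ?_ continuous_const fun t ht => h1 t ht
    refine M.cont.comp (continuous_pi fun _ => continuous_pi fun j => ?_)
    fin_cases j
    · exact continuous_id
    · exact continuous_const
  have h3 := congrFun h2 (c 0)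
  have : (![c 0, c 1] : R2) = c := by ext j; fin_cases j <;> rfl
  simpa [this] using h3

theorem isBigO_pow_of_flatAtZero_rays {f : R2 → ℝ} (hf : ContDiff ℝ ∞ f)
    (h : ∀ m : ℝ, FlatAtZero fun r => f (r • ![1, m])) (n : ℕ) : f =O[𝓝 0] fun x => ‖x‖ ^ n := by
  refine isBigO_pow_of_diag_eq_zero hf (fun n c => multilinear_diag_eq_zero _ (fun m => ?_) c) n
  have := iteratedDeriv_line hf ![1, m] n 0
  rw [(h m).iteratedDeriv_eq_zero, zero_smul] at this
  exact this.symm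

/-- If `f(r, m r) / rⁿ` has a limit along every ray, the limit is a polynomial in the slope. -/
theorem exists_polynomial_of_tendsto_rays {f : R2 → ℝ} (hf : ContDiff ℝ ∞ f) (n : ℕ) {l : ℝ → ℝ}
    (h : ∀ m : ℝ, Tendsto (fun r : ℝ => f (r • ![1, m]) / r ^ n) (𝓝[≠] 0) (𝓝 (l m))) :
    ∃ p : Polynomial ℝ, ∀ m, l m = p.eval m := by
  obtain ⟨p, hp⟩ := exists_polynomial_of_multilinear (iteratedFDeriv ℝ n f 0)
  refine ⟨Polynomial.C (n.factorial : ℝ)⁻¹ * p, fun m => ?_⟩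
  have hs : ContDiff ℝ ∞ fun r : ℝ => f (r • ![1, m]) := by fun_prop
  -- A finite limit of `f / rⁿ` forces all Taylor coefficients of order below `n` along the ray to
  -- vanish. The limit is then the `n`-th one, which is polynomial in the slope.
  have main : ∀ k ≤ n, ∃ g : ℝ → ℝ, ContDiff ℝ ∞ g ∧ ∀ r, f (r • ![1, m]) = r ^ k * g r := by
    intro k
    induction k with
    | zero => exact fun _ => ⟨_, hs, by simp⟩
    | succ k ih =>
      intro hk
      obtain ⟨g, hg, e⟩ := ih (by omega)
      have h0 : g 0 = 0 := by
        have h1 : Tendsto g (𝓝[≠] 0) (𝓝 (g 0)) := hg.continuous.continuousAt.mono_left nhdsWithin_le_nhds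
        have h2 : Tendsto (fun r : ℝ => f (r • ![1, m]) / r ^ n * r ^ (n - k)) (𝓝[≠] 0) (𝓝 (l m * 0 ^ (n - k))) :=
          (h m).mul ((continuous_pow _).continuousAt.mono_left nhdsWithin_le_nhds)
        rw [zero_pow (by omega), mul_zero] at h2
        refine tendsto_nhds_unique h1 (h2.congr' ?_)
        filter_upwards [self_mem_nhdsWithin] with r hr
        have hr : r ≠ 0 := hr
        have : r ^ n = r ^ k * r ^ (n - k) := by rw [← pow_add]; congr 1; omega
        rw [e, this]
        field_simp
      obtain ⟨g', hg', e'⟩ := exists_eq_mul_of_zero hg h0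
      exact ⟨g', hg', fun r => by rw [e, e', pow_succ, mul_assoc]⟩
  obtain ⟨g, hg, e⟩ := main n le_rfl
  have hl : l m = g 0 := by
    have h1 : Tendsto g (𝓝[≠] 0) (𝓝 (g 0)) := hg.continuous.continuousAt.mono_left nhdsWithin_le_nhds
    refine tendsto_nhds_unique (h m) (h1.congr' ?_)
    filter_upwards [self_mem_nhdsWithin] with r hr
    have hr : r ≠ 0 := hr
    rw [e]; field_simp
  have h3 := iteratedDeriv_line hf ![1, m] n 0
  rw [funext e, iteratedDeriv_pow_mul n hg, zero_smul, hp] at h3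
  rw [hl, Polynomial.eval_mul, Polynomial.eval_C, ← h3]
  field_simp

/-- Evaluate the polynomial identity at `m = i`: the left side vanishes and the right side is `C i`.
-/
theorem eq_zero_of_eval_mul {p : Polynomial ℝ} {C : ℝ}
    (h : ∀ m : ℝ, p.eval m * (1 + m ^ 2) = C * m) : C = 0 := by
  have e : p * (1 + Polynomial.X ^ 2) = Polynomial.C C * Polynomial.X :=
    Polynomial.funext fun m => by simpa using h m
  have := congrArg (Polynomial.aeval Complex.I) e
  simpa using this.symm

end TaylorAlongRays

/-! ### Flatness forced by the logarithmic relation -/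

section LogRelation

theorem smul_ray (r m : ℝ) : r • (![1, m] : R2) = ![r, r * m] := by
  ext j; fin_cases j <;> simp

/-- A function whose `b`-derivative is flat differs along any two rays of equal abscissa by
a flat function. -/
theorem isBigO_sub_of_fderiv_sub_one {u : R2 → ℝ} (hu : ContDiff ℝ ∞ u)
    (hw : ∀ n : ℕ, (fun c => fderiv ℝ u c ![0, 1] - 1) =O[𝓝 0] fun c => ‖c‖ ^ n) (m : ℝ) (n : ℕ) :
    (fun r : ℝ => u ![r, r * m] - r * m - u ![r, 0]) =O[𝓝 0] fun r => r ^ (n + 1) := by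
  obtain ⟨C, hCp, hC⟩ := (hw n).exists_pos
  obtain ⟨ε, hε, hb⟩ := Metric.eventually_nhds_iff_ball.1 hC.bound
  refine Asymptotics.IsBigO.of_bound (C * (1 + |m|) ^ n * |m|) ?_
  filter_upwards [Metric.ball_mem_nhds (0 : ℝ) (show 0 < ε / (1 + |m|) by positivity)] with r hr
  rw [mem_ball_zero_iff, Real.norm_eq_abs, lt_div_iff₀ (by positivity)] at hr
  have hn : ∀ s : ℝ, |s| ≤ |r * m| → ‖(![r, s] : R2)‖ ≤ |r| * (1 + |m|) := by
    intro s hs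
    rw [abs_mul] at hs
    refine (pi_norm_le_iff_of_nonneg (by positivity)).2 fun j => ?_
    fin_cases j
    · change |r| ≤ _
      nlinarith [abs_nonneg r, abs_nonneg m]
    · change |s| ≤ _
      nlinarith [abs_nonneg r, abs_nonneg m]
  have hd : ∀ s : ℝ, HasDerivAt (fun s : ℝ => u ![r, s] - s) (fderiv ℝ u ![r, s] ![0, 1] - 1) s := by
    intro s
    have h1 : HasDerivAt (fun s : ℝ => (![r, s] : R2)) ![0, 1] s := by
      rw [hasDerivAt_pi]
      intro j
      fin_cases j
      · exact hasDerivAt_const s r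
      · exact hasDerivAt_id s
    exact ((hu.differentiable (by simp) _).hasFDerivAt.comp_hasDerivAt s h1).sub (hasDerivAt_id s)
  have key := (convex_closedBall (0 : ℝ) |r * m|).norm_image_sub_le_of_norm_hasDerivWithin_le
    (f := fun s : ℝ => u ![r, s] - s) (C := C * (|r| * (1 + |m|)) ^ n) (x := 0) (y := r * m)
    (fun s _ => (hd s).hasDerivWithinAt)
    (fun s hs => by
      have hs' := hn s (by simpa using hs)
      have := hb ![r, s] (by rw [mem_ball_zero_iff]; linarith)
      refine this.trans ?_
      rw [norm_pow, norm_norm]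
      gcongr)
    (Metric.mem_closedBall_self (abs_nonneg _)) (by rw [mem_closedBall_zero_iff, Real.norm_eq_abs])
  simp only [sub_zero, Real.norm_eq_abs] at key ⊢
  calc _ ≤ _ := key
    _ = _ := by rw [abs_mul, abs_pow, mul_pow, pow_succ]; ring

/-- On the ray of slope `m`, with `u = r V`, the relation becomes `(∂_b u - 1) log r² = log(1 + m²)
+ S - ∂_b u log(1 + V²)`, so both `∂_b u - 1` and the right side are flat. The first fact leaves
only a function of the abscissa to control, represented by `V 0`; the second shows that its Taylor
series would be visible in `S` with non-polynomial dependence on `m`. -/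
theorem isFlat_of_log_relation {u S : R2 → ℝ} (hu : ContDiff ℝ ∞ u) (hS : ContDiff ℝ ∞ S)
    (hu0 : u 0 = 0)
    (H : ∀ᶠ c in 𝓝 (0 : R2), c 0 ≠ 0 → fderiv ℝ u c ![0, 1] * Real.log (c 0 ^ 2 + u c ^ 2) =
      Real.log (c 0 ^ 2 + c 1 ^ 2) + S c) (n : ℕ) :
    iteratedFDeriv ℝ n (fun c => u c - c 1) 0 = 0 := by
  have hw : ContDiff ℝ ∞ fun c => fderiv ℝ u c ![0, 1] - 1 :=
    ((hu.fderiv_right (m := ∞) (by simp)).clm_apply contDiff_const).sub contDiff_const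
  have hray : ∀ m : ℝ, ContDiff ℝ ∞ fun r : ℝ => r • (![1, m] : R2) := fun m => by fun_prop
  have hV : ∀ m : ℝ, ∃ V : ℝ → ℝ, ContDiff ℝ ∞ V ∧ ∀ r : ℝ, u (r • ![1, m]) = r * V r := fun m =>
    exists_eq_mul_of_zero (hu.comp (hray m)) (by simp [hu0])
  choose V hVs hVe using hV
  have hlog : ∀ m, ContDiff ℝ ∞ fun r => Real.log (1 + V m r ^ 2) := fun m =>
    (contDiff_const.add ((hVs m).pow 2)).log fun r => by positivity
  -- the relation along a ray
  have hAB : ∀ m : ℝ, FlatAtZero (fun r : ℝ => fderiv ℝ u (r • ![1, m]) ![0, 1] - 1) ∧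
      FlatAtZero (fun r : ℝ => Real.log (1 + m ^ 2) + S (r • ![1, m])
        - fderiv ℝ u (r • ![1, m]) ![0, 1] * Real.log (1 + V m r ^ 2)) := by
    intro m
    refine flatAtZero_of_mul_log (hw.comp (hray m)) ?_ ?_
    · refine (contDiff_const.add (hS.comp (hray m))).sub (ContDiff.mul ?_ (hlog m))
      simpa using (hw.comp (hray m)).add (contDiff_const (c := (1 : ℝ)))
    · have ht : Tendsto (fun r : ℝ => r • (![1, m] : R2)) (𝓝[≠] 0) (𝓝 0) := by
        have := ((hray m).continuous.tendsto 0).mono_left (nhdsWithin_le_nhds (s := {0}ᶜ))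
        simpa using this
      filter_upwards [ht.eventually H, self_mem_nhdsWithin] with r hr hr0
      have hr0 : r ≠ 0 := hr0
      have h1 := hr (by simpa using hr0)
      rw [hVe] at h1
      have e0 : (r • (![1, m] : R2)) 0 = r := by simp
      have e1 : (r • (![1, m] : R2)) 1 = r * m := by simp
      rw [e0, e1] at h1
      have l1 : Real.log (r ^ 2 + (r * V m r) ^ 2) = Real.log (r ^ 2) + Real.log (1 + V m r ^ 2) := by
        rw [← Real.log_mul (by positivity) (by positivity)]; congr 1; ring
      have l2 : Real.log (r ^ 2 + (r * m) ^ 2) = Real.log (r ^ 2) + Real.log (1 + m ^ 2) := by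
        rw [← Real.log_mul (by positivity) (by positivity)]; congr 1; ring
      rw [l1, l2] at h1
      linarith
  have hwO := isBigO_pow_of_flatAtZero_rays hw fun m => (hAB m).1
  have hdiff : ∀ m : ℝ, FlatAtZero fun r => V m r - m - V 0 r := by
    intro m
    refine FlatAtZero.of_isBigO (((hVs m).sub contDiff_const).sub (hVs 0)) fun n => ?_
    obtain ⟨C, hC⟩ := ((isBigO_sub_of_fderiv_sub_one hu hwO m n).mono
      (nhdsWithin_le_nhds (s := {0}ᶜ))).bound
    refine Asymptotics.IsBigO.of_bound C ?_
    filter_upwards [hC, self_mem_nhdsWithin] with r hr hr0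
    have e0 : u ![r, 0] = r * V 0 r := by rw [← hVe, smul_ray, mul_zero]
    have e1 : u ![r, r * m] = r * V m r := by rw [← hVe, smul_ray]
    have e2 : u ![r, r * m] - r * m - u ![r, 0] = r * (V m r - m - V 0 r) := by rw [e0, e1]; ring
    rw [e2, norm_mul, norm_pow, pow_succ] at hr
    rw [norm_pow]
    refine le_of_mul_le_mul_left ?_ (norm_pos_iff.2 hr0)
    linarith
  -- the common part of the expansions vanishes
  have hV0 : FlatAtZero (V 0) := by
    intro n
    induction n with
    | zero => exact ⟨V 0, hVs 0, by simp⟩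
    | succ n ih =>
      obtain ⟨W, hW, eW⟩ := ih
      have hW0 : W 0 = 0 := by
        rcases Nat.eq_zero_or_pos n with rfl | hn
        · have h0 : ∀ m : ℝ, S 0 = Real.log (1 + (m + W 0) ^ 2) - Real.log (1 + m ^ 2) := by
            intro m
            have h1 := (hAB m).1.apply_zero
            have h2 := (hAB m).2.apply_zero
            have h3 := (hdiff m).apply_zero
            simp only [zero_smul] at h1 h2
            rw [eW, pow_zero, one_mul] at h3
            have h4 : V m 0 = m + W 0 := by linarith
            have h5 : fderiv ℝ u 0 ![0, 1] = 1 := by linarith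
            rw [h4, h5] at h2
            linarith
          -- Slope `0` gives `S 0 = log(1 + W²)`. At slope `-W / 2` the two logarithms are equal by
          -- symmetry, so `S 0 = 0`.
          have h1 := h0 0
          have h2 := h0 (-W 0 / 2)
          have h3 : -W 0 / 2 + W 0 = W 0 / 2 := by ring
          have h4 : (-W 0 / 2) ^ 2 = (W 0 / 2) ^ 2 := by ring
          rw [h3, h4, sub_self] at h2
          rw [h2] at h1
          norm_num at h1
          have h5 : Real.log (1 + W 0 ^ 2) = 0 := h1.symm
          rw [Real.log_eq_zero] at h5
          rcases h5 with h5 | h5 | h5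
          · nlinarith [sq_nonneg (W 0)]
          · have : W 0 ^ 2 = 0 := by linarith
            exact pow_eq_zero_iff (two_ne_zero) |>.1 this
          · nlinarith [sq_nonneg (W 0)]
        · have hlim : ∀ m : ℝ, Tendsto (fun r : ℝ => S (r • ![1, m]) / r ^ n) (𝓝[≠] 0)
              (𝓝 (W 0 * (2 * m / (1 + m ^ 2)))) := by
            intro m
            -- Adding `(∂_b u - 1) log(1 + V²)` eliminates `∂_b u`: up to a flat term, `S = log(1 +
            -- V²) - log(1 + m²)`. With `V = m + rⁿ (W + r R)` the leading coefficient of `S` is `W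
            -- 0` times the derivative `2m / (1 + m²)`.
            obtain ⟨D, hD, eD⟩ := ((hAB m).2.add ((hAB m).1.mul (hlog m))) (n + 1)
            obtain ⟨R, hR, eR⟩ := hdiff m (n + 1)
            have hψ : ContDiff ℝ ∞ fun x : ℝ => Real.log (1 + (m + x) ^ 2) - Real.log (1 + m ^ 2) :=
              ((contDiff_const.add ((contDiff_const.add contDiff_id).pow 2)).log
                fun r => by positivity).sub contDiff_const
            obtain ⟨χ, hχ, eχ⟩ := exists_eq_mul_of_zero hψ (by simp)
            have hχ0 : χ 0 = 2 * m / (1 + m ^ 2) := by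
              have d1 : HasDerivAt (fun x : ℝ => Real.log (1 + (m + x) ^ 2) - Real.log (1 + m ^ 2))
                  (2 * m / (1 + m ^ 2)) 0 := by
                have := (((((hasDerivAt_id (0 : ℝ)).const_add m).pow 2).const_add 1).log
                  (by simp; positivity)).sub_const (Real.log (1 + m ^ 2))
                refine this.congr_deriv ?_
                simp
              have d2 : HasDerivAt (fun x : ℝ => x * χ x) (χ 0) 0 := by
                have := (hasDerivAt_id (0 : ℝ)).mul (hχ.differentiable (by simp) 0).hasDerivAt
                refine this.congr_deriv ?_
                simp
              rw [funext eχ] at d1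
              exact d2.unique d1
            have hS' : ∀ r : ℝ, S (r • ![1, m]) = r ^ n * (r * D r +
                (W r + r * R r) * χ (r ^ n * (W r + r * R r))) := by
              intro r
              have h1 := eD r
              have h2 := eR r
              have h3 := eχ (r ^ n * (W r + r * R r))
              simp only [eW] at h1 h2
              have h4 : V m r = m + r ^ n * (W r + r * R r) := by
                rw [pow_succ] at h2; linear_combination h2
              rw [← h4] at h3
              rw [pow_succ r] at h1
              linear_combination h1 + h3
            have hcont : Continuous fun r : ℝ => r * D r +
                (W r + r * R r) * χ (r ^ n * (W r + r * R r)) := by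
              have := hD.continuous
              have := hW.continuous
              have := hR.continuous
              have := hχ.continuous
              fun_prop
            have ht := (hcont.tendsto 0).mono_left (nhdsWithin_le_nhds (s := {0}ᶜ))
            simp only [zero_mul, add_zero, zero_add, zero_pow hn.ne', hχ0] at ht
            refine ht.congr' ?_
            filter_upwards [self_mem_nhdsWithin] with r hr
            have hr : r ≠ 0 := hr
            rw [hS']
            field_simp
          obtain ⟨p, hp⟩ := exists_polynomial_of_tendsto_rays hS n hlim
          have : 2 * W 0 = 0 := eq_zero_of_eval_mul (p := p) fun m => by
            rw [← hp]
            have : 1 + m ^ 2 ≠ 0 := by positivity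
            field_simp
          linarith
      obtain ⟨W', hW', e'⟩ := exists_eq_mul_of_zero hW hW0
      exact ⟨W', hW', fun r => by rw [eW, e', pow_succ, mul_assoc]⟩
  have hs : ContDiff ℝ ∞ fun c : R2 => u c - c 1 := hu.sub (contDiff_apply ℝ ℝ 1)
  refine iteratedFDeriv_eq_zero_of_isBigO n hs (isBigO_pow_of_flatAtZero_rays hs fun m => ?_)
  have e : (fun r : ℝ => u (r • ![1, m]) - (r • (![1, m] : R2)) 1) =
      fun r => ((V m r - m - V 0 r) + V 0 r) * r := by
    ext r
    rw [hVe]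
    simp
    ring
  rw [e]
  exact ((hdiff m).add hV0).mul contDiff_id

end LogRelation

/-! ### Hamiltonian fields, the joint flow and its transport -/

section HamiltonianFlow

/-- The Hamiltonian vector fields of `q₁` and `q₂`. -/
def hamField (j : Fin 2) (x : R4) : R4 :=
  ![![-x 2, -x 3, x 0, x 1], ![x 0, -x 1, x 2, -x 3]] j

/-- The complex coordinate `x₁ + i x₂`. -/
def cz (x : R4) : ℂ := ⟨x 0, x 2⟩

/-- The complex coordinate `y₁ + i y₂`. -/
def cw (x : R4) : ℂ := ⟨x 1, x 3⟩

/-- The point of `ℝ⁴` with given complex coordinates. -/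
def ofComplex (z w : ℂ) : R4 := ![z.re, w.re, z.im, w.im]

theorem contDiff_q : ContDiff ℝ ∞ q := by
  rw [contDiff_pi]
  intro i
  fin_cases i
  · change ContDiff ℝ ∞ fun x : R4 => x 0 * x 3 - x 2 * x 1
    fun_prop
  · change ContDiff ℝ ∞ fun x : R4 => x 0 * x 1 + x 2 * x 3
    fun_prop

/-- The sign convention in force: the differential of `q_j` is the contraction of the form with
`hamField j`. -/
theorem fderiv_q (x v : R4) (j : Fin 2) : fderiv ℝ q x v j = omegaCan (hamField j x) v := by
  have hp : ∀ i : Fin 4, HasFDerivAt (fun x : R4 => x i)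
      (ContinuousLinearMap.proj (R := ℝ) (φ := fun _ : Fin 4 => ℝ) i) x := fun i =>
    (ContinuousLinearMap.proj (R := ℝ) (φ := fun _ : Fin 4 => ℝ) i).hasFDerivAt
  have h := hasFDerivAt_pi'.1 (contDiff_q.differentiable (by simp) x).hasFDerivAt j
  fin_cases j
  · have h1 := h.unique (((hp 0).mul (hp 3)).sub ((hp 2).mul (hp 1)))
    have := congrArg (fun L => L v) h1
    simp [omegaCan, hamField] at this ⊢
    rw [this]
    ring
  · have h1 := h.unique (((hp 0).mul (hp 1)).add ((hp 2).mul (hp 3)))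
    have := congrArg (fun L => L v) h1
    simp [omegaCan, hamField] at this ⊢
    rw [this]

theorem omegaCan_eq_zero {u : R4} (h : ∀ v, omegaCan u v = 0) : u = 0 := by
  have h0 := h ![0, 1, 0, 0]
  have h1 := h ![1, 0, 0, 0]
  have h2 := h ![0, 0, 0, 1]
  have h3 := h ![0, 0, 1, 0]
  simp [omegaCan] at h0 h1 h2 h3
  ext i
  fin_cases i <;> simpa

theorem omegaCan_sub_left (u u' v : R4) :
    omegaCan (u - u') v = omegaCan u v - omegaCan u' v := by
  simp [omegaCan]; ring

theorem omegaCan_sum_smul_left (a : Fin 2 → ℝ) (u : Fin 2 → R4) (v : R4) :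
    omegaCan (∑ i, a i • u i) v = ∑ i, a i * omegaCan (u i) v := by
  simp [omegaCan, Fin.sum_univ_two]; ring

theorem bijective_of_symplectic {L : R4 →L[ℝ] R4}
    (h : ∀ u v, omegaCan (L u) (L v) = omegaCan u v) : Function.Bijective L := by
  have hi : Function.Injective L := by
    refine (injective_iff_map_eq_zero L).2 fun u hu => omegaCan_eq_zero fun v => ?_
    rw [← h, hu]
    simp [omegaCan]
  exact ⟨hi, (LinearMap.injective_iff_surjective (f := (L : R4 →ₗ[ℝ] R4))).1 hi⟩

/-- A symplectic map `f` with `k ∘ q ∘ f = q` pushes the Hamiltonian field of `q_j` to that of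
`k_j ∘ q`. -/
theorem fderiv_hamField {f : R4 → R4} {k : R2 → R2} {x : R4} (hf : DifferentiableAt ℝ f x)
    (hs : ∀ u v, omegaCan (fderiv ℝ f x u) (fderiv ℝ f x v) = omegaCan u v)
    (hk : DifferentiableAt ℝ k (q (f x))) (hq : ∀ᶠ y in 𝓝 x, k (q (f y)) = q y) (j : Fin 2) :
    fderiv ℝ f x (hamField j x) =
      ∑ i, fderiv ℝ k (q (f x)) (Pi.single i 1) j • hamField i (f x) := by
  rw [← sub_eq_zero]
  refine omegaCan_eq_zero fun w => ?_
  obtain ⟨v, rfl⟩ := (bijective_of_symplectic hs).2 w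
  rw [omegaCan_sub_left, hs, omegaCan_sum_smul_left, ← fderiv_q, sub_eq_zero]
  have hqd : DifferentiableAt ℝ q (f x) := contDiff_q.differentiable (by simp) _
  have e : fderiv ℝ q x = (fderiv ℝ k (q (f x))).comp ((fderiv ℝ q (f x)).comp (fderiv ℝ f x)) := by
    have hq' : (fun y => k (q (f y))) =ᶠ[𝓝 x] q := hq
    rw [← hq'.fderiv_eq]
    exact (hk.hasFDerivAt.comp x (hqd.hasFDerivAt.comp x hf.hasFDerivAt)).fderiv
  rw [e]
  simp only [ContinuousLinearMap.comp_apply, ← fderiv_q]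
  set c : R2 := fderiv ℝ q (f x) (fderiv ℝ f x v)
  have hc : c = ∑ i, c i • (Pi.single i 1 : R2) := by
    ext i; fin_cases i <;> simp [Fin.sum_univ_two]
  conv_lhs => rw [hc, map_sum]
  simp [Fin.sum_univ_two, mul_comm]

theorem q_ofComplex (z w : ℂ) : q (ofComplex z w) =
    ![(starRingEnd ℂ z * w).im, (starRingEnd ℂ z * w).re] := by
  ext i
  fin_cases i
  · simp [q, ofComplex]; ring
  · simp [q, ofComplex]

theorem ofComplex_cz_cw (x : R4) : ofComplex (cz x) (cw x) = x := by
  ext i; fin_cases i <;> rfl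

theorem norm_ofComplex_le (z w : ℂ) : ‖ofComplex z w‖ ≤ max ‖z‖ ‖w‖ := by
  refine (pi_norm_le_iff_of_nonneg (by positivity)).2 fun i => ?_
  fin_cases i
  · exact (Complex.abs_re_le_norm z).trans (le_max_left _ _)
  · exact (Complex.abs_re_le_norm w).trans (le_max_right _ _)
  · exact (Complex.abs_im_le_norm z).trans (le_max_left _ _)
  · exact (Complex.abs_im_le_norm w).trans (le_max_right _ _)

theorem normSq_cz_mul_normSq_cw (x : R4) :
    Complex.normSq (cz x) * Complex.normSq (cw x) = q x 0 ^ 2 + q x 1 ^ 2 := by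
  simp [Complex.normSq_apply, cz, cw, q]; ring

/-- The joint flow of `q₁`, `q₂` at time `t (a, b)`. -/
noncomputable def jointFlow (a b : ℝ) (z w : ℂ) (t : ℝ) : R4 :=
  ofComplex (Complex.exp (t * (b + a * Complex.I)) * z) (Complex.exp (t * (-b + a * Complex.I)) * w)

theorem hasDerivAt_exp_mul (s z : ℂ) (t : ℝ) :
    HasDerivAt (fun t : ℝ => Complex.exp (t * s) * z) (s * (Complex.exp (t * s) * z)) t := by
  have h1 : HasDerivAt (fun t : ℝ => (t : ℂ) * s) s t := by
    simpa using (Complex.ofRealCLM.hasDerivAt (x := t)).mul_const s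
  refine (h1.cexp.mul_const z).congr_deriv ?_
  ring

theorem hasDerivAt_re {f : ℝ → ℂ} {f' : ℂ} {t : ℝ} (h : HasDerivAt f f' t) :
    HasDerivAt (fun t => (f t).re) f'.re t :=
  Complex.reCLM.hasFDerivAt.comp_hasDerivAt t h

theorem hasDerivAt_im {f : ℝ → ℂ} {f' : ℂ} {t : ℝ} (h : HasDerivAt f f' t) :
    HasDerivAt (fun t => (f t).im) f'.im t :=
  Complex.imCLM.hasFDerivAt.comp_hasDerivAt t h

theorem hasDerivAt_jointFlow (a b : ℝ) (z w : ℂ) (t : ℝ) :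
    HasDerivAt (jointFlow a b z w)
      (a • hamField 0 (jointFlow a b z w t) + b • hamField 1 (jointFlow a b z w t)) t := by
  have hz := hasDerivAt_exp_mul (b + a * Complex.I) z t
  have hw := hasDerivAt_exp_mul (-b + a * Complex.I) w t
  rw [hasDerivAt_pi]
  intro i
  fin_cases i
  · refine (hasDerivAt_re hz).congr_deriv ?_
    simp [hamField, jointFlow, ofComplex]; ring
  · refine (hasDerivAt_re hw).congr_deriv ?_
    simp [hamField, jointFlow, ofComplex]; ring
  · refine (hasDerivAt_im hz).congr_deriv ?_
    simp [hamField, jointFlow, ofComplex]; ring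
  · refine (hasDerivAt_im hw).congr_deriv ?_
    simp [hamField, jointFlow, ofComplex]; ring

theorem q_jointFlow (a b : ℝ) (z w : ℂ) (t : ℝ) : q (jointFlow a b z w t) = q (ofComplex z w) := by
  have : starRingEnd ℂ (Complex.exp (t * (b + a * Complex.I)) * z) *
      (Complex.exp (t * (-b + a * Complex.I)) * w) = starRingEnd ℂ z * w := by
    rw [map_mul, ← Complex.exp_conj]
    have e : Complex.exp (starRingEnd ℂ (t * (b + a * Complex.I))) *
        Complex.exp (t * (-b + a * Complex.I)) = 1 := by
      rw [← Complex.exp_add, ← Complex.exp_zero]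
      congr 1
      simp
      ring
    linear_combination (starRingEnd ℂ z * w) * e
  rw [jointFlow, q_ofComplex, q_ofComplex, this]

/-- Both moduli are monotone in `t`, so bounds at the two ends of the orbit keep it inside the ball
where `f` is controlled. -/
theorem norm_jointFlow_lt {a b : ℝ} {z w : ℂ} {ε : ℝ} (hz : ‖z‖ < ε) (hw : ‖w‖ < ε)
    (hz' : Real.exp b * ‖z‖ < ε) (hw' : Real.exp (-b) * ‖w‖ < ε) {t : ℝ} (ht : t ∈ Set.Icc (0 : ℝ) 1) :
    ‖jointFlow a b z w t‖ < ε := by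
  have key : ∀ (b : ℝ) (z : ℂ), ‖z‖ < ε → Real.exp b * ‖z‖ < ε →
      ‖Complex.exp (t * (b + a * Complex.I)) * z‖ < ε := by
    intro b z hz hz'
    rw [norm_mul, Complex.norm_exp]
    have e : ((t : ℂ) * (b + a * Complex.I)).re = t * b := by simp
    rw [e]
    rcases le_total 0 b with hb | hb
    · refine lt_of_le_of_lt ?_ hz'
      gcongr
      nlinarith [ht.2]
    · refine lt_of_le_of_lt ?_ hz
      have : Real.exp (t * b) ≤ 1 := Real.exp_le_one_iff.2 (mul_nonpos_of_nonneg_of_nonpos ht.1 hb)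
      nlinarith [norm_nonneg z]
  refine (norm_ofComplex_le _ _).trans_lt (max_lt (key b z hz hz') ?_)
  have := key (-b) w hw hw'
  push_cast at this
  exact this

theorem eq_exp_mul_of_hasDerivAt {f : ℝ → ℂ} {s : ℂ}
    (h : ∀ t ∈ Set.Icc (0 : ℝ) 1, HasDerivAt f (s * f t) t) : f 1 = Complex.exp s * f 0 := by
  have hd : ∀ t ∈ Set.Icc (0 : ℝ) 1, HasDerivAt (fun t : ℝ => Complex.exp (t * (-s)) * f t) 0 t := by
    intro t ht
    have h1 := hasDerivAt_exp_mul (-s) 1 t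
    simp only [mul_one] at h1
    refine (h1.mul (h t ht)).congr_deriv ?_
    ring
  have := constant_of_has_deriv_right_zero
    (fun t ht => (hd t ht).continuousAt.continuousWithinAt)
    (fun t ht => (hd t ⟨ht.1, ht.2.le⟩).hasDerivWithinAt) 1 (by simp)
  simp only [Complex.ofReal_one, one_mul, Complex.ofReal_zero, zero_mul, Complex.exp_zero] at this
  rw [← this, ← mul_assoc, ← Complex.exp_add]
  simp

/-- The local conditions relating a symplectic map `f` to a map `k₀` of the base with
inverse `k`. -/
def IsGoodAt (f : R4 → R4) (k₀ k : R2 → R2) (x : R4) : Prop :=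
  DifferentiableAt ℝ f x ∧ (∀ u v, omegaCan (fderiv ℝ f x u) (fderiv ℝ f x v) = omegaCan u v) ∧
    DifferentiableAt ℝ k (q (f x)) ∧ (∀ᶠ y in 𝓝 x, k (q (f y)) = q y) ∧ q (f x) = k₀ (q x)

/-- `f` transports the joint flow of `(q₁, q₂)` into a joint flow, with times given by the
derivative of `k`. -/
theorem transport_jointFlow {f : R4 → R4} {k₀ k : R2 → R2} {ε : ℝ}
    (hgood : ∀ x, ‖x‖ < ε → IsGoodAt f k₀ k x) {a b : ℝ} {z w : ℂ} (hz : ‖z‖ < ε) (hw : ‖w‖ < ε)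
    (hz' : Real.exp b * ‖z‖ < ε) (hw' : Real.exp (-b) * ‖w‖ < ε) {K : R2 →L[ℝ] R2}
    (hK : K = fderiv ℝ k (k₀ (q (ofComplex z w)))) {α β : ℝ}
    (hα : α = a * K (Pi.single 0 1) 0 + b * K (Pi.single 0 1) 1)
    (hβ : β = a * K (Pi.single 1 1) 0 + b * K (Pi.single 1 1) 1) :
    cz (f (jointFlow a b z w 1)) = Complex.exp (β + α * Complex.I) * cz (f (ofComplex z w)) ∧
    cw (f (jointFlow a b z w 1)) = Complex.exp (-β + α * Complex.I) * cw (f (ofComplex z w)) := by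
  have hd : ∀ t ∈ Set.Icc (0 : ℝ) 1, HasDerivAt (fun t => f (jointFlow a b z w t))
      (α • hamField 0 (f (jointFlow a b z w t)) + β • hamField 1 (f (jointFlow a b z w t))) t := by
    intro t ht
    obtain ⟨h1, h2, h3, h4, h5⟩ := hgood _ (norm_jointFlow_lt (a := a) hz hw hz' hw' ht)
    refine (h1.hasFDerivAt.comp_hasDerivAt t (hasDerivAt_jointFlow a b z w t)).congr_deriv ?_
    -- Since `q` is constant along the flow, so is the derivative of `k`. The image curve therefore
    -- solves a linear equation with constant coefficients `α`, `β`, which decouples in the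
    -- coordinates `z`, `w`.
    rw [map_add, map_smul, map_smul, fderiv_hamField h1 h2 h3 h4, fderiv_hamField h1 h2 h3 h4, h5,
      q_jointFlow, ← hK, hα, hβ]
    simp only [Fin.sum_univ_two]
    module
  have h0 : jointFlow a b z w 0 = ofComplex z w := by simp [jointFlow]
  have hcoord : ∀ t ∈ Set.Icc (0 : ℝ) 1, ∀ i, HasDerivAt (fun t => f (jointFlow a b z w t) i)
      ((α • hamField 0 (f (jointFlow a b z w t)) + β • hamField 1 (f (jointFlow a b z w t))) i) t :=
    fun t ht i => hasDerivAt_pi.1 (hd t ht) i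
  have cplx : ∀ {x y : ℝ → ℝ} {x' y' t : ℝ}, HasDerivAt x x' t → HasDerivAt y y' t →
      HasDerivAt (fun t => (⟨x t, y t⟩ : ℂ)) ⟨x', y'⟩ t := by
    intro x y x' y' t hx hy
    have := hx.ofReal_comp.add (hy.ofReal_comp.mul_const Complex.I)
    have e : (fun t => (⟨x t, y t⟩ : ℂ)) = fun t => (x t : ℂ) + y t * Complex.I :=
      funext fun t => Complex.ext (by simp) (by simp)
    rw [e]
    exact this.congr_deriv (Complex.ext (by simp) (by simp))
  constructor
  · have := eq_exp_mul_of_hasDerivAt (f := fun t => cz (f (jointFlow a b z w t)))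
      (s := β + α * Complex.I) fun t ht => by
        refine (cplx (hcoord t ht 0) (hcoord t ht 2)).congr_deriv ?_
        apply Complex.ext <;> simp [hamField, cz] <;> ring
    simpa only [h0] using this
  · have := eq_exp_mul_of_hasDerivAt (f := fun t => cw (f (jointFlow a b z w t)))
      (s := -β + α * Complex.I) fun t ht => by
        refine (cplx (hcoord t ht 1) (hcoord t ht 3)).congr_deriv ?_
        apply Complex.ext <;> simp [hamField, cw] <;> ring
    simpa only [h0] using this

end HamiltonianFlow

/-! ### The first component: periodicity of the flow of `q₁` -/

section Necessity

/-- A symplectic map `f` near the origin of `ℝ⁴` lifting a local diffeomorphism `k₀` of the base,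
with inverse `k`. -/
structure IsLocalLift (f : R4 → R4) (k₀ k : R2 → R2) : Prop where
  map_zero : f 0 = 0
  base_zero : k₀ 0 = 0
  inv_zero : k 0 = 0
  smooth : ∀ᶠ x in 𝓝 (0 : R4), ContDiffAt ℝ ∞ f x
  base_smooth : ∀ᶠ c in 𝓝 (0 : R2), ContDiffAt ℝ ∞ k₀ c
  inv_smooth : ∀ᶠ c in 𝓝 (0 : R2), ContDiffAt ℝ ∞ k c
  symplectic : ∀ᶠ x in 𝓝 (0 : R4), ∀ u v, omegaCan (fderiv ℝ f x u) (fderiv ℝ f x v) = omegaCan u v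
  lift : ∀ᶠ x in 𝓝 (0 : R4), q (f x) = k₀ (q x)
  left_inv : ∀ᶠ c in 𝓝 (0 : R2), k (k₀ c) = c
  right_inv : ∀ᶠ c in 𝓝 (0 : R2), k₀ (k c) = c
  ne_zero : ∀ᶠ x in 𝓝 (0 : R4), x ≠ 0 → f x ≠ 0

variable {f : R4 → R4} {k₀ k : R2 → R2}

theorem tendsto_zero_of_contDiffAt {E : Type*} [NormedAddCommGroup E] [NormedSpace ℝ E] {f : E → E}
    (h : ∀ᶠ x in 𝓝 (0 : E), ContDiffAt ℝ ∞ f x) (h0 : f 0 = 0) : Tendsto f (𝓝 0) (𝓝 0) := by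
  simpa [h0] using h.self_of_nhds.continuousAt.tendsto

theorem IsLocalLift.exists_good (h : IsLocalLift f k₀ k) :
    ∃ ε > 0, ∀ x, ‖x‖ < ε → IsGoodAt f k₀ k x := by
  have t1 := tendsto_zero_of_contDiffAt h.smooth h.map_zero
  have h1 : ∀ᶠ x in 𝓝 (0 : R4), k (q (f x)) = q x := by
    filter_upwards [h.lift, q_tendsto.eventually h.left_inv] with x h1 h2
    rw [h1, h2]
  have : ∀ᶠ x in 𝓝 (0 : R4), IsGoodAt f k₀ k x := by
    filter_upwards [h.smooth, h.symplectic, (q_tendsto.comp t1).eventually h.inv_smooth,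
      h1.eventually_nhds, h.lift] with x a1 a2 a3 a4 a5
    exact ⟨a1.differentiableAt (by simp), a2, a3.differentiableAt (by simp), a4, a5⟩
  obtain ⟨ε, hε, hb⟩ := Metric.eventually_nhds_iff_ball.1 this
  exact ⟨ε, hε, fun x hx => hb x (by simpa using hx)⟩

/-- The complex number `b + i a`. -/
def toComplex (c : R2) : ℂ := ⟨c 1, c 0⟩

theorem normSq_toComplex (c : R2) : Complex.normSq (toComplex c) = c 0 ^ 2 + c 1 ^ 2 := by
  simp [Complex.normSq_apply, toComplex]; ring

theorem toComplex_ne_zero {c : R2} (hc : c ≠ 0) : toComplex c ≠ 0 := by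
  contrapose! hc
  have h0 := congrArg Complex.im hc
  have h1 := congrArg Complex.re hc
  ext i
  fin_cases i
  · exact h0
  · exact h1

theorem continuous_toComplex : Continuous toComplex := by
  have : toComplex = fun c => (c 1 : ℂ) + c 0 * Complex.I :=
    funext fun c => Complex.ext (by simp [toComplex]) (by simp [toComplex])
  rw [this]
  fun_prop

theorem q_ofComplex_eq {z w : ℂ} {c : R2} (h : starRingEnd ℂ z * w = toComplex c) :
    q (ofComplex z w) = c := by
  rw [q_ofComplex, h]
  ext i; fin_cases i <;> rfl

theorem sum_sq_ne_zero {c : R2} (hc : c ≠ 0) : c 0 ^ 2 + c 1 ^ 2 ≠ 0 := by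
  rw [← normSq_toComplex]
  exact fun h => toComplex_ne_zero hc (Complex.normSq_eq_zero.1 h)

theorem IsLocalLift.base_ne_zero (h : IsLocalLift f k₀ k) : ∀ᶠ c in 𝓝 (0 : R2), c ≠ 0 → k₀ c ≠ 0 := by
  filter_upwards [h.left_inv] with c hc h0 h1
  rw [h1, h.inv_zero] at hc
  exact h0 hc.symm

theorem IsLocalLift.inv_ne_zero (h : IsLocalLift f k₀ k) : ∀ᶠ c in 𝓝 (0 : R2), c ≠ 0 → k c ≠ 0 := by
  filter_upwards [h.right_inv] with c hc h0 h1
  rw [h1, h.base_zero] at hc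
  exact h0 hc.symm

/-- The `2π`-periodic orbit of `q₁` is sent to a closed joint orbit through a point with `z ≠ 0`, so
the exponential multiplier there equals `1`: its real part in the exponent vanishes and its
imaginary part is in `2πℤ`. -/
theorem IsLocalLift.fderiv_fst (h : IsLocalLift f k₀ k) : ∀ᶠ c in 𝓝 (0 : R2), c ≠ 0 →
    fderiv ℝ k (k₀ c) (Pi.single 1 1) 0 = 0 ∧ ∃ n : ℤ, fderiv ℝ k (k₀ c) (Pi.single 0 1) 0 = n := by
  obtain ⟨ε, hε, hgood⟩ := h.exists_good
  have ht : Tendsto (fun c => Real.sqrt ‖toComplex c‖) (𝓝 0) (𝓝 0) := by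
    have := (Real.continuous_sqrt.comp continuous_toComplex.norm).tendsto (0 : R2)
    have e : toComplex 0 = 0 := rfl
    simpa [Function.comp_def, e] using this
  filter_upwards [ht.eventually (gt_mem_nhds hε), h.base_ne_zero] with c hc hk hc0
  -- The point of the leaf over `c` with `|z| = |w| = √|c|` tends to the origin with `c`, and
  -- rotation preserves both moduli.
  set s := Real.sqrt ‖toComplex c‖ with hs
  have hC := toComplex_ne_zero hc0
  have hsp : 0 < s := Real.sqrt_pos.2 (norm_pos_iff.2 hC)
  have hss : s * s = ‖toComplex c‖ := Real.mul_self_sqrt (norm_nonneg _)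
  have hz : ‖(s : ℂ)‖ = s := by simp [abs_of_pos hsp]
  have hw : ‖toComplex c / s‖ = s := by rw [norm_div, hz, ← hss]; field_simp
  have hsC : (s : ℂ) ≠ 0 := by exact_mod_cast hsp.ne'
  have hq : q (ofComplex s (toComplex c / s)) = c := q_ofComplex_eq (by simp; field_simp)
  have key := (transport_jointFlow hgood (a := 2 * Real.pi) (b := 0) (z := s) (w := toComplex c / s)
    (by rw [hz]; exact hc) (by rw [hw]; exact hc) (by simp only [Real.exp_zero, hz]; linarith)
    (by simp only [neg_zero, Real.exp_zero, hw]; linarith) rfl rfl rfl).1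
  have hx : jointFlow (2 * Real.pi) 0 s (toComplex c / s) 1 = ofComplex s (toComplex c / s) := by
    simp [jointFlow, Complex.exp_two_pi_mul_I]
  rw [hx, hq] at key
  have hne : cz (f (ofComplex s (toComplex c / s))) ≠ 0 := by
    intro h0
    have h1 := normSq_cz_mul_normSq_cw (f (ofComplex s (toComplex c / s)))
    have h2 : ‖ofComplex s (toComplex c / s)‖ < ε :=
      (norm_ofComplex_le _ _).trans_lt (by rw [hz, hw, max_self]; exact hc)
    rw [(hgood _ h2).2.2.2.2, hq, h0, Complex.normSq_zero, zero_mul] at h1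
    exact sum_sq_ne_zero (hk hc0) h1.symm
  have h1 := mul_right_cancel₀ hne ((one_mul _).trans key)
  simp only [zero_mul, add_zero] at h1
  obtain ⟨n, hn⟩ := Complex.exp_eq_one_iff.1 h1.symm
  have hre := congrArg Complex.re hn
  have him := congrArg Complex.im hn
  simp at hre him
  have hpi := Real.pi_pos.ne'
  refine ⟨hre, n, ?_⟩
  have : (2 * Real.pi) * fderiv ℝ k (k₀ c) (Pi.single 0 1) 0 = (2 * Real.pi) * n := by linarith
  exact mul_left_cancel₀ (by positivity) this

/-- The derivative of `k_a` in `a` is continuous and integer-valued off the origin. Its limit there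
is an integer `N` because `ℤ` is closed, and nearby values within distance `1` of `N` equal `N`. -/
theorem IsLocalLift.inv_fst (h : IsLocalLift f k₀ k) :
    ∃ n : ℤ, ∀ᶠ c in 𝓝 (0 : R2), k c 0 = n * c 0 := by
  have tk := tendsto_zero_of_contDiffAt h.inv_smooth h.inv_zero
  have h1 : ∀ᶠ c in 𝓝 (0 : R2), c ≠ 0 → fderiv ℝ k c (Pi.single 1 1) 0 = 0 ∧
      ∃ n : ℤ, fderiv ℝ k c (Pi.single 0 1) 0 = n := by
    filter_upwards [tk.eventually h.fderiv_fst, h.inv_ne_zero, h.right_inv] with c h1 h2 h3 h4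
    rw [h3] at h1
    exact h1 (h2 h4)
  have hcont : ∀ v : R2, ContinuousAt (fun c => fderiv ℝ k c v 0) 0 := by
    intro v
    have h2 : ContinuousAt (fderiv ℝ k) 0 :=
      (h.inv_smooth.self_of_nhds.fderiv_right (m := ∞) (by simp)).continuousAt
    have h3 : ContinuousAt (fun c => fderiv ℝ k c v) 0 := h2.clm_apply continuousAt_const
    exact (continuous_apply 0).continuousAt.comp h3
  have h1' := eventually_nhdsWithin_iff.2 h1
  have hN : fderiv ℝ k 0 (Pi.single 0 1) 0 ∈ Set.range ((↑) : ℤ → ℝ) := by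
    refine Int.isClosedEmbedding_coe_real.isClosed_range.mem_of_tendsto
      ((hcont (Pi.single 0 1)).tendsto.mono_left (nhdsWithin_le_nhds (s := {0}ᶜ))) ?_
    filter_upwards [h1'] with c hc
    obtain ⟨n, hn⟩ := hc.2
    exact ⟨n, hn.symm⟩
  obtain ⟨N, hN⟩ := hN
  have h01 : fderiv ℝ k 0 (Pi.single 1 1) 0 = 0 := by
    refine tendsto_nhds_unique_of_eventuallyEq
      ((hcont (Pi.single 1 1)).tendsto.mono_left (nhdsWithin_le_nhds (s := {0}ᶜ)))
      (tendsto_const_nhds) ?_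
    filter_upwards [h1'] with c hc using hc.1
  refine ⟨N, ?_⟩
  have h2 : ∀ᶠ c in 𝓝 (0 : R2), ∀ v, fderiv ℝ k c v 0 = N * v 0 := by
    have h3 : ∀ᶠ c in 𝓝 (0 : R2), |fderiv ℝ k c (Pi.single 0 1) 0 - N| < 1 := by
      have := (hcont (Pi.single 0 1)).tendsto
      rw [← hN] at this
      filter_upwards [this.eventually (Metric.ball_mem_nhds _ one_pos)] with c hc
      simpa [Real.dist_eq] using hc
    filter_upwards [h1, h3] with c h1 h3 v
    have hv : v = v 0 • (Pi.single 0 1 : R2) + v 1 • (Pi.single 1 1 : R2) := by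
      ext i; fin_cases i <;> simp
    have e : fderiv ℝ k c (Pi.single 0 1) 0 = N ∧ fderiv ℝ k c (Pi.single 1 1) 0 = 0 := by
      by_cases hc : c = 0
      · rw [hc]; exact ⟨hN.symm, h01⟩
      · obtain ⟨h4, n, h5⟩ := h1 hc
        refine ⟨?_, h4⟩
        rw [h5] at h3 ⊢
        have h6 : |n - N| < 1 := by exact_mod_cast h3
        rw [Int.abs_lt_one_iff] at h6
        have : n = N := by linarith
        rw [this]
    rw [hv, map_add, map_smul, map_smul]
    simp [e.1, e.2, mul_comm]
  obtain ⟨ε, hε, hb⟩ := Metric.eventually_nhds_iff_ball.1 (h2.and h.inv_smooth)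
  filter_upwards [Metric.ball_mem_nhds (0 : R2) hε] with c hc
  have hd : ∀ y ∈ Metric.ball (0 : R2) ε, HasFDerivAt (fun c => k c 0 - N * c 0)
      ((ContinuousLinearMap.proj (R := ℝ) (φ := fun _ : Fin 2 => ℝ) 0).comp (fderiv ℝ k y) -
        (N : ℝ) • ContinuousLinearMap.proj (R := ℝ) (φ := fun _ : Fin 2 => ℝ) 0) y := by
    intro y hy
    have h1 := ((hb y hy).2.differentiableAt (by simp)).hasFDerivAt
    exact (((ContinuousLinearMap.proj (R := ℝ) (φ := fun _ : Fin 2 => ℝ) 0).hasFDerivAt.comp y h1)).sub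
      ((ContinuousLinearMap.proj (R := ℝ) (φ := fun _ : Fin 2 => ℝ) 0).hasFDerivAt.const_mul (N : ℝ))
  have key := (convex_ball (0 : R2) ε).norm_image_sub_le_of_norm_hasFDerivWithin_le (C := 0)
    (fun y hy => (hd y hy).hasFDerivWithinAt)
    (fun y hy => by
      refine le_of_eq (norm_eq_zero.2 ?_)
      ext v
      simp [(hb y hy).1 v])
    (Metric.mem_ball_self hε) hc
  rw [zero_mul] at key
  have := norm_le_zero_iff.1 key
  simp only [h.inv_zero, Pi.zero_apply, mul_zero, sub_zero] at this
  linarith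

end Necessity

/-! ### The second component: passage time near the singular point -/

section LogRelationOfLift

variable {f : R4 → R4} {k₀ k : R2 → R2}

theorem contDiff_normSq_cz : ContDiff ℝ ∞ fun x : R4 => Complex.normSq (cz x) := by
  simp only [Complex.normSq_apply, cz]; fun_prop

theorem contDiff_normSq_cw : ContDiff ℝ ∞ fun x : R4 => Complex.normSq (cw x) := by
  simp only [Complex.normSq_apply, cw]; fun_prop

theorem eq_zero_of_normSq {x : R4} (hz : Complex.normSq (cz x) = 0) (hw : Complex.normSq (cw x) = 0) :
    x = 0 := by
  rw [← ofComplex_cz_cw x, Complex.normSq_eq_zero.1 hz, Complex.normSq_eq_zero.1 hw]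
  ext i; fin_cases i <;> rfl

/-- Ratios growing like `exp (s κ b)` with `b → ∞` and `s κ(0) ≠ 0` cannot have a finite nonzero limit. -/
theorem not_exp_growth {X : Type*} {l : Filter X} [l.NeBot] {F G κ b : X → ℝ} {F₀ G₀ κ₀ s : ℝ}
    (hF : Tendsto F l (𝓝 F₀)) (hG : Tendsto G l (𝓝 G₀)) (hκ : Tendsto κ l (𝓝 κ₀))
    (hb : Tendsto b l atTop) (hF₀ : F₀ ≠ 0) (hG₀ : G₀ ≠ 0) (hκ₀ : κ₀ ≠ 0) (hs : s ≠ 0)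
    (h : ∀ᶠ c in l, F c = Real.exp (s * κ c * b c) * G c) : False := by
  have h1 : Tendsto (fun c => (Real.log (F c) - Real.log (G c)) * (b c)⁻¹) l
      (𝓝 ((Real.log F₀ - Real.log G₀) * 0)) :=
    ((hF.log hF₀).sub (hG.log hG₀)).mul hb.inv_tendsto_atTop
  have h2 : Tendsto (fun c => (Real.log (F c) - Real.log (G c)) * (b c)⁻¹) l (𝓝 (s * κ₀)) := by
    refine (hκ.const_mul s).congr' ?_
    filter_upwards [h, hG.eventually_ne hG₀, hb.eventually_gt_atTop 0] with c hc hg hb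
    rw [hc, Real.log_mul (Real.exp_ne_zero _) hg, Real.log_exp]
    field_simp
    ring
  rw [mul_zero] at h1
  exact mul_ne_zero hs hκ₀ (tendsto_nhds_unique h2 h1)

/-- The point of the leaf over `c` with second complex coordinate `δ`. -/
noncomputable def stablePoint (δ : ℝ) (c : R2) : R4 :=
  ofComplex (starRingEnd ℂ (toComplex c) / δ) δ

/-- The point of the leaf over `c` with first complex coordinate `δ`. -/
noncomputable def unstablePoint (δ : ℝ) (c : R2) : R4 := ofComplex δ (toComplex c / δ)

theorem contDiff_stablePoint (δ : ℝ) : ContDiff ℝ ∞ (stablePoint δ) := by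
  rw [contDiff_pi]
  intro i
  fin_cases i
  · have : (fun c => stablePoint δ c 0) = fun c : R2 => c 1 / δ := by
      ext c; simp [stablePoint, ofComplex, toComplex]
    exact this ▸ by fun_prop
  · exact contDiff_const
  · have : (fun c => stablePoint δ c 2) = fun c : R2 => -c 0 / δ := by
      ext c; simp [stablePoint, ofComplex, toComplex]
    exact this ▸ by fun_prop
  · exact contDiff_const

theorem contDiff_unstablePoint (δ : ℝ) : ContDiff ℝ ∞ (unstablePoint δ) := by
  rw [contDiff_pi]
  intro i
  fin_cases i
  · exact contDiff_const
  · have : (fun c => unstablePoint δ c 1) = fun c : R2 => c 1 / δ := by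
      ext c; simp [unstablePoint, ofComplex, toComplex]
    exact this ▸ by fun_prop
  · exact contDiff_const
  · have : (fun c => unstablePoint δ c 3) = fun c : R2 => c 0 / δ := by
      ext c; simp [unstablePoint, ofComplex, toComplex]
    exact this ▸ by fun_prop

theorem q_stablePoint {δ : ℝ} (hδ : 0 < δ) (c : R2) : q (stablePoint δ c) = c :=
  q_ofComplex_eq (by
    have : (δ : ℂ) ≠ 0 := by exact_mod_cast hδ.ne'
    simp; field_simp)

theorem q_unstablePoint {δ : ℝ} (hδ : 0 < δ) (c : R2) : q (unstablePoint δ c) = c :=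
  q_ofComplex_eq (by
    have : (δ : ℂ) ≠ 0 := by exact_mod_cast hδ.ne'
    simp; field_simp)

theorem stablePoint_zero (δ : ℝ) : stablePoint δ 0 = ofComplex 0 δ := by
  have e : toComplex 0 = 0 := rfl
  simp [stablePoint, e]

theorem unstablePoint_zero (δ : ℝ) : unstablePoint δ 0 = ofComplex δ 0 := by
  have e : toComplex 0 = 0 := rfl
  simp [unstablePoint, e]

theorem norm_stablePoint_lt {δ : ℝ} (hδ : 0 < δ) {c : R2} (hc : ‖toComplex c‖ ≤ δ * δ) {ε : ℝ}
    (hε : δ < ε) : ‖stablePoint δ c‖ < ε ∧ ‖unstablePoint δ c‖ < ε := by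
  have h1 : ‖toComplex c‖ / δ ≤ δ := by rwa [div_le_iff₀ hδ]
  have h2 : ‖(δ : ℂ)‖ = δ := by simp [abs_of_pos hδ]
  constructor
  · refine (norm_ofComplex_le _ _).trans_lt (max_lt ?_ (by rwa [h2]))
    rw [norm_div, RCLike.norm_conj, h2]; linarith
  · refine (norm_ofComplex_le _ _).trans_lt (max_lt (by rwa [h2]) ?_)
    rw [norm_div, h2]; linarith

/-- The passage near the singular point from the stable to the unstable plane. -/
theorem passage {ε δ : ℝ} (hgood : ∀ x, ‖x‖ < ε → IsGoodAt f k₀ k x) (hδ : 0 < δ) (hε : δ < ε) {c : R2}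
    (hc : ‖toComplex c‖ ≤ δ * δ) (hc0 : c ≠ 0) (h1 : fderiv ℝ k (k₀ c) (Pi.single 1 1) 0 = 0) :
    Complex.normSq (cz (f (unstablePoint δ c))) =
      Real.exp (2 * fderiv ℝ k (k₀ c) (Pi.single 1 1) 1 * Real.log (δ * δ / ‖toComplex c‖)) *
        Complex.normSq (cz (f (stablePoint δ c))) ∧
    Complex.normSq (cw (f (unstablePoint δ c))) =
      Real.exp (-2 * fderiv ℝ k (k₀ c) (Pi.single 1 1) 1 * Real.log (δ * δ / ‖toComplex c‖)) *
        Complex.normSq (cw (f (stablePoint δ c))) := by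
  have hC := toComplex_ne_zero hc0
  have hCp : 0 < ‖toComplex c‖ := norm_pos_iff.2 hC
  have hCc : starRingEnd ℂ (toComplex c) ≠ 0 := by simpa using hC
  have hδC : (δ : ℂ) ≠ 0 := by exact_mod_cast hδ.ne'
  -- The factor taking the first coordinate `c̄ / δ` of the stable point to `δ`; its logarithm `b +
  -- i arg s` gives the flow times `(arg s, b)`. The transported time for `q₂` is `κ b` alone, as
  -- `∂_b k_a = 0`.
  set s : ℂ := δ * δ / starRingEnd ℂ (toComplex c) with hs
  have hs0 : s ≠ 0 := div_ne_zero (mul_ne_zero hδC hδC) hCc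
  have hsn : ‖s‖ = δ * δ / ‖toComplex c‖ := by
    rw [hs, norm_div, norm_mul, RCLike.norm_conj]; simp [abs_of_pos hδ]
  have hsp : 0 < δ * δ / ‖toComplex c‖ := by positivity
  set b : ℝ := Real.log (δ * δ / ‖toComplex c‖) with hb
  have hexp : Complex.exp (b + s.arg * Complex.I) = s := by
    have : (b : ℂ) + s.arg * Complex.I = Complex.log s := by
      rw [Complex.log, hsn]
    rw [this, Complex.exp_log hs0]
  have hexp' : Complex.exp (-b + s.arg * Complex.I) = toComplex c / (δ * δ) := by
    have e1 : (-b : ℂ) + s.arg * Complex.I = -(starRingEnd ℂ (b + s.arg * Complex.I)) := by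
      simp
      ring
    rw [e1, Complex.exp_neg, Complex.exp_conj, hexp, hs]
    simp
  have hz : ‖starRingEnd ℂ (toComplex c) / δ‖ = ‖toComplex c‖ / δ := by
    rw [norm_div, RCLike.norm_conj]; simp [abs_of_pos hδ]
  have hw : ‖(δ : ℂ)‖ = δ := by simp [abs_of_pos hδ]
  have hz1 : ‖toComplex c‖ / δ ≤ δ := by rwa [div_le_iff₀ hδ]
  have hflow : jointFlow s.arg b (starRingEnd ℂ (toComplex c) / δ) δ 1 = unstablePoint δ c := by
    simp only [jointFlow, Complex.ofReal_one, one_mul, hexp, hexp', unstablePoint]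
    congr 1
    · rw [hs]; field_simp
    · field_simp
  have hq : q (ofComplex (starRingEnd ℂ (toComplex c) / δ) δ) = c := q_stablePoint hδ c
  have key := transport_jointFlow hgood (a := s.arg) (b := b)
    (z := starRingEnd ℂ (toComplex c) / δ) (w := δ) (by rw [hz]; linarith) (by rw [hw]; exact hε)
    (by
      rw [hz, hb, Real.exp_log hsp]
      have : δ * δ / ‖toComplex c‖ * (‖toComplex c‖ / δ) = δ := by field_simp
      rw [this]; exact hε)
    (by
      rw [hw, hb, Real.exp_neg, Real.exp_log hsp, inv_div]
      have : ‖toComplex c‖ / (δ * δ) * δ = ‖toComplex c‖ / δ := by field_simp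
      rw [this]; linarith) rfl rfl rfl
  rw [hflow, hq, h1] at key
  have hn : ∀ s z : ℂ, Complex.normSq (Complex.exp s * z) = Real.exp (2 * s.re) * Complex.normSq z := by
    intro s z
    rw [Complex.normSq_mul, Complex.normSq_eq_norm_sq, Complex.norm_exp, ← Real.exp_nat_mul]
    norm_num
  constructor
  · rw [key.1, hn]
    congr 2
    simp
    ring
  · rw [key.2, hn]
    congr 2
    simp
    ring

/-- At `c = 0` the images of the stable and unstable points are nonzero. If both had `z ≠ 0`, or
both `w ≠ 0`, the divergent passage time would contradict `not_exp_growth`. So `f` either preserves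
the two branches (`σ = 1`) or exchanges them (`σ = -1`). In each case `|k₀ c|² = |z|² |w|²` is an
exponential of the passage time multiplied by a smooth function that does not vanish at `0`. -/
theorem IsLocalLift.log_relation (h : IsLocalLift f k₀ k) {N : ℤ}
    (hN : ∀ᶠ c in 𝓝 (0 : R2), k c 0 = N * c 0) :
    ∃ (σ : ℤˣ) (S : R2 → ℝ), (∀ᶠ c in 𝓝 (0 : R2), ContDiffAt ℝ ∞ S c) ∧ ∀ᶠ c in 𝓝 (0 : R2), c ≠ 0 →
      Real.log (k₀ c 0 ^ 2 + k₀ c 1 ^ 2) = ((σ : ℤ) : ℝ) * fderiv ℝ k (k₀ c) (Pi.single 1 1) 1 *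
        Real.log (c 0 ^ 2 + c 1 ^ 2) + S c := by
  obtain ⟨ε, hε, hgood⟩ := h.exists_good
  obtain ⟨ε', hε', hsm⟩ := Metric.eventually_nhds_iff_ball.1 (h.smooth.and h.ne_zero)
  obtain ⟨δ, hδ, hδε, hδε'⟩ : ∃ δ > 0, δ < ε ∧ δ < ε' :=
    ⟨min ε ε' / 2, by positivity, by have := min_le_left ε ε'; have := lt_min hε hε'; linarith,
      by have := min_le_right ε ε'; have := lt_min hε hε'; linarith⟩
  have tk₀ := tendsto_zero_of_contDiffAt h.base_smooth h.base_zero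
  set κ : R2 → ℝ := fun c => fderiv ℝ k (k₀ c) (Pi.single 1 1) 1 with hκ
  have hκs : ∀ᶠ c in 𝓝 (0 : R2), ContDiffAt ℝ ∞ κ c := by
    filter_upwards [h.base_smooth, tk₀.eventually h.inv_smooth] with c h1 h2
    have h3 : ContDiffAt ℝ ∞ (fun c => fderiv ℝ k (k₀ c)) c :=
      (h2.fderiv_right (m := ∞) (by simp)).comp c h1
    exact contDiffAt_pi.1 (h3.clm_apply contDiffAt_const) 1
  set b : R2 → ℝ := fun c => Real.log (δ * δ / ‖toComplex c‖) with hb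
  have hsmall : ∀ᶠ c in 𝓝 (0 : R2), ‖toComplex c‖ < δ * δ := by
    have e : toComplex 0 = 0 := rfl
    have := continuous_toComplex.norm.tendsto (0 : R2)
    rw [e, norm_zero] at this
    exact this.eventually (gt_mem_nhds (by positivity))
  have hbt : Tendsto b (𝓝[≠] 0) atTop := by
    have e : toComplex 0 = 0 := rfl
    have h1 : Tendsto (fun c => ‖toComplex c‖) (𝓝[≠] 0) (𝓝[>] 0) := by
      refine tendsto_nhdsWithin_iff.2 ⟨?_, ?_⟩
      · have := continuous_toComplex.norm.tendsto (0 : R2)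
        rw [e, norm_zero] at this
        exact this.mono_left nhdsWithin_le_nhds
      · filter_upwards [self_mem_nhdsWithin] with c hc using norm_pos_iff.2 (toComplex_ne_zero hc)
    refine Real.tendsto_log_atTop.comp ?_
    exact (tendsto_inv_nhdsGT_zero.comp h1).const_mul_atTop (by positivity : 0 < δ * δ)
  -- derivative information at `k₀ c`
  have hfst : ∀ᶠ c in 𝓝 (0 : R2), c ≠ 0 → fderiv ℝ k (k₀ c) (Pi.single 1 1) 0 = 0 := by
    filter_upwards [h.fderiv_fst] with c hc h0 using (hc h0).1
  -- Otherwise the derivative of `k` at `0` would kill `(0, 1)`, contradicting invertibility.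
  have hκ0 : κ 0 ≠ 0 := by
    intro h0
    have hb0 := h.base_smooth.self_of_nhds.differentiableAt (by simp)
    have hk0 := h.inv_smooth.self_of_nhds.differentiableAt (by simp)
    have e1 : fderiv ℝ k 0 (Pi.single 1 1) = 0 := by
      ext i
      fin_cases i
      · have e2 : (fun c => k c 0) =ᶠ[𝓝 0] fun c => (N : ℝ) * c 0 := hN
        have h1 := hasFDerivAt_pi'.1 hk0.hasFDerivAt 0
        have h2 := ((ContinuousLinearMap.proj (R := ℝ) (φ := fun _ : Fin 2 => ℝ) 0).hasFDerivAt
          (x := 0)).const_mul (N : ℝ)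
        have h3 := h1.unique (h2.congr_of_eventuallyEq e2)
        simpa using congrArg (fun L => L (Pi.single 1 1 : R2)) h3
      · simpa [hκ, h.base_zero] using h0
    have e3 : (fun c => k₀ (k c)) =ᶠ[𝓝 0] id := h.right_inv
    rw [← h.inv_zero] at hb0
    have h4 := (hb0.hasFDerivAt.comp (0 : R2) hk0.hasFDerivAt).unique
      ((hasFDerivAt_id (0 : R2)).congr_of_eventuallyEq e3)
    have h5 := congrArg (fun L => L (Pi.single 1 1 : R2) 1) h4
    simp [e1] at h5
  have hκt : Tendsto κ (𝓝[≠] 0) (𝓝 (κ 0)) :=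
    hκs.self_of_nhds.continuousAt.tendsto.mono_left nhdsWithin_le_nhds
  have hpass : ∀ᶠ c in 𝓝 (0 : R2), c ≠ 0 →
      Complex.normSq (cz (f (unstablePoint δ c))) = Real.exp (2 * κ c * b c) *
        Complex.normSq (cz (f (stablePoint δ c))) ∧
      Complex.normSq (cw (f (unstablePoint δ c))) = Real.exp (-2 * κ c * b c) *
        Complex.normSq (cw (f (stablePoint δ c))) := by
    filter_upwards [hsmall, hfst] with c h1 h2 h3
    exact passage hgood hδ hδε h1.le h3 (h2 h3)
  have hprod : ∀ᶠ c in 𝓝 (0 : R2),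
      Complex.normSq (cz (f (stablePoint δ c))) * Complex.normSq (cw (f (stablePoint δ c))) =
        k₀ c 0 ^ 2 + k₀ c 1 ^ 2 ∧
      Complex.normSq (cz (f (unstablePoint δ c))) * Complex.normSq (cw (f (unstablePoint δ c))) =
        k₀ c 0 ^ 2 + k₀ c 1 ^ 2 := by
    filter_upwards [hsmall] with c h1
    obtain ⟨h2, h3⟩ := norm_stablePoint_lt hδ h1.le hδε
    rw [normSq_cz_mul_normSq_cw, normSq_cz_mul_normSq_cw, (hgood _ h2).2.2.2.2,
      (hgood _ h3).2.2.2.2, q_stablePoint hδ, q_unstablePoint hδ]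
    exact ⟨rfl, rfl⟩
  have hsmooth : ∀ {g : R4 → ℝ}, ContDiff ℝ ∞ g → ∀ᶠ c in 𝓝 (0 : R2),
      ContDiffAt ℝ ∞ (fun c => g (f (stablePoint δ c))) c ∧
      ContDiffAt ℝ ∞ (fun c => g (f (unstablePoint δ c))) c := by
    intro g hg
    filter_upwards [hsmall] with c h1
    obtain ⟨h2, h3⟩ := norm_stablePoint_lt hδ h1.le hδε'
    exact ⟨hg.contDiffAt.comp c ((hsm _ (by simpa using h2)).1.comp c (contDiff_stablePoint δ).contDiffAt),
      hg.contDiffAt.comp c ((hsm _ (by simpa using h3)).1.comp c (contDiff_unstablePoint δ).contDiffAt)⟩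
  have hsz := hsmooth contDiff_normSq_cz
  have hsw := hsmooth contDiff_normSq_cw
  set zs : R2 → ℝ := fun c => Complex.normSq (cz (f (stablePoint δ c)))
  set ws : R2 → ℝ := fun c => Complex.normSq (cw (f (stablePoint δ c)))
  set zu : R2 → ℝ := fun c => Complex.normSq (cz (f (unstablePoint δ c)))
  set wu : R2 → ℝ := fun c => Complex.normSq (cw (f (unstablePoint δ c)))
  have lim : ∀ {g : R2 → ℝ}, ContDiffAt ℝ ∞ g 0 → Tendsto g (𝓝[≠] 0) (𝓝 (g 0)) := fun hg =>
    hg.continuousAt.tendsto.mono_left nhdsWithin_le_nhds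
  have hne : ∀ x : R4, x ≠ 0 → ‖x‖ < ε' → f x ≠ 0 := fun x hx hx' => (hsm x (by simpa using hx')).2 hx
  have hδn : ‖(δ : ℂ)‖ = δ := by simp [abs_of_pos hδ]
  have hs0 : zs 0 = 0 → ws 0 ≠ 0 := by
    intro h1 h2
    refine hne (stablePoint δ 0) ?_ ?_ (eq_zero_of_normSq h1 h2)
    · intro h3
      have := congrFun h3 1
      simp [stablePoint_zero, ofComplex] at this
      exact hδ.ne' this
    · rw [stablePoint_zero]
      exact (norm_ofComplex_le _ _).trans_lt (max_lt (by simpa using hε') (by rwa [hδn]))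
  have hu0 : zu 0 = 0 → wu 0 ≠ 0 := by
    intro h1 h2
    refine hne (unstablePoint δ 0) ?_ ?_ (eq_zero_of_normSq h1 h2)
    · intro h3
      have := congrFun h3 0
      simp [unstablePoint_zero, ofComplex] at this
      exact hδ.ne' this
    · rw [unstablePoint_zero]
      exact (norm_ofComplex_le _ _).trans_lt (max_lt (by rwa [hδn]) (by simpa using hε'))
  have conclude : ∀ (σ : ℤˣ) (P : R2 → ℝ), (∀ᶠ c in 𝓝 (0 : R2), ContDiffAt ℝ ∞ P c) → P 0 ≠ 0 →
      (∀ᶠ c in 𝓝 (0 : R2), c ≠ 0 →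
        k₀ c 0 ^ 2 + k₀ c 1 ^ 2 = Real.exp (-(2 * ((σ : ℤ) : ℝ) * κ c * b c)) * P c) →
      ∃ (σ : ℤˣ) (S : R2 → ℝ), (∀ᶠ c in 𝓝 (0 : R2), ContDiffAt ℝ ∞ S c) ∧
        ∀ᶠ c in 𝓝 (0 : R2), c ≠ 0 → Real.log (k₀ c 0 ^ 2 + k₀ c 1 ^ 2) =
          ((σ : ℤ) : ℝ) * κ c * Real.log (c 0 ^ 2 + c 1 ^ 2) + S c := by
    intro σ P hP hP0 hrel
    have hPne := hP.self_of_nhds.continuousAt.eventually_ne hP0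
    refine ⟨σ, fun c => Real.log (P c) - ((σ : ℤ) : ℝ) * κ c * (2 * Real.log (δ * δ)), ?_, ?_⟩
    · filter_upwards [hP, hPne, hκs] with c h1 h2 h3
      exact (h1.log h2).sub ((contDiffAt_const.mul h3).mul contDiffAt_const)
    · filter_upwards [hrel, hPne] with c h1 h2 h3
      have hC := toComplex_ne_zero h3
      rw [h1 h3, Real.log_mul (Real.exp_ne_zero _) h2, Real.log_exp, ← normSq_toComplex,
        Complex.normSq_eq_norm_sq, Real.log_pow, hb]
      simp only
      rw [Real.log_div (by positivity) (norm_ne_zero_iff.2 hC)]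
      push_cast
      ring
  have hpass' := eventually_nhdsWithin_iff.2 hpass
  -- The cases are, in order: contradiction through `w`, branches preserved, branches exchanged,
  -- contradiction through `z`.
  by_cases h1 : zs 0 = 0 <;> by_cases h2 : zu 0 = 0
  · refine (not_exp_growth (lim hsw.self_of_nhds.2) (lim hsw.self_of_nhds.1) hκt hbt (hu0 h2) (hs0 h1)
      hκ0 (s := -2) (by norm_num) ?_).elim
    filter_upwards [hpass'] with c hc using hc.2
  · refine conclude 1 (fun c => zu c * ws c) ?_ (mul_ne_zero h2 (hs0 h1)) ?_
    · filter_upwards [hsz, hsw] with c a1 a2 using a1.2.mul a2.1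
    · filter_upwards [hprod, hpass] with c a1 a2 a3
      have e0 : zs c * ws c = _ := a1.1
      have e1 : zu c = Real.exp (2 * κ c * b c) * zs c := (a2 a3).1
      have e2 : -(2 * (((1 : ℤˣ) : ℤ) : ℝ) * κ c * b c) = -(2 * κ c * b c) := by push_cast; ring
      rw [← e0, e1, e2, Real.exp_neg]
      field_simp
  · refine conclude (-1) (fun c => zs c * wu c) ?_ (mul_ne_zero h1 (hu0 h2)) ?_
    · filter_upwards [hsz, hsw] with c a1 a2 using a1.1.mul a2.2
    · filter_upwards [hprod, hpass] with c a1 a2 a3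
      have e : -(2 * (((-1 : ℤˣ) : ℤ) : ℝ) * κ c * b c) = 2 * κ c * b c := by push_cast; ring
      have e2 : -2 * κ c * b c = -(2 * κ c * b c) := by ring
      have e0 : zs c * ws c = _ := a1.1
      have e1 : wu c = Real.exp (-2 * κ c * b c) * ws c := (a2 a3).2
      rw [← e0, e1, e, e2, Real.exp_neg]
      field_simp
  · refine (not_exp_growth (lim hsz.self_of_nhds.2) (lim hsz.self_of_nhds.1) hκt hbt h2 h1
      hκ0 (s := 2) (by norm_num) ?_).elim
    filter_upwards [hpass'] with c hc using hc.1

end LogRelationOfLift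

/-! ### Necessity and uniqueness for germs -/

section GermNecessity

variable {f : R4 → R4} {k₀ k : R2 → R2}

/-- Substitute `k c` for `c` in the logarithmic relation and set `u = σ k_b`. Both signs disappear
under squares, leaving the hypothesis of `isFlat_of_log_relation`; cut-offs supply its global
smoothness. -/
theorem IsLocalLift.isFlat_snd (h : IsLocalLift f k₀ k) {ε : ℤˣ}
    (hN : ∀ᶠ c in 𝓝 (0 : R2), k c 0 = ((ε : ℤ) : ℝ) * c 0) :
    ∃ σ : ℤˣ, IsFlat fun c => k c 1 - ((σ : ℤ) : ℝ) * c 1 := by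
  obtain ⟨σ, S, hS, hrel⟩ := h.log_relation hN
  have tk := tendsto_zero_of_contDiffAt h.inv_smooth h.inv_zero
  have sq : ∀ e : ℤˣ, ((e : ℤ) : ℝ) * ((e : ℤ) : ℝ) = 1 := fun e => by
    exact_mod_cast Int.units_coe_mul_self e
  have hk1 : ∀ᶠ c in 𝓝 (0 : R2), ContDiffAt ℝ ∞ (fun c => ((σ : ℤ) : ℝ) * k c 1) c := by
    filter_upwards [h.inv_smooth] with c hc
    exact contDiffAt_const.mul (contDiffAt_pi.1 hc 1)
  have hS1 : ∀ᶠ c in 𝓝 (0 : R2), ContDiffAt ℝ ∞ (fun c => -S (k c)) c := by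
    filter_upwards [h.inv_smooth, tk.eventually hS] with c h1 h2
    exact (h2.comp c h1).neg
  obtain ⟨u, hu, eu⟩ := exists_contDiff_eventuallyEq hk1
  obtain ⟨T, hT, eT⟩ := exists_contDiff_eventuallyEq hS1
  have hu0 : u 0 = 0 := by rw [eu.self_of_nhds]; simp [h.inv_zero]
  have main := isFlat_of_log_relation hu hT hu0 (by
    filter_upwards [eu.eventually_nhds, eT, tk.eventually hrel, h.inv_ne_zero, h.right_inv, hN,
      h.inv_smooth] with c h1 h2 h3 h4 h5 h6 h7 h8
    have hc : c ≠ 0 := fun hc => h8 (by rw [hc]; rfl)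
    have h9 := h3 (h4 hc)
    rw [h5, h6] at h9
    have e1 : u c = ((σ : ℤ) : ℝ) * k c 1 := h1.self_of_nhds
    have e2 : fderiv ℝ u c ![0, 1] = ((σ : ℤ) : ℝ) * fderiv ℝ k c (Pi.single 1 1) 1 := by
      have h1' : u =ᶠ[𝓝 c] fun c => ((σ : ℤ) : ℝ) * k c 1 := h1
      rw [h1'.fderiv_eq]
      have h10 := (hasFDerivAt_pi'.1 (h7.differentiableAt (by simp)).hasFDerivAt 1).const_mul
        (((σ : ℤ) : ℝ))
      rw [h10.fderiv]
      have : (![0, 1] : R2) = Pi.single 1 1 := by ext i; fin_cases i <;> simp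
      rw [this]
      simp
    have e3 : (((ε : ℤ) : ℝ) * c 0) ^ 2 = c 0 ^ 2 := by
      rw [mul_pow, pow_two, sq, one_mul]
    have e4 : u c ^ 2 = k c 1 ^ 2 := by
      rw [e1, mul_pow, pow_two, sq, one_mul]
    rw [e3] at h9
    rw [e2, e4, h2, h9]
    ring)
  refine ⟨σ, ?_, fun n => ?_⟩
  · filter_upwards [h.inv_smooth] with c hc
    exact (contDiffAt_pi.1 hc 1).sub (contDiffAt_const.mul (contDiff_apply ℝ ℝ 1).contDiffAt)
  · have e : (fun c : R2 => k c 1 - ((σ : ℤ) : ℝ) * c 1) =ᶠ[𝓝 0]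
        ((σ : ℤ) : ℝ) • fun c => u c - c 1 := by
      filter_upwards [eu] with c hc
      simp only [Pi.smul_apply, smul_eq_mul, hc, mul_sub, ← mul_assoc, sq, one_mul]
    rw [iteratedFDeriv_congr_nhds e]
    have hs : ContDiff ℝ ∞ fun c : R2 => u c - c 1 := hu.sub (contDiff_apply ℝ ℝ 1)
    rw [iteratedFDeriv_const_smul_apply (hs.contDiffAt.of_le (by exact_mod_cast le_top)), main n,
      smul_zero]

theorem isLocalLift_of_germs {φ : DiffeoGerm R4} {g : DiffeoGerm R2} (hs : IsSymplectic φ.val)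
    (hI : Intertwines φ.val g.val) {f : PointedMap R4} (hf : germ f = φ.val)
    {k₀ k : PointedMap R2} (hk₀ : germ k₀ = g.val) (hk : germ k = (g⁻¹).val) :
    IsLocalLift f.toFun k₀.toFun k.toFun := by
  obtain ⟨f', hf'⟩ := germ_surj (φ⁻¹).val
  have e1 : germ (f'.comp f) = 1 := by rw [← germ_mul, hf, hf']; simp
  have e2 : germ (k.comp k₀) = 1 := by rw [← germ_mul, hk, hk₀]; simp
  have e3 : germ (k₀.comp k) = 1 := by rw [← germ_mul, hk, hk₀]; simp
  rw [germ_one, germ_eq_iff] at e1 e2 e3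
  rw [← hf, isSymplectic_germ] at hs
  rw [← hf, ← hk₀, intertwines_germ] at hI
  refine ⟨f.map_zero, k₀.map_zero, k.map_zero, f.smooth, k₀.smooth, k.smooth, hs, hI, e2, e3, ?_⟩
  filter_upwards [e1] with x hx hx0 h0
  change f'.toFun (f.toFun x) = x at hx
  rw [h0, f'.map_zero] at hx
  exact hx0 hx.symm

theorem IsSymplectic.inv {φ : DiffeoGerm R4} (h : IsSymplectic φ.val) : IsSymplectic (φ⁻¹).val :=
  IsSymplectic.of_mul h (by rw [Units.mul_inv]; exact IsSymplectic.one)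

theorem hasFlatForm_of_intertwines {φ : DiffeoGerm R4} {g : DiffeoGerm R2}
    (hs : IsSymplectic φ.val) (hI : Intertwines φ.val g.val) : HasFlatForm g.val := by
  obtain ⟨f, hf⟩ := germ_surj φ.val
  obtain ⟨f', hf'⟩ := germ_surj (φ⁻¹).val
  obtain ⟨k₀, hk₀⟩ := germ_surj g.val
  obtain ⟨k, hk⟩ := germ_surj (g⁻¹).val
  have hl := isLocalLift_of_germs hs hI hf hk₀ hk
  have hl' := isLocalLift_of_germs hs.inv hI.inv hf' hk (by rw [inv_inv]; exact hk₀)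
  obtain ⟨n, hn⟩ := hl.inv_fst
  obtain ⟨m, hm⟩ := hl'.inv_fst
  -- `n` and `m` are the integer factors of the first components of `g⁻¹` and of `g`; being inverse
  -- to each other, they are signs.
  have hnm : n * m = 1 := by
    have h1 : ∀ᶠ c in 𝓝 (0 : R2), c 0 = (n * m : ℝ) * c 0 := by
      filter_upwards [hl.left_inv, k₀.tendsto.eventually hn, hm] with c h1 h2 h3
      rw [h1, h3] at h2
      linear_combination h2
    have ht : Tendsto (fun t : ℝ => t • (![1, 0] : R2)) (𝓝[≠] 0) (𝓝 0) := by
      have : Continuous fun t : ℝ => t • (![1, 0] : R2) := by fun_prop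
      have := (this.tendsto 0).mono_left (nhdsWithin_le_nhds (s := {0}ᶜ))
      simpa using this
    obtain ⟨t, h2, h3⟩ := ((ht.eventually h1).and self_mem_nhdsWithin).exists
    have h3 : t ≠ 0 := h3
    simp at h2
    have h4 : (1 : ℝ) * t = (n * m : ℝ) * t := by linarith
    exact_mod_cast (mul_right_cancel₀ h3 h4).symm
  have hu : IsUnit n := IsUnit.of_mul_eq_one m hnm
  obtain ⟨ε, rfl⟩ := hu
  obtain ⟨σ, hσ⟩ := hl.isFlat_snd hn
  have : HasFlatForm (g⁻¹).val := by
    refine ⟨k, hk, (ε, σ), _, hσ, ?_⟩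
    filter_upwards [hn] with c hc
    ext i
    fin_cases i
    · exact hc
    · simp
  simpa using HasFlatForm.inv this

/-- A right inverse of `q`, continuous at the origin. -/
noncomputable def qSection (c : R2) : R4 :=
  ofComplex (Real.sqrt ‖toComplex c‖) (toComplex c / Real.sqrt ‖toComplex c‖)

theorem q_qSection (c : R2) : q (qSection c) = c := by
  by_cases hc : c = 0
  · have : toComplex c = 0 := by rw [hc]; rfl
    exact q_ofComplex_eq (by simp [this])
  · have h1 : (Real.sqrt ‖toComplex c‖ : ℂ) ≠ 0 := by
      exact_mod_cast (Real.sqrt_pos.2 (norm_pos_iff.2 (toComplex_ne_zero hc))).ne'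
    refine q_ofComplex_eq ?_
    rw [Complex.conj_ofReal]
    field_simp

theorem tendsto_qSection : Tendsto qSection (𝓝 0) (𝓝 0) := by
  have ht : Tendsto (fun c => Real.sqrt ‖toComplex c‖) (𝓝 0) (𝓝 0) := by
    have := (Real.continuous_sqrt.comp continuous_toComplex.norm).tendsto (0 : R2)
    have e : toComplex 0 = 0 := rfl
    simpa [Function.comp_def, e] using this
  refine squeeze_zero_norm (fun c => ?_) ht
  refine (norm_ofComplex_le _ _).trans (max_le ?_ ?_)
  · rw [Complex.norm_real, Real.norm_of_nonneg (Real.sqrt_nonneg _)]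
  · rw [norm_div, Complex.norm_real, Real.norm_of_nonneg (Real.sqrt_nonneg _)]
    exact Real.div_sqrt.le

/-- Evaluate both relations on `qSection c`: continuity of the section at the origin suffices to
compare germs. -/
theorem intertwines_unique {φ : SmoothGerm R4} {g g' : SmoothGerm R2} (h : Intertwines φ g)
    (h' : Intertwines φ g') : g = g' := by
  obtain ⟨f, rfl⟩ := germ_surj φ
  obtain ⟨k, rfl⟩ := germ_surj g
  obtain ⟨k', rfl⟩ := germ_surj g'
  rw [intertwines_germ] at h h'
  rw [germ_eq_iff]
  filter_upwards [tendsto_qSection.eventually h, tendsto_qSection.eventually h'] with c h1 h2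
  rw [q_qSection] at h1 h2
  rw [← h1, h2]

end GermNecessity

/-! ### Flat functions of `q` absorb singularities along `z = 0` -/

section FlatMultipliers

/-- Smooth functions on `ℝ²` that vanish to infinite order at the origin. -/
def IsFlatFun (k : R2 → ℝ) : Prop :=
  ContDiff ℝ ∞ k ∧ ∀ n : ℕ, k =O[𝓝 0] fun c => ‖c‖ ^ n

theorem IsFlatFun.apply_zero {k : R2 → ℝ} (hk : IsFlatFun k) : k 0 = 0 :=
  Asymptotics.IsBigO.eq_zero_of_norm_pow (n := 1) (by simpa using hk.2 1) one_ne_zero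

theorem IsFlatFun.fderiv_apply {k : R2 → ℝ} (hk : IsFlatFun k) (v : R2) :
    IsFlatFun fun c => fderiv ℝ k c v := by
  refine ⟨(hk.1.fderiv_right (m := ∞) (by simp)).clm_apply contDiff_const, fun n => ?_⟩
  refine Asymptotics.IsBigO.trans ?_ (isBigO_pow_fderiv hk.1 hk.2 n)
  refine Asymptotics.IsBigO.of_bound ‖v‖ (Eventually.of_forall fun c => ?_)
  rw [mul_comm]
  exact (fderiv ℝ k c).le_opNorm v

theorem IsFlatFun.fderiv_zero {k : R2 → ℝ} (hk : IsFlatFun k) : fderiv ℝ k 0 = 0 := by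
  ext v
  exact (hk.fderiv_apply v).apply_zero

theorem isFlatFun_of_isFlat {h k : R2 → ℝ} (hh : IsFlat h) (hk : ContDiff ℝ ∞ k) (e : k =ᶠ[𝓝 0] h) :
    IsFlatFun k :=
  ⟨hk, fun n => isBigO_pow_of_iteratedFDeriv_eq_zero n
    (Eventually.of_forall fun _ => hk.contDiffAt)
    (fun n => by rw [iteratedFDeriv_congr_nhds e, hh.2 n])⟩

/-- The squared modulus `x₁² + x₂²`. -/
def rsq (x : R4) : ℝ := x 0 ^ 2 + x 2 ^ 2

theorem contDiff_rsq : ContDiff ℝ ∞ rsq := by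
  unfold rsq; fun_prop

theorem rsq_nonneg (x : R4) : 0 ≤ rsq x := by unfold rsq; positivity

theorem q_eq_zero_of_rsq {x : R4} (hx : rsq x = 0) : q x = 0 := by
  have h0 : x 0 = 0 := by
    unfold rsq at hx; nlinarith [sq_nonneg (x 0), sq_nonneg (x 2)]
  have h2 : x 2 = 0 := by
    unfold rsq at hx; nlinarith [sq_nonneg (x 0), sq_nonneg (x 2)]
  ext i; fin_cases i <;> simp [q, h0, h2]

/-- The product of a flat function of `q` with a function of moderate growth along `z = 0` has
vanishing derivative there. -/
theorem hasFDerivAt_flat_mul_of_rsq_eq_zero {k : R2 → ℝ} (hk : IsFlatFun k) {l : R4 → ℝ} {x : R4}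
    (hx : rsq x = 0) {m : ℕ} (hl : ∀ᶠ y in 𝓝 x, rsq y ≠ 0 → |l y| ≤ (rsq y)⁻¹ ^ m) :
    HasFDerivAt (fun y => k (q y) * l y) (0 : R4 →L[ℝ] ℝ) x := by
  refine Asymptotics.IsBigO.hasFDerivAt (n := 2) ?_ (by norm_num)
  -- Since `|q|² = rsq · |w|²`, order `2 * (m + 1)` yields `rsq ^ (m + 1)`. After the loss of `rsq ^
  -- m` one factor `rsq` remains, which is quadratic in the distance to `x`.
  obtain ⟨C, hC, hb⟩ := (hk.2 (2 * (m + 1))).exists_pos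
  have hq : Tendsto q (𝓝 x) (𝓝 0) := by
    have := contDiff_q.continuous.tendsto x
    rwa [q_eq_zero_of_rsq hx] at this
  set B : ℝ := Complex.normSq (cw x) + 1
  have hw : ∀ᶠ y in 𝓝 x, Complex.normSq (cw y) < B :=
    (contDiff_normSq_cw.continuous.tendsto x).eventually (gt_mem_nhds (by simp [B]))
  have hBp : 0 < B := by have := Complex.normSq_nonneg (cw x); simp only [B]; linarith
  refine Asymptotics.IsBigO.of_bound (C * B ^ (m + 1) * 2) ?_
  filter_upwards [hq.eventually hb.bound, hw, hl] with y h1 h2 h3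
  by_cases hy : rsq y = 0
  · rw [q_eq_zero_of_rsq hy, hk.apply_zero, zero_mul, norm_zero]
    positivity
  have hyp : 0 < rsq y := lt_of_le_of_ne (rsq_nonneg y) (Ne.symm hy)
  have e0 : x 0 = 0 := by
    unfold rsq at hx; nlinarith [sq_nonneg (x 0), sq_nonneg (x 2)]
  have e2 : x 2 = 0 := by
    unfold rsq at hx; nlinarith [sq_nonneg (x 0), sq_nonneg (x 2)]
  have h4 : rsq y ≤ 2 * ‖y - x‖ ^ 2 := by
    have a0 := norm_le_pi_norm (y - x) 0
    have a2 := norm_le_pi_norm (y - x) 2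
    rw [Pi.sub_apply, Real.norm_eq_abs, e0, sub_zero] at a0
    rw [Pi.sub_apply, Real.norm_eq_abs, e2, sub_zero] at a2
    have b0 := pow_le_pow_left₀ (abs_nonneg _) a0 2
    have b2 := pow_le_pow_left₀ (abs_nonneg _) a2 2
    rw [sq_abs] at b0 b2
    unfold rsq; linarith
  have h5 : ‖q y‖ ^ 2 ≤ rsq y * B := by
    have e : rsq y = Complex.normSq (cz y) := by simp [rsq, cz, Complex.normSq_apply, pow_two]
    have h6 : q y 0 ^ 2 + q y 1 ^ 2 ≤ rsq y * B := by
      rw [← normSq_cz_mul_normSq_cw, e]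
      gcongr
      exact Complex.normSq_nonneg _
    refine le_trans ?_ h6
    have h7 : ‖q y‖ ≤ Real.sqrt (q y 0 ^ 2 + q y 1 ^ 2) := by
      refine (pi_norm_le_iff_of_nonneg (Real.sqrt_nonneg _)).2 fun i => ?_
      rw [Real.norm_eq_abs]
      refine Real.abs_le_sqrt ?_
      fin_cases i
      · change q y 0 ^ 2 ≤ _; nlinarith [sq_nonneg (q y 1)]
      · change q y 1 ^ 2 ≤ _; nlinarith [sq_nonneg (q y 0)]
    have := pow_le_pow_left₀ (norm_nonneg _) h7 2
    rwa [Real.sq_sqrt (by positivity)] at this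
  rw [norm_pow, norm_norm] at h1
  rw [norm_mul, norm_pow, norm_norm, Real.norm_eq_abs (l y)]
  calc ‖k (q y)‖ * |l y| ≤ (C * ‖q y‖ ^ (2 * (m + 1))) * (rsq y)⁻¹ ^ m := by
        gcongr
        exact h3 hy
    _ ≤ (C * (rsq y * B) ^ (m + 1)) * (rsq y)⁻¹ ^ m := by
        rw [pow_mul]; gcongr
    _ = C * B ^ (m + 1) * rsq y := by
        rw [mul_pow, pow_succ (rsq y), inv_pow]
        field_simp
    _ ≤ C * B ^ (m + 1) * (2 * ‖y - x‖ ^ 2) := by gcongr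
    _ = _ := by ring

/-- The product rule stays valid on `z = 0`, whatever values `l` and `l'` take there: `q` vanishes
at such points, and so do `k` and its derivative at the origin. -/
theorem hasFDerivAt_flat_mul {k : R2 → ℝ} (hk : IsFlatFun k) {l : R4 → ℝ} {l' : R4 → R4 →L[ℝ] ℝ}
    {m : ℕ} (hl : ∀ x, rsq x = 0 → ∀ᶠ y in 𝓝 x, rsq y ≠ 0 → |l y| ≤ (rsq y)⁻¹ ^ m)
    (hl' : ∀ x, rsq x ≠ 0 → HasFDerivAt l (l' x) x) (x : R4) :
    HasFDerivAt (fun y => k (q y) * l y)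
      (k (q x) • l' x + l x • (fderiv ℝ k (q x)).comp (fderiv ℝ q x)) x := by
  by_cases hx : rsq x = 0
  · rw [q_eq_zero_of_rsq hx, hk.apply_zero, hk.fderiv_zero]
    simpa using hasFDerivAt_flat_mul_of_rsq_eq_zero hk hx (hl x hx)
  · exact ((hk.1.differentiable (by simp) _).hasFDerivAt.comp x
      (contDiff_q.differentiable (by simp) x).hasFDerivAt).mul (hl' x hx)

theorem fderiv_comp_q (k : R2 → ℝ) (x : R4) : (fderiv ℝ k (q x)).comp (fderiv ℝ q x) =
    ∑ j, fderiv ℝ k (q x) (Pi.single j 1) •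
      (ContinuousLinearMap.proj (R := ℝ) (φ := fun _ : Fin 2 => ℝ) j).comp (fderiv ℝ q x) := by
  ext v
  set c : R2 := fderiv ℝ q x v with hc
  have e : c = ∑ i, c i • (Pi.single i 1 : R2) := by
    ext i; fin_cases i <;> simp [Fin.sum_univ_two]
  rw [ContinuousLinearMap.comp_apply, ← hc]
  conv_lhs => rw [e, map_sum]
  simp [Fin.sum_univ_two, mul_comm, hc]

theorem contDiff_proj_fderiv_q (j : Fin 2) : ContDiff ℝ ∞ fun x =>
    (ContinuousLinearMap.proj (R := ℝ) (φ := fun _ : Fin 2 => ℝ) j).comp (fderiv ℝ q x) :=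
  contDiff_const.clm_comp (contDiff_q.fderiv_right (m := ∞) (by simp))

theorem hasFDerivAt_rsq (x : R4) : HasFDerivAt rsq (fderiv ℝ rsq x) x :=
  (contDiff_rsq.differentiable (by simp) x).hasFDerivAt

/-- The derivative is a combination of terms of the same shape, with another flat function or
exponent `m + 1`, and smooth coefficients. Quantifying over all flat `k` and all `m` closes the
induction. -/
theorem contDiff_flat_mul_inv_pow (n : ℕ) : ∀ {k : R2 → ℝ}, IsFlatFun k → ∀ m : ℕ,
    ContDiff ℝ n fun x => k (q x) * (rsq x)⁻¹ ^ m := by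
  have hd : ∀ {k : R2 → ℝ}, IsFlatFun k → ∀ (m : ℕ) (x : R4),
      HasFDerivAt (fun x => k (q x) * (rsq x)⁻¹ ^ m)
        (k (q x) • ((-(m : ℝ) * (rsq x)⁻¹ ^ (m + 1)) • fderiv ℝ rsq x) +
          (rsq x)⁻¹ ^ m • (fderiv ℝ k (q x)).comp (fderiv ℝ q x)) x := by
    intro k hk m x
    refine hasFDerivAt_flat_mul hk (l := fun x => (rsq x)⁻¹ ^ m) (m := m)
      (l' := fun x => (-(m : ℝ) * (rsq x)⁻¹ ^ (m + 1)) • fderiv ℝ rsq x) ?_ ?_ x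
    · intro x _
      refine Eventually.of_forall fun y _ => ?_
      rw [abs_of_nonneg (pow_nonneg (inv_nonneg.2 (rsq_nonneg y)) m)]
    · intro x hx
      have h1 := ((hasDerivAt_inv hx).pow m).comp_hasFDerivAt x (hasFDerivAt_rsq x)
      refine h1.congr_fderiv ?_
      congr 1
      rcases m with _ | m
      · simp
      · simp only [Nat.add_sub_cancel]
        rw [← inv_pow, pow_succ _ (m + 1), pow_succ _ m]
        push_cast
        ring
  induction n with
  | zero =>
    intro k hk m
    exact contDiff_zero.2 (continuous_iff_continuousAt.2 fun x => (hd hk m x).continuousAt)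
  | succ n ih =>
    intro k hk m
    rw [Nat.cast_succ, contDiff_succ_iff_hasFDerivAt]
    refine ⟨_, ?_, hd hk m⟩
    have e : (fun x => k (q x) • ((-(m : ℝ) * (rsq x)⁻¹ ^ (m + 1)) • fderiv ℝ rsq x) +
          (rsq x)⁻¹ ^ m • (fderiv ℝ k (q x)).comp (fderiv ℝ q x)) = fun x =>
        (k (q x) * (rsq x)⁻¹ ^ (m + 1)) • (-(m : ℝ) • fderiv ℝ rsq x) +
          ∑ j, (fderiv ℝ k (q x) (Pi.single j 1) * (rsq x)⁻¹ ^ m) •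
            (ContinuousLinearMap.proj (R := ℝ) (φ := fun _ : Fin 2 => ℝ) j).comp (fderiv ℝ q x) := by
      ext x v
      rw [fderiv_comp_q]
      simp [Fin.sum_univ_two]
      ring
    rw [e]
    refine ContDiff.add ((ih hk (m + 1)).smul ?_) (ContDiff.sum fun j _ =>
      (ih (hk.fderiv_apply _) m).smul ?_)
    · exact ((contDiff_rsq.fderiv_right (m := ∞) (by simp)).const_smul _).of_le (by exact_mod_cast le_top)
    · exact (contDiff_proj_fderiv_q j).of_le (by exact_mod_cast le_top)

theorem hasFDerivAt_flat_mul_log {k : R2 → ℝ} (hk : IsFlatFun k) (x : R4) :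
    HasFDerivAt (fun x => k (q x) * Real.log (rsq x))
      (k (q x) • ((rsq x)⁻¹ • fderiv ℝ rsq x) +
        Real.log (rsq x) • (fderiv ℝ k (q x)).comp (fderiv ℝ q x)) x := by
  refine hasFDerivAt_flat_mul hk (l := fun x => Real.log (rsq x)) (m := 1)
    (l' := fun x => (rsq x)⁻¹ • fderiv ℝ rsq x) ?_ ?_ x
  · intro x hx
    have : ∀ᶠ y in 𝓝 x, rsq y < 1 :=
      (contDiff_rsq.continuous.tendsto x).eventually (gt_mem_nhds (by rw [hx]; norm_num))
    filter_upwards [this] with y h1 h2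
    have hp : 0 < rsq y := lt_of_le_of_ne (rsq_nonneg y) (Ne.symm h2)
    have h3 := Real.abs_log_mul_self_lt (rsq y) hp h1.le
    rw [abs_mul, abs_of_pos hp] at h3
    rw [pow_one, ← one_div, le_div_iff₀ hp]
    exact h3.le
  · intro x hx
    exact (hasFDerivAt_rsq x).log hx

theorem contDiff_flat_mul_log {k : R2 → ℝ} (hk : IsFlatFun k) :
    ContDiff ℝ ∞ fun x => k (q x) * Real.log (rsq x) := by
  rw [contDiff_infty]
  intro n
  induction n generalizing k with
  | zero =>
    exact contDiff_zero.2 (continuous_iff_continuousAt.2 fun x =>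
      (hasFDerivAt_flat_mul_log hk x).continuousAt)
  | succ n ih =>
    rw [Nat.cast_succ, contDiff_succ_iff_hasFDerivAt]
    refine ⟨_, ?_, hasFDerivAt_flat_mul_log hk⟩
    have e : (fun x => k (q x) • ((rsq x)⁻¹ • fderiv ℝ rsq x) +
        Real.log (rsq x) • (fderiv ℝ k (q x)).comp (fderiv ℝ q x)) = fun x =>
        (k (q x) * (rsq x)⁻¹ ^ 1) • fderiv ℝ rsq x +
          ∑ j, (fderiv ℝ k (q x) (Pi.single j 1) * Real.log (rsq x)) •
            (ContinuousLinearMap.proj (R := ℝ) (φ := fun _ : Fin 2 => ℝ) j).comp (fderiv ℝ q x) := by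
      ext x v
      rw [fderiv_comp_q]
      simp [Fin.sum_univ_two]
      ring
    rw [e]
    refine ContDiff.add ((contDiff_flat_mul_inv_pow n hk 1).smul ?_) (ContDiff.sum fun j _ =>
      (ih (hk.fderiv_apply _)).smul ?_)
    · exact (contDiff_rsq.fderiv_right (m := ∞) (by simp)).of_le (by exact_mod_cast le_top)
    · exact (contDiff_proj_fderiv_q j).of_le (by exact_mod_cast le_top)

end FlatMultipliers

/-! ### The explicit lift of `(a, b) ↦ (a, b + h)` -/

section ModelLift

theorem omegaCan_ofComplex (a b a' b' : ℂ) : omegaCan (ofComplex a b) (ofComplex a' b') =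
    (starRingEnd ℂ a * b').re - (starRingEnd ℂ a' * b).re := by
  simp [omegaCan, ofComplex]; ring

/-- The common factors `e₁`, `e₂` cancel because the form sees only `z̄ w`. What remains beyond the
original form is grouped by the differentials of `H`, of the radial exponent (`au`, `av`) and of the
phase (`bu`, `bv`). -/
theorem omegaCan_twisted (z w zu zv wu wv e₁ e₂ : ℂ) (H Hu Hv au av bu bv : ℝ)
    (he : starRingEnd ℂ e₁ * e₂ = 1) :
    omegaCan
      (ofComplex (e₁ * (zu + z * (au + bu * Complex.I)))
        (e₂ * (wu + H * zu + Hu * z + (w + H * z) * (-au + bu * Complex.I))))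
      (ofComplex (e₁ * (zv + z * (av + bv * Complex.I)))
        (e₂ * (wv + H * zv + Hv * z + (w + H * z) * (-av + bv * Complex.I)))) =
    omegaCan (ofComplex zu wu) (ofComplex zv wv) +
      ((starRingEnd ℂ z * zu).re * Hv - (starRingEnd ℂ z * zv).re * Hu) +
      (au * ((starRingEnd ℂ zv * w + starRingEnd ℂ z * wv).re + 2 * (starRingEnd ℂ z * zv).re * H
          + Complex.normSq z * Hv) -
        av * ((starRingEnd ℂ zu * w + starRingEnd ℂ z * wu).re + 2 * (starRingEnd ℂ z * zu).re * H
          + Complex.normSq z * Hu)) +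
      (bu * (starRingEnd ℂ zv * w + starRingEnd ℂ z * wv).im -
        bv * (starRingEnd ℂ zu * w + starRingEnd ℂ z * wu).im) := by
  have key : ∀ A B : ℂ, starRingEnd ℂ (e₁ * A) * (e₂ * B) = starRingEnd ℂ A * B := by
    intro A B
    rw [map_mul]
    linear_combination (starRingEnd ℂ A * B) * he
  rw [omegaCan_ofComplex, omegaCan_ofComplex, key, key]
  simp [Complex.normSq_apply]
  ring

/-- Functions `h`, `m₁`, `m₂` with `1 + m₁ = 1 / (1 + h_b)` and `m₂ = h_a / (1 + h_b)` near the
origin, all of them flat. -/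
structure IsLiftData (h m₁ m₂ : R2 → ℝ) : Prop where
  flat : IsFlatFun h
  flat₁ : IsFlatFun m₁
  flat₂ : IsFlatFun m₂
  rel₁ : ∀ᶠ c in 𝓝 (0 : R2), (1 + fderiv ℝ h c (Pi.single 1 1)) * (1 + m₁ c) = 1
  rel₂ : ∀ᶠ c in 𝓝 (0 : R2),
    (1 + fderiv ℝ h c (Pi.single 1 1)) * m₂ c = fderiv ℝ h c (Pi.single 0 1)

theorem exists_isFlatFun_mul {k g : R2 → ℝ} (hk : IsFlatFun k)
    (hg : ∀ᶠ c in 𝓝 (0 : R2), ContDiffAt ℝ ∞ g c) :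
    ∃ m : R2 → ℝ, IsFlatFun m ∧ m =ᶠ[𝓝 0] fun c => k c * g c := by
  obtain ⟨m, hm, e⟩ := exists_contDiff_eventuallyEq (f := fun c => k c * g c) (by
    filter_upwards [hg] with c hc using hk.1.contDiffAt.mul hc)
  refine ⟨m, ⟨hm, fun n => ?_⟩, e⟩
  refine Asymptotics.IsBigO.congr' ?_ e.symm EventuallyEq.rfl
  simpa using (hk.2 n).mul (hg.self_of_nhds.continuousAt.isBigO_one ℝ)

theorem exists_isLiftData {h₀ : R2 → ℝ} (hh : IsFlat h₀) :
    ∃ h m₁ m₂ : R2 → ℝ, h =ᶠ[𝓝 0] h₀ ∧ IsLiftData h m₁ m₂ := by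
  obtain ⟨h, hs, e⟩ := exists_contDiff_eventuallyEq hh.1
  have hf : IsFlatFun h := isFlatFun_of_isFlat hh hs e
  have hb := hf.fderiv_apply (Pi.single 1 1)
  have ha := hf.fderiv_apply (Pi.single 0 1)
  have hne : ∀ᶠ c in 𝓝 (0 : R2), 1 + fderiv ℝ h c (Pi.single 1 1) ≠ 0 := by
    have : Continuous fun c => 1 + fderiv ℝ h c (Pi.single 1 1) := continuous_const.add hb.1.continuous
    refine this.continuousAt.eventually_ne ?_
    rw [hb.apply_zero]; norm_num
  have hsm : ∀ᶠ c in 𝓝 (0 : R2),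
      ContDiffAt ℝ ∞ (fun c => (1 + fderiv ℝ h c (Pi.single 1 1))⁻¹) c := by
    filter_upwards [hne] with c hc
    exact (contDiffAt_const.add hb.1.contDiffAt).inv hc
  -- `m₁ = 1 / (1 + h_b) - 1 = h_b · (-1 / (1 + h_b))` is flat as a multiple of `h_b`.
  obtain ⟨m₁, hm₁, e₁⟩ := exists_isFlatFun_mul hb (hsm.mono fun c hc => hc.neg)
  obtain ⟨m₂, hm₂, e₂⟩ := exists_isFlatFun_mul ha hsm
  refine ⟨h, m₁, m₂, e, hf, hm₁, hm₂, ?_, ?_⟩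
  · filter_upwards [e₁, hne] with c h1 h2
    rw [h1]; field_simp; ring
  · filter_upwards [e₂, hne] with c h1 h2
    rw [h1]; field_simp

/-- The lift to `ℝ⁴` of the map `(a, b) ↦ (a, b + h(a, b))`. -/
noncomputable def modelLift (h m₁ m₂ : R2 → ℝ) (x : R4) : R4 :=
  ofComplex
    (Complex.exp (((1 / 2 * (m₁ (q x) * Real.log (rsq x)) : ℝ) : ℂ) +
      ((-(1 / 2) * (m₂ (q x) * Real.log (rsq x)) : ℝ) : ℂ) * Complex.I) * cz x)
    (Complex.exp (-((1 / 2 * (m₁ (q x) * Real.log (rsq x)) : ℝ) : ℂ) +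
      ((-(1 / 2) * (m₂ (q x) * Real.log (rsq x)) : ℝ) : ℂ) * Complex.I) *
      (cw x + ((h (q x) * (rsq x)⁻¹ ^ 1 : ℝ) : ℂ) * cz x))

/-- `x₁ + i x₂` as a linear map. -/
noncomputable def czL : R4 →L[ℝ] ℂ :=
  Complex.ofRealCLM.comp (ContinuousLinearMap.proj (R := ℝ) (φ := fun _ : Fin 4 => ℝ) 0) +
    Complex.I • Complex.ofRealCLM.comp (ContinuousLinearMap.proj (R := ℝ) (φ := fun _ : Fin 4 => ℝ) 2)

/-- `y₁ + i y₂` as a linear map. -/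
noncomputable def cwL : R4 →L[ℝ] ℂ :=
  Complex.ofRealCLM.comp (ContinuousLinearMap.proj (R := ℝ) (φ := fun _ : Fin 4 => ℝ) 1) +
    Complex.I • Complex.ofRealCLM.comp (ContinuousLinearMap.proj (R := ℝ) (φ := fun _ : Fin 4 => ℝ) 3)

theorem czL_apply (x : R4) : czL x = cz x := by
  apply Complex.ext <;> simp [czL, cz]

theorem cwL_apply (x : R4) : cwL x = cw x := by
  apply Complex.ext <;> simp [cwL, cw]

theorem contDiff_cz : ContDiff ℝ ∞ cz := by
  rw [← funext czL_apply]; exact czL.contDiff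

theorem contDiff_cw : ContDiff ℝ ∞ cw := by
  rw [← funext cwL_apply]; exact cwL.contDiff

theorem hasFDerivAt_cz (x : R4) : HasFDerivAt cz czL x := by
  rw [← funext czL_apply]; exact czL.hasFDerivAt

theorem hasFDerivAt_cw (x : R4) : HasFDerivAt cw cwL x := by
  rw [← funext cwL_apply]; exact cwL.hasFDerivAt

theorem contDiff_ofComplex {f g : R4 → ℂ} (hf : ContDiff ℝ ∞ f) (hg : ContDiff ℝ ∞ g) :
    ContDiff ℝ ∞ fun x => ofComplex (f x) (g x) := by
  rw [contDiff_pi]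
  intro i
  fin_cases i
  · exact Complex.reCLM.contDiff.comp hf
  · exact Complex.reCLM.contDiff.comp hg
  · exact Complex.imCLM.contDiff.comp hf
  · exact Complex.imCLM.contDiff.comp hg

theorem fderiv_ofComplex {f g : R4 → ℂ} {f' g' : R4 →L[ℝ] ℂ} {x : R4} (hf : HasFDerivAt f f' x)
    (hg : HasFDerivAt g g' x) (u : R4) :
    fderiv ℝ (fun x => ofComplex (f x) (g x)) x u = ofComplex (f' u) (g' u) := by
  have h : HasFDerivAt (fun x => ofComplex (f x) (g x)) (ContinuousLinearMap.pi
      ![Complex.reCLM.comp f', Complex.reCLM.comp g', Complex.imCLM.comp f', Complex.imCLM.comp g']) x := by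
    rw [hasFDerivAt_pi]
    intro i
    fin_cases i
    · exact Complex.reCLM.hasFDerivAt.comp x hf
    · exact Complex.reCLM.hasFDerivAt.comp x hg
    · exact Complex.imCLM.hasFDerivAt.comp x hf
    · exact Complex.imCLM.hasFDerivAt.comp x hg
  rw [h.fderiv]
  ext i
  fin_cases i <;> rfl

variable {h m₁ m₂ : R2 → ℝ}

theorem IsLiftData.contDiff_modelLift (H : IsLiftData h m₁ m₂) : ContDiff ℝ ∞ (modelLift h m₁ m₂) := by
  have ha : ContDiff ℝ ∞ fun x => ((1 / 2 * (m₁ (q x) * Real.log (rsq x)) : ℝ) : ℂ) :=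
    Complex.ofRealCLM.contDiff.comp (contDiff_const.mul (contDiff_flat_mul_log H.flat₁))
  have hb : ContDiff ℝ ∞ fun x => ((-(1 / 2) * (m₂ (q x) * Real.log (rsq x)) : ℝ) : ℂ) :=
    Complex.ofRealCLM.contDiff.comp (contDiff_const.mul (contDiff_flat_mul_log H.flat₂))
  have hH : ContDiff ℝ ∞ fun x => ((h (q x) * (rsq x)⁻¹ ^ 1 : ℝ) : ℂ) :=
    Complex.ofRealCLM.contDiff.comp (contDiff_infty.2 fun n => contDiff_flat_mul_inv_pow n H.flat 1)
  refine contDiff_ofComplex ?_ ?_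
  · exact (ha.add (hb.mul contDiff_const)).cexp.mul contDiff_cz
  · exact (ha.neg.add (hb.mul contDiff_const)).cexp.mul (contDiff_cw.add (hH.mul contDiff_cz))

theorem modelLift_zero : modelLift h m₁ m₂ 0 = 0 := by
  have e1 : cz 0 = 0 := rfl
  have e2 : cw 0 = 0 := rfl
  simp only [modelLift, e1, e2, mul_zero, add_zero]
  ext i; fin_cases i <;> rfl

theorem normSq_cz (x : R4) : Complex.normSq (cz x) = rsq x := by
  simp [Complex.normSq_apply, cz, rsq, pow_two]

theorem conj_exp_mul_exp (a b : ℝ) : starRingEnd ℂ (Complex.exp (a + b * Complex.I)) *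
    Complex.exp (-a + b * Complex.I) = 1 := by
  rw [← Complex.exp_conj, ← Complex.exp_add, ← Complex.exp_zero]
  congr 1
  simp
  ring

/-- The exponential factors cancel in `z̄ w`, and `z̄ · H z = H |z|² = h`. On `z = 0` this persists
because `q = 0` and `h 0 = 0`. -/
theorem q_modelLift (hh : h 0 = 0) (x : R4) :
    q (modelLift h m₁ m₂ x) = ![q x 0, q x 1 + h (q x)] := by
  have key : (h (q x) * (rsq x)⁻¹ ^ 1) * rsq x = h (q x) := by
    by_cases hx : rsq x = 0
    · rw [q_eq_zero_of_rsq hx, hh]; simp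
    · field_simp
  rw [modelLift, q_ofComplex]
  generalize 1 / 2 * (m₁ (q x) * Real.log (rsq x)) = a
  generalize -(1 / 2) * (m₂ (q x) * Real.log (rsq x)) = b
  generalize h (q x) * (rsq x)⁻¹ ^ 1 = H at *
  have e : starRingEnd ℂ (Complex.exp (a + b * Complex.I) * cz x) *
      (Complex.exp (-a + b * Complex.I) * (cw x + H * cz x)) =
      starRingEnd ℂ (cz x) * cw x + ((H * rsq x : ℝ) : ℂ) := by
    have e1 : starRingEnd ℂ (cz x) * cz x = (rsq x : ℂ) := by
      rw [← normSq_cz, Complex.normSq_eq_conj_mul_self]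
    rw [map_mul]
    push_cast
    linear_combination (starRingEnd ℂ (cz x) * (cw x + H * cz x)) * conj_exp_mul_exp a b + H * e1
  rw [e, key]
  ext i
  fin_cases i
  · simp [q, cz, cw]; ring
  · simp [q, cz, cw]

theorem fderiv_q_eq (x u : R4) : fderiv ℝ q x u =
    ![(starRingEnd ℂ (cz u) * cw x + starRingEnd ℂ (cz x) * cw u).im,
      (starRingEnd ℂ (cz u) * cw x + starRingEnd ℂ (cz x) * cw u).re] := by
  ext i
  rw [fderiv_q]
  fin_cases i
  · simp [omegaCan, hamField, cz, cw]; ring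
  · simp [omegaCan, hamField, cz, cw]; ring

theorem fderiv_rsq_eq (x u : R4) : fderiv ℝ rsq x u = 2 * (starRingEnd ℂ (cz x) * cz u).re := by
  have hp : ∀ i : Fin 4, HasFDerivAt (fun x : R4 => x i)
      (ContinuousLinearMap.proj (R := ℝ) (φ := fun _ : Fin 4 => ℝ) i) x := fun i =>
    (ContinuousLinearMap.proj (R := ℝ) (φ := fun _ : Fin 4 => ℝ) i).hasFDerivAt
  have h1 : HasFDerivAt rsq _ x := ((hp 0).pow 2).add ((hp 2).pow 2)
  rw [h1.fderiv]
  simp [cz]; ring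

end ModelLift

/-! ### The model lift is a symplectic local diffeomorphism -/

section ModelLiftSymplectic

theorem fderiv_twisted {a b H : R4 → ℝ} {a' b' H' : R4 →L[ℝ] ℝ} {x : R4} (ha : HasFDerivAt a a' x)
    (hb : HasFDerivAt b b' x) (hH : HasFDerivAt H H' x) (u : R4) :
    fderiv ℝ (fun x => ofComplex (Complex.exp ((a x : ℂ) + b x * Complex.I) * cz x)
      (Complex.exp (-(a x : ℂ) + b x * Complex.I) * (cw x + H x * cz x))) x u =
    ofComplex (Complex.exp ((a x : ℂ) + b x * Complex.I) * (cz u + cz x * (a' u + b' u * Complex.I)))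
      (Complex.exp (-(a x : ℂ) + b x * Complex.I) * (cw u + H x * cz u + H' u * cz x +
        (cw x + H x * cz x) * (-a' u + b' u * Complex.I))) := by
  have hac : HasFDerivAt (fun x => (a x : ℂ)) (Complex.ofRealCLM.comp a') x :=
    Complex.ofRealCLM.hasFDerivAt.comp x ha
  have hbc : HasFDerivAt (fun x => (b x : ℂ)) (Complex.ofRealCLM.comp b') x :=
    Complex.ofRealCLM.hasFDerivAt.comp x hb
  have hHc : HasFDerivAt (fun x => (H x : ℂ)) (Complex.ofRealCLM.comp H') x :=
    Complex.ofRealCLM.hasFDerivAt.comp x hH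
  have h1 := ((hac.add (hbc.mul_const Complex.I)).cexp).mul (hasFDerivAt_cz x)
  have h2 := ((hac.neg.add (hbc.mul_const Complex.I)).cexp).mul
    ((hasFDerivAt_cw x).add (hHc.mul (hasFDerivAt_cz x)))
  refine (fderiv_ofComplex h1 h2 u).trans ?_
  congr 1
  · simp [czL_apply]; ring
  · simp [czL_apply, cwL_apply]; ring

/-- The cancellation behind symplecticity. Here `ρ = |z|²`, `L = log ρ`; `A`, `B`, `C` are the
second derivatives `h_aa`, `h_ab`, `h_bb`; `D`, `C` with a subscript are `dq₁`, `dq₂` on the two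
vectors; `M1`, `M2` are the differentials of `m₁`, `m₂`. Solving the relations for `hb`, `ha` and
all differentials leaves a rational identity in free variables. -/
theorem lift_identity {ρ L m₁ m₂ ha hb H A B C ru rv Hu Hv Cu Cv Du Dv M1u M1v M2u M2v : ℝ}
    (hρ : ρ ≠ 0) (R1 : (1 + hb) * (1 + m₁) = 1) (R2 : (1 + hb) * m₂ = ha)
    (e1u : (1 + hb) * M1u + (1 + m₁) * (Du * B + Cu * C) = 0)
    (e1v : (1 + hb) * M1v + (1 + m₁) * (Dv * B + Cv * C) = 0)
    (e2u : (1 + hb) * M2u + m₂ * (Du * B + Cu * C) = Du * A + Cu * B)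
    (e2v : (1 + hb) * M2v + m₂ * (Dv * B + Cv * C) = Dv * A + Cv * B)
    (eu : H * (2 * ru) + ρ * Hu = Du * ha + Cu * hb) (ev : H * (2 * rv) + ρ * Hv = Dv * ha + Cv * hb) :
    (ru * Hv - rv * Hu) +
      (1 / 2 * (m₁ * (ρ⁻¹ * (2 * ru)) + L * M1u) * (Cv + 2 * rv * H + ρ * Hv) -
        1 / 2 * (m₁ * (ρ⁻¹ * (2 * rv)) + L * M1v) * (Cu + 2 * ru * H + ρ * Hu)) +
      (-(1 / 2) * (m₂ * (ρ⁻¹ * (2 * ru)) + L * M2u) * Dv -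
        -(1 / 2) * (m₂ * (ρ⁻¹ * (2 * rv)) + L * M2v) * Du) = 0 := by
  obtain ⟨M, rfl⟩ : ∃ M, m₁ = M - 1 := ⟨1 + m₁, by ring⟩
  have hM : M ≠ 0 := by
    intro hM
    rw [hM] at R1
    norm_num at R1
  obtain rfl : hb = 1 / M - 1 := by
    field_simp
    linear_combination R1
  obtain rfl : ha = m₂ / M := by
    rw [← R2]; field_simp; ring
  obtain rfl : M1u = -M ^ 2 * (Du * B + Cu * C) := by
    field_simp at e1u
    linear_combination e1u
  obtain rfl : M1v = -M ^ 2 * (Dv * B + Cv * C) := by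
    field_simp at e1v
    linear_combination e1v
  obtain rfl : M2u = M * (Du * A + Cu * B - m₂ * (Du * B + Cu * C)) := by
    field_simp at e2u
    linear_combination e2u
  obtain rfl : M2v = M * (Dv * A + Cv * B - m₂ * (Dv * B + Cv * C)) := by
    field_simp at e2v
    linear_combination e2v
  obtain rfl : Hu = (Du * (m₂ / M) + Cu * (1 / M - 1) - H * (2 * ru)) / ρ := by
    rw [← eu]; field_simp; ring
  obtain rfl : Hv = (Dv * (m₂ / M) + Cv * (1 / M - 1) - H * (2 * rv)) / ρ := by
    rw [← ev]; field_simp; ring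
  field_simp
  ring

variable {h m₁ m₂ : R2 → ℝ}

theorem fderiv_apply_eq_add (l : R2 →L[ℝ] ℝ) (c : R2) :
    l c = c 0 * l (Pi.single 0 1) + c 1 * l (Pi.single 1 1) := by
  have e : c = c 0 • (Pi.single 0 1 : R2) + c 1 • (Pi.single 1 1 : R2) := by
    ext i; fin_cases i <;> simp
  conv_lhs => rw [e, map_add, map_smul, map_smul]
  simp

theorem IsLiftData.symplectic_of_rsq_ne_zero (D : IsLiftData h m₁ m₂) {x : R4} (hx : rsq x ≠ 0)
    (hr₁ : ∀ᶠ c in 𝓝 (q x), (1 + fderiv ℝ h c (Pi.single 1 1)) * (1 + m₁ c) = 1)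
    (hr₂ : ∀ᶠ c in 𝓝 (q x),
      (1 + fderiv ℝ h c (Pi.single 1 1)) * m₂ c = fderiv ℝ h c (Pi.single 0 1)) (u v : R4) :
    omegaCan (fderiv ℝ (modelLift h m₁ m₂) x u) (fderiv ℝ (modelLift h m₁ m₂) x v) = omegaCan u v := by
  have ha := (hasFDerivAt_flat_mul_log D.flat₁ x).const_mul (1 / 2)
  have hb := (hasFDerivAt_flat_mul_log D.flat₂ x).const_mul (-(1 / 2))
  have hHs : ContDiff ℝ 1 fun x => h (q x) * (rsq x)⁻¹ ^ 1 := contDiff_flat_mul_inv_pow 1 D.flat 1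
  have hH := (hHs.differentiable (by simp) x).hasFDerivAt
  set H' := fderiv ℝ (fun x => h (q x) * (rsq x)⁻¹ ^ 1) x with hH'
  have hF : ∀ u, fderiv ℝ (modelLift h m₁ m₂) x u = _ := fderiv_twisted ha hb hH
  rw [hF, hF, omegaCan_twisted _ _ _ _ _ _ _ _ _ _ _ _ _ _ _ (conj_exp_mul_exp _ _),
    ofComplex_cz_cw, ofComplex_cz_cw]
  have hQ1 : ∀ u, (starRingEnd ℂ (cz u) * cw x + starRingEnd ℂ (cz x) * cw u).re =
      fderiv ℝ q x u 1 := fun u => by rw [fderiv_q_eq]; rfl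
  have hQ0 : ∀ u, (starRingEnd ℂ (cz u) * cw x + starRingEnd ℂ (cz x) * cw u).im =
      fderiv ℝ q x u 0 := fun u => by rw [fderiv_q_eq]; rfl
  have hhs := D.flat.1.differentiable (by simp) (q x)
  have hqd := contDiff_q.differentiable (by simp) x
  -- derivative of `H ρ² = h ∘ q`
  have hHrel : ∀ u, (h (q x) * (rsq x)⁻¹ ^ 1) * (2 * (starRingEnd ℂ (cz x) * cz u).re) + rsq x * H' u =
      fderiv ℝ q x u 0 * fderiv ℝ h (q x) (Pi.single 0 1) +
        fderiv ℝ q x u 1 * fderiv ℝ h (q x) (Pi.single 1 1) := by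
    intro u
    have e : (fun x => (h (q x) * (rsq x)⁻¹ ^ 1) * rsq x) =ᶠ[𝓝 x] fun x => h (q x) := by
      filter_upwards [contDiff_rsq.continuous.continuousAt.eventually_ne hx] with y hy
      field_simp
    have h1 := (hH.mul (hasFDerivAt_rsq x)).unique
      ((hhs.hasFDerivAt.comp x hqd.hasFDerivAt).congr_of_eventuallyEq e)
    have h2 := congrArg (fun l => l u) h1
    simp only [add_apply, smul_apply, smul_eq_mul,
      ContinuousLinearMap.comp_apply, fderiv_rsq_eq] at h2
    rw [h2, fderiv_apply_eq_add]
  -- derivatives of the relations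
  have hD2 : HasFDerivAt (fderiv ℝ h) (fderiv ℝ (fderiv ℝ h) (q x)) (q x) :=
    ((D.flat.1.fderiv_right (m := ∞) (by simp)).differentiable (by simp) _).hasFDerivAt
  have hdir : ∀ w : R2, HasFDerivAt (fun c => fderiv ℝ h c w)
      ((ContinuousLinearMap.apply ℝ ℝ w).comp (fderiv ℝ (fderiv ℝ h) (q x))) (q x) := fun w =>
    (ContinuousLinearMap.apply ℝ ℝ w).hasFDerivAt.comp (q x) hD2
  have hm₁ := (D.flat₁.1.differentiable (by simp) (q x)).hasFDerivAt
  have hm₂ := (D.flat₂.1.differentiable (by simp) (q x)).hasFDerivAt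
  -- Symmetry of the Hessian of `h` lets the same `B` appear in both differentiated relations.
  have hsymm : fderiv ℝ (fderiv ℝ h) (q x) (Pi.single 0 1) (Pi.single 1 1) =
      fderiv ℝ (fderiv ℝ h) (q x) (Pi.single 1 1) (Pi.single 0 1) :=
    second_derivative_symmetric (f := h) (fun y => (D.flat.1.differentiable (by simp) y).hasFDerivAt)
      hD2 _ _
  have hsecond : ∀ w c : R2, fderiv ℝ (fderiv ℝ h) (q x) c w =
      c 0 * fderiv ℝ (fderiv ℝ h) (q x) (Pi.single 0 1) w +
        c 1 * fderiv ℝ (fderiv ℝ h) (q x) (Pi.single 1 1) w := fun w c =>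
    fderiv_apply_eq_add ((ContinuousLinearMap.apply ℝ ℝ w).comp (fderiv ℝ (fderiv ℝ h) (q x))) c
  have e1 : ∀ u, (1 + fderiv ℝ h (q x) (Pi.single 1 1)) * fderiv ℝ m₁ (q x) (fderiv ℝ q x u) +
      (1 + m₁ (q x)) * (fderiv ℝ q x u 0 * fderiv ℝ (fderiv ℝ h) (q x) (Pi.single 1 1) (Pi.single 0 1) +
        fderiv ℝ q x u 1 * fderiv ℝ (fderiv ℝ h) (q x) (Pi.single 1 1) (Pi.single 1 1)) = 0 := by
    intro u
    have h1 := (((hdir (Pi.single 1 1)).const_add 1).mul (hm₁.const_add 1)).unique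
      ((hasFDerivAt_const (1 : ℝ) (q x)).congr_of_eventuallyEq hr₁)
    have h2 := congrArg (fun l => l (fderiv ℝ q x u)) h1
    simp only [add_apply, smul_apply, smul_eq_mul,
      ContinuousLinearMap.comp_apply, ContinuousLinearMap.apply_apply,
      zero_apply] at h2
    rw [hsecond, hsymm] at h2
    exact h2
  have e2 : ∀ u, (1 + fderiv ℝ h (q x) (Pi.single 1 1)) * fderiv ℝ m₂ (q x) (fderiv ℝ q x u) +
      m₂ (q x) * (fderiv ℝ q x u 0 * fderiv ℝ (fderiv ℝ h) (q x) (Pi.single 1 1) (Pi.single 0 1) +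
        fderiv ℝ q x u 1 * fderiv ℝ (fderiv ℝ h) (q x) (Pi.single 1 1) (Pi.single 1 1)) =
      fderiv ℝ q x u 0 * fderiv ℝ (fderiv ℝ h) (q x) (Pi.single 0 1) (Pi.single 0 1) +
        fderiv ℝ q x u 1 * fderiv ℝ (fderiv ℝ h) (q x) (Pi.single 1 1) (Pi.single 0 1) := by
    intro u
    have h1 := (((hdir (Pi.single 1 1)).const_add 1).mul hm₂).unique
      ((hdir (Pi.single 0 1)).congr_of_eventuallyEq hr₂)
    have h2 := congrArg (fun l => l (fderiv ℝ q x u)) h1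
    simp only [add_apply, smul_apply, smul_eq_mul,
      ContinuousLinearMap.comp_apply, ContinuousLinearMap.apply_apply] at h2
    rw [hsecond, hsymm, hsecond (Pi.single 0 1) (fderiv ℝ q x u)] at h2
    exact h2
  have main := lift_identity (L := Real.log (rsq x)) hx hr₁.self_of_nhds hr₂.self_of_nhds (e1 u) (e1 v)
    (e2 u) (e2 v) (hHrel u) (hHrel v)
  simp only [hQ0, hQ1, normSq_cz, add_apply, smul_apply,
    smul_eq_mul, ContinuousLinearMap.comp_apply, fderiv_rsq_eq]
  linear_combination main

theorem continuous_omegaCan {f g : ℝ → R4} (hf : Continuous f) (hg : Continuous g) :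
    Continuous fun t => omegaCan (f t) (g t) := by
  unfold omegaCan
  fun_prop

/-- The plane `z = 0` is approached by moving `x₁`; the pulled-back form is continuous, so the
identity extends from `z ≠ 0`. -/
theorem IsLiftData.symplectic (D : IsLiftData h m₁ m₂) : ∀ᶠ x in 𝓝 (0 : R4), ∀ u v,
    omegaCan (fderiv ℝ (modelLift h m₁ m₂) x u) (fderiv ℝ (modelLift h m₁ m₂) x v) = omegaCan u v := by
  have hs := D.contDiff_modelLift
  filter_upwards [(q_tendsto.eventually (D.rel₁.eventually_nhds)).eventually_nhds,
    (q_tendsto.eventually (D.rel₂.eventually_nhds)).eventually_nhds] with x h1 h2 u v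
  by_cases hx : rsq x = 0
  · have e0 : x 0 = 0 := by
      unfold rsq at hx; nlinarith [sq_nonneg (x 0), sq_nonneg (x 2)]
    have hline : Continuous fun t : ℝ => x + t • (Pi.single 0 1 : R4) := by fun_prop
    have hfd : Continuous (fderiv ℝ (modelLift h m₁ m₂)) := hs.continuous_fderiv (by simp)
    have hc : Continuous fun t : ℝ =>
        omegaCan (fderiv ℝ (modelLift h m₁ m₂) (x + t • (Pi.single 0 1 : R4)) u)
          (fderiv ℝ (modelLift h m₁ m₂) (x + t • (Pi.single 0 1 : R4)) v) :=
      continuous_omegaCan ((hfd.comp hline).clm_apply continuous_const)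
        ((hfd.comp hline).clm_apply continuous_const)
    have ht := (hc.tendsto 0).mono_left (nhdsWithin_le_nhds (s := {0}ᶜ))
    have hl := (hline.tendsto 0).mono_left (nhdsWithin_le_nhds (s := {0}ᶜ))
    simp only [zero_smul, add_zero] at ht hl
    refine tendsto_nhds_unique_of_eventuallyEq ht tendsto_const_nhds ?_
    filter_upwards [hl.eventually h1, hl.eventually h2, self_mem_nhdsWithin] with t a1 a2 a3
    have a3 : t ≠ 0 := a3
    refine D.symplectic_of_rsq_ne_zero ?_ a1 a2 u v
    have : 0 < t ^ 2 := by positivity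
    simp only [rsq, Pi.add_apply, Pi.smul_apply, Pi.single_eq_same, e0]
    simp
    positivity
  · exact D.symplectic_of_rsq_ne_zero hx h1.self_of_nhds h2.self_of_nhds u v

/-- A smooth map that is symplectic near its fixed point `0` is a local diffeomorphism there. -/
theorem exists_diffeoGerm {F : R4 → R4} (hF : ContDiff ℝ ∞ F) (h0 : F 0 = 0)
    (hs : ∀ᶠ x in 𝓝 (0 : R4), ∀ u v, omegaCan (fderiv ℝ F x u) (fderiv ℝ F x v) = omegaCan u v) :
    ∃ φ : DiffeoGerm R4, φ.val = germ ⟨F, h0, Eventually.of_forall fun _ => hF.contDiffAt⟩ := by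
  have hequiv : ∀ x, (∀ u v, omegaCan (fderiv ℝ F x u) (fderiv ℝ F x v) = omegaCan u v) →
      ∃ e : R4 ≃L[ℝ] R4, (e : R4 →L[ℝ] R4) = fderiv ℝ F x := fun x hx =>
    ⟨(LinearEquiv.ofBijective (fderiv ℝ F x : R4 →ₗ[ℝ] R4)
      (bijective_of_symplectic hx)).toContinuousLinearEquiv, by ext; rfl⟩
  obtain ⟨e, he⟩ := hequiv 0 hs.self_of_nhds
  have hd0 : HasFDerivAt F (e : R4 →L[ℝ] R4) 0 := by
    rw [he]; exact (hF.differentiable (by simp) 0).hasFDerivAt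
  set P := (hF.contDiffAt (x := 0)).toOpenPartialHomeomorph F hd0 (by simp) with hP
  have hPF : ∀ x, P x = F x := fun x => rfl
  have hsrc : (0 : R4) ∈ P.source := ContDiffAt.mem_toOpenPartialHomeomorph_source _ hd0 (by simp)
  have htgt : (0 : R4) ∈ P.target := by
    have := P.map_source hsrc
    rwa [hPF, h0] at this
  have hsymm0 : P.symm 0 = 0 := by
    have := P.left_inv hsrc
    rwa [hPF, h0] at this
  have hts : Tendsto P.symm (𝓝 0) (𝓝 0) := by
    have := P.symm.continuousAt htgt
    rwa [ContinuousAt, hsymm0] at this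
  refine ⟨⟨germ ⟨F, h0, Eventually.of_forall fun _ => hF.contDiffAt⟩,
    germ ⟨P.symm, hsymm0, ?_⟩, ?_, ?_⟩, rfl⟩
  -- Smoothness of the inverse is needed on a whole neighbourhood; symplecticity makes the
  -- derivative invertible at every nearby point.
  · filter_upwards [P.open_target.mem_nhds htgt, hts.eventually hs] with y hy h1
    obtain ⟨e', he'⟩ := hequiv _ h1
    refine P.contDiffAt_symm hy (f₀' := e') ?_ hF.contDiffAt
    rw [he']
    exact (hF.differentiable (by simp) _).hasFDerivAt
  · rw [germ_mul, germ_one, germ_eq_iff]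
    filter_upwards [P.open_target.mem_nhds htgt] with y hy
    exact P.right_inv hy
  · rw [germ_mul, germ_one, germ_eq_iff]
    filter_upwards [P.open_source.mem_nhds hsrc] with y hy
    exact P.left_inv hy

end ModelLiftSymplectic

/-! ### The linear maps realizing the sign changes -/

section LinearModels

theorem signMap_apply (ε : ℤˣ × ℤˣ) (c : R2) :
    signMap ε c = ![((ε.1 : ℤ) : ℝ) * c 0, ((ε.2 : ℤ) : ℝ) * c 1] := rfl

theorem A_mul_apply (ε : ℤˣ × ℤˣ) (x : R4) :
    A ε x = (if ε.1 = -1 then A10 else 1) ((if ε.2 = -1 then A01 else 1) x) := rfl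

theorem forall_sign_pairs {p : ℤˣ × ℤˣ → Prop} (h₁ : p (1, 1)) (h₂ : p (-1, 1)) (h₃ : p (1, -1))
    (h₄ : p (-1, -1)) (ε : ℤˣ × ℤˣ) : p ε := by
  obtain ⟨a, b⟩ := ε
  rcases Int.units_eq_one_or a with rfl | rfl <;> rcases Int.units_eq_one_or b with rfl | rfl <;>
    assumption

theorem A_one_one (x : R4) : A (1, 1) x = x := by
  rw [A_mul_apply, if_neg (by decide), if_neg (by decide)]; rfl

theorem A_neg_one (x : R4) : A (-1, 1) x = ![x 2, x 3, x 0, x 1] := by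
  rw [A_mul_apply, if_pos rfl, if_neg (by decide)]; rfl

theorem A_one_neg (x : R4) : A (1, -1) x = ![x 1, -x 0, x 3, -x 2] := by
  rw [A_mul_apply, if_neg (by decide), if_pos rfl]; rfl

theorem A_neg_neg (x : R4) : A (-1, -1) x = ![x 3, -x 2, x 1, -x 0] := by
  rw [A_mul_apply, if_pos rfl, if_pos rfl]; rfl

theorem omegaCan_A (ε : ℤˣ × ℤˣ) (u v : R4) : omegaCan (A ε u) (A ε v) = omegaCan u v := by
  revert ε
  apply forall_sign_pairs <;>
    simp only [A_one_one, A_neg_one, A_one_neg, A_neg_neg, omegaCan, Matrix.cons_val] <;> ring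

theorem q_A (ε : ℤˣ × ℤˣ) (x : R4) : q (A ε x) = signMap ε (q x) := by
  revert ε
  apply forall_sign_pairs <;>
    simp only [A_one_one, A_neg_one, A_one_neg, A_neg_neg, q, signMap_apply, Matrix.cons_val] <;>
    ext i <;> fin_cases i <;> simp <;> ring

theorem A_mul_comm (ε ε' : ℤˣ × ℤˣ) : A ε * A ε' = A ε' * A ε := by
  refine ContinuousLinearEquiv.ext (funext fun x => ?_)
  change A ε (A ε' x) = A ε' (A ε x)
  revert ε ε'
  refine forall_sign_pairs ?_ ?_ ?_ ?_ <;> refine forall_sign_pairs ?_ ?_ ?_ ?_ <;>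
    simp [A_one_one, A_neg_one, A_one_neg, A_neg_neg]

/-- `A10` and `A01` commute, `A10² = 1` and `A01² = -1`, so a sign appears exactly when both second
entries are `-1`. -/
theorem A_mul_eq_or (ε ε' : ℤˣ × ℤˣ) :
    (∀ x, A (ε * ε') x = A ε (A ε' x)) ∨ (∀ x, A (ε * ε') x = -A ε (A ε' x)) := by
  revert ε ε'
  refine forall_sign_pairs ?_ ?_ ?_ ?_ <;> refine forall_sign_pairs ?_ ?_ ?_ ?_ <;>
    first
    | (refine Or.inl fun x => ?_
       simp [A_one_one, A_neg_one, A_one_neg, A_neg_neg, funext_iff, Fin.forall_fin_succ]; done)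
    | (refine Or.inr fun x => ?_
       simp [A_one_one, A_neg_one, A_one_neg, A_neg_neg, funext_iff, Fin.forall_fin_succ])

theorem signMap_injective {ε ε' : ℤˣ × ℤˣ} (h : ∀ x, signMap ε (q x) = signMap ε' (q x)) : ε = ε' := by
  -- At this point `q = (1, 1)`, so both signs can be read off.
  have h1 := congrFun (h ![1, 1, 0, 1]) 0
  have h2 := congrFun (h ![1, 1, 0, 1]) 1
  simp [signMap_apply, q] at h1 h2
  exact Prod.ext (Units.ext (by exact_mod_cast h1)) (Units.ext (by exact_mod_cast h2))

theorem q_neg (x : R4) : q (-x) = q x := by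
  ext i; fin_cases i <;> simp [q]

/-- As `q` is even, `±A ε` induces `signMap ε` on the base, which determines `ε`. -/
theorem A_injective {ε ε' : ℤˣ × ℤˣ}
    (h : (∀ x, A ε x = A ε' x) ∨ (∀ x, A ε x = -A ε' x)) : ε = ε' := by
  refine signMap_injective fun x => ?_
  rcases h with h | h
  · rw [← q_A, ← q_A, h]
  · rw [← q_A, ← q_A, h, q_neg]

theorem isSymplectic_linearGerm (ε : ℤˣ × ℤˣ) : IsSymplectic (linearGerm (A ε)).val := by
  change IsSymplectic (germ (PointedMap.ofLinear (A ε : R4 →L[ℝ] R4)))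
  rw [isSymplectic_germ]
  refine Eventually.of_forall fun x u v => ?_
  have : fderiv ℝ (PointedMap.ofLinear (A ε : R4 →L[ℝ] R4)).toFun x = (A ε : R4 →L[ℝ] R4) :=
    (A ε : R4 →L[ℝ] R4).fderiv
  rw [this]
  exact omegaCan_A ε u v

theorem intertwines_linearGerm (ε : ℤˣ × ℤˣ) :
    Intertwines (linearGerm (A ε)).val (linearGerm (signMap ε)).val := by
  change Intertwines (germ (PointedMap.ofLinear (A ε : R4 →L[ℝ] R4)))
    (germ (PointedMap.ofLinear (signMap ε : R2 →L[ℝ] R2)))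
  rw [intertwines_germ]
  exact Eventually.of_forall fun x => q_A ε x

end LinearModels

/-! ### Every element of `G` lifts -/

section Sufficiency

theorem exists_lift_of_hasFlatForm {g : DiffeoGerm R2} (hg : HasFlatForm g.val) :
    ∃ φ : DiffeoGerm R4, IsSymplectic φ.val ∧ Intertwines φ.val g.val := by
  obtain ⟨k, hk, ε, h₀, hh, e⟩ := hg
  -- `g` is the sign change after `(a, b) ↦ (a, b + ε₂ h₀)`, because `ε₂² = 1`.
  obtain ⟨h, m₁, m₂, eh, D⟩ := exists_isLiftData (hh.const_mul ((ε.2 : ℤ) : ℝ))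
  obtain ⟨φ, hφ⟩ := exists_diffeoGerm D.contDiff_modelLift modelLift_zero D.symplectic
  have hs : IsSymplectic φ.val := by
    rw [hφ, isSymplectic_germ]
    exact D.symplectic
  refine ⟨linearGerm (A ε) * φ, (isSymplectic_linearGerm ε).mul hs, ?_⟩
  rw [Units.val_mul, hφ, ← hk]
  change Intertwines (germ (PointedMap.ofLinear (A ε : R4 →L[ℝ] R4)) * germ _) _
  rw [germ_mul, intertwines_germ]
  filter_upwards [q_tendsto.eventually e, q_tendsto.eventually eh] with x h1 h2
  change q (A ε (modelLift h m₁ m₂ x)) = _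
  rw [q_A, q_modelLift D.flat.apply_zero, h1, h2, signMap_apply]
  have s : ((ε.2 : ℤ) : ℝ) * ((ε.2 : ℤ) : ℝ) = 1 := by
    exact_mod_cast Int.units_coe_mul_self ε.2
  ext i
  fin_cases i
  · simp
  · simp only [Pi.smul_apply, smul_eq_mul]
    change ((ε.2 : ℤ) : ℝ) * (q x 1 + ((ε.2 : ℤ) : ℝ) * h₀ (q x)) = ((ε.2 : ℤ) : ℝ) * q x 1 + h₀ (q x)
    linear_combination h₀ (q x) * s

end Sufficiency

/-! ### The homomorphism from `Aut` onto `G` -/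

section BaseMap

theorem Aut.exists_base (φ : Aut) : ∃ g : G, Intertwines φ.val.val g.val.val := by
  obtain ⟨h1, g, h2⟩ := φ.2
  exact ⟨⟨g, hasFlatForm_of_intertwines h1 h2⟩, h2⟩

/-- The homomorphism sending `φ` to the germ `g` with `q ∘ φ = g ∘ q`. -/
noncomputable def baseMap : Aut →* G :=
  MonoidHom.mk' (fun φ => (Aut.exists_base φ).choose) fun φ ψ => by
    refine Subtype.ext (Units.ext (intertwines_unique (Aut.exists_base (φ * ψ)).choose_spec ?_))
    exact (Aut.exists_base φ).choose_spec.mul (Aut.exists_base ψ).choose_spec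

theorem intertwines_baseMap (φ : Aut) : Intertwines φ.val.val (baseMap φ).val.val :=
  (Aut.exists_base φ).choose_spec

theorem intertwines_iff_eq_baseMap (φ : Aut) (g : DiffeoGerm R2) :
    Intertwines φ.val.val g.val ↔ g = (baseMap φ).val :=
  ⟨fun h => Units.ext (intertwines_unique h (intertwines_baseMap φ)),
    fun h => h ▸ intertwines_baseMap φ⟩

theorem baseMap_surjective : Function.Surjective baseMap := by
  intro g
  obtain ⟨φ, h1, h2⟩ := exists_lift_of_hasFlatForm g.2
  exact ⟨⟨φ, h1, g.val, h2⟩, Subtype.ext ((intertwines_iff_eq_baseMap _ _).1 h2).symm⟩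

end BaseMap

end FocusFocus
theorem mainTheorem4 :
    -- a germ `g` occurs in a pair `(φ, g)` with `q ∘ φ = g ∘ q` if and only if `g ∈ G`
    (∀ g : FocusFocus.DiffeoGerm FocusFocus.R2,
      (∃ φ : FocusFocus.DiffeoGerm FocusFocus.R4,
        FocusFocus.IsSymplectic φ.val ∧ FocusFocus.Intertwines φ.val g.val) ↔
      g ∈ FocusFocus.G) ∧
    -- `φ ↦ g` is a well-defined homomorphism `Aut → G`; it is onto, and `A_ε ↦ g_ε`
    (∃ Φ : FocusFocus.Aut →* FocusFocus.G,
      (∀ (φ : FocusFocus.Aut) (g : FocusFocus.DiffeoGerm FocusFocus.R2),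
        FocusFocus.Intertwines φ.val.val g.val ↔ g = (Φ φ).val) ∧
      Function.Surjective Φ ∧
      ∀ ε : ℤˣ × ℤˣ, ∃ hA : FocusFocus.linearGerm (FocusFocus.A ε) ∈ FocusFocus.Aut,
        (Φ ⟨FocusFocus.linearGerm (FocusFocus.A ε), hA⟩).val =
          FocusFocus.linearGerm (FocusFocus.signMap ε)) ∧
    -- the `A_ε` are linear symplectomorphisms of `ℝ⁴` with `q ∘ A_ε = g_ε ∘ q` everywhere
    (∀ ε : ℤˣ × ℤˣ,
      (∀ u v : FocusFocus.R4,
        FocusFocus.omegaCan (FocusFocus.A ε u) (FocusFocus.A ε v) = FocusFocus.omegaCan u v) ∧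
      ∀ x : FocusFocus.R4,
        FocusFocus.q (FocusFocus.A ε x) = FocusFocus.signMap ε (FocusFocus.q x)) ∧
    -- the `A_ε` commute, and `ε ↦ A_ε` is an injective homomorphism modulo `± 1`
    (∀ ε ε' : ℤˣ × ℤˣ,
      FocusFocus.A ε * FocusFocus.A ε' = FocusFocus.A ε' * FocusFocus.A ε ∧
      ((∀ x, FocusFocus.A (ε * ε') x = FocusFocus.A ε (FocusFocus.A ε' x)) ∨
        (∀ x, FocusFocus.A (ε * ε') x = -FocusFocus.A ε (FocusFocus.A ε' x))) ∧
      (((∀ x, FocusFocus.A ε x = FocusFocus.A ε' x) ∨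
        (∀ x, FocusFocus.A ε x = -FocusFocus.A ε' x)) → ε = ε')) := by
  refine ⟨fun g => ⟨fun ⟨φ, h1, h2⟩ => FocusFocus.hasFlatForm_of_intertwines h1 h2,
    fun hg => FocusFocus.exists_lift_of_hasFlatForm hg⟩,
    ⟨FocusFocus.baseMap, FocusFocus.intertwines_iff_eq_baseMap, FocusFocus.baseMap_surjective,
      fun ε => ?_⟩,
    fun ε => ⟨FocusFocus.omegaCan_A ε, FocusFocus.q_A ε⟩,
    fun ε ε' => ⟨FocusFocus.A_mul_comm ε ε', FocusFocus.A_mul_eq_or ε ε', FocusFocus.A_injective⟩⟩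
  exact ⟨⟨FocusFocus.isSymplectic_linearGerm ε, _, FocusFocus.intertwines_linearGerm ε⟩,
    ((FocusFocus.intertwines_iff_eq_baseMap _ _).1 (FocusFocus.intertwines_linearGerm ε)).symm⟩
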